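/- Let $\Phi$ be a reduced simply-laced (finite crystallographic) root system, not necessarily irreducible, with simple roots $\alpha_1,\dots,\alpha_r$, positive roots $\Phi^+$, Weyl group $W$ generated by the simple reflections $\sigma_1,\dots,\sigma_r$, root lattice $\Lambda=\bigoplus_i\mathbb Z\alpha_i$ and $\rho=\tfrac12\sum_{\alpha\in\Phi^+}\alpha$. Write $i\sim j$ if the nodes $i,j$ of the Dynkin diagram are adjacent, $d(\sum k_i\alpha_i)=\sum k_i$, $\mathbf x^{\sum k_i\alpha_i}=\prod x_i^{k_i}$, and $\lambda\le\mu$ if $\mu-\lambda$ is a nonnegative integral combination of simple roots. **(1)** Let $\mathfrak g$ be a complex semisimple Lie algebra with root system $\Phi$ with respect to a Cartan subalgebra, and let $V_\rho$ be the finite-dimensional irreducible representation of $\mathfrak g$ of highest weight $\rho$. Then $\rho$ is the only weight of $V_\rho$ that is both dominant and regular (that is, lies on no reflection hyperplane of $W$). **(2)** Let $q$ be a prime power. Put $(\sigma_i\mathbf x)_j=x_ix_j\sqrt q$ if $i\sim j$, $(\sigma_i\mathbf x)_i=1/(qx_i)$, and $(\sigma_i\mathbf x)_j=x_j$ otherwise;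 let $\epsilon_i\mathbf x$ be $\mathbf x$ with $x_j$ replaced by $-x_j$ for all $j\sim i$. For $f\in\mathbb C(x_1,\dots,x_r)$ put $f_i^\pm(\mathbf x)=\tfrac12\bigl(f(\mathbf x)\pm f(\epsilon_i\mathbf x)\bigr)$ and $$(f|\sigma_i)(\mathbf x)=-\frac{1-qx_i}{qx_i(1-x_i)}\,f_i^+(\sigma_i\mathbf x)+\frac1{x_i\sqrt q}\,f_i^-(\sigma_i\mathbf x);$$ this extends to a right action of $W$ on $\mathbb C(x_1,\dots,x_r)$, and likewise $f(\mathbf x)\mapsto f(w\mathbf x)$ denotes the right action extending $f(\mathbf x)\mapsto f(\sigma_i\mathbf x)$. Let $$\Delta(\mathbf x)=\prod_{\alpha\in\Phi^+}(1-q^{d(\alpha)}\mathbf x^{2\alpha}),\qquad D(\mathbf x)=\prod_{\alpha\in\Phi^+}(1-q^{d(\alpha)-1}\mathbf x^{2\alpha}),$$ $$N(\mathbf x)=D(\mathbf x)\,\Delta(\mathbf x)^{-1}\sum_{w\in W}\frac{\Delta(\mathbf x)}{\Delta(w\mathbf x)}\,(1|w)(\mathbf x).$$ Then $N(\mathbf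 x)=\sum_{\lambda\in\Lambda} a_\lambda\mathbf x^\lambda$ is a polynomial, and it is the unique polynomial in $\mathbb C[x_1,\dots,x_r]$ (with $a_\lambda=0$ when $\lambda$ has a negative coordinate) such that $a_0=1$ and, for all $k$ and all $\lambda,\mu\in\Lambda$ with $\mu=\sigma_k\lambda+\alpha_k$ and $\lambda\le\mu$, with $\mu=\sum_j\mu_j\alpha_j$, $\varphi_k(\mu)=\sum_{j\sim k}\mu_j$ and $\beta=\lambda-\mu+\alpha_k$, $$q\,a_{\lambda-\alpha_k}+a_\lambda=q^{d(\beta)/2}\bigl(a_\mu+a_{\mu+\alpha_k}/q\bigr)\quad\text{if }\varphi_k(\mu)\text{ is even},$$ $$q^2a_{\lambda-2\alpha_k}-a_\lambda=\sqrt q\,q^{d(\beta)/2}\bigl(a_\mu-a_{\mu+2\alpha_k}/q^2\bigr)\quad\text{if }\varphi_k(\mu)\text{ is odd}.$$ -/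

import Mathlib

namespace WeylMDS

noncomputable section

/-! ### Regular dominant weights of a representation of a semisimple Lie algebra -/

section Weights

open LieAlgebra.IsKilling

variable {ι : Type*} {L : Type*} [LieRing L] [LieAlgebra ℂ L]
  [FiniteDimensional ℂ L] [LieAlgebra.IsKilling ℂ L]
  (H : LieSubalgebra ℂ L) [H.IsCartanSubalgebra]

/-- `χ` is a weight of the `L`-module `V`: some nonzero vector is a simultaneous eigenvector
of the Cartan subalgebra `H` with eigenvalue `χ`. -/
def IsWeight (V : Type*) [AddCommGroup V] [Module ℂ V] [LieRingModule L V] [LieModule ℂ L V]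
    (χ : Module.Dual ℂ H) : Prop :=
  ∃ v : V, v ≠ 0 ∧ ∀ h : H, ⁅(h : L), v⁆ = χ h • v

/-- `χ` is a highest weight of `V`, where the roots `e i` with `pos i` are the positive ones:
some nonzero vector of weight `χ` is annihilated by all positive root spaces. -/
def IsHighestWeight (V : Type*) [AddCommGroup V] [Module ℂ V] [LieRingModule L V]
    [LieModule ℂ L V] (e : ι ≃ H.root) (pos : ι → Prop) (χ : Module.Dual ℂ H) : Prop :=
  ∃ v : V, v ≠ 0 ∧ (∀ h : H, ⁅(h : L), v⁆ = χ h • v) ∧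
    ∀ i, pos i → ∀ x ∈ LieAlgebra.rootSpace H ((rootSystem H).root (e i)), ⁅x, v⁆ = 0

/-- `χ` is a dominant (integral) weight, where the `e i` with `simple i` are the simple roots. -/
def IsDominant (e : ι ≃ H.root) (simple : ι → Prop) (χ : Module.Dual ℂ H) : Prop :=
  ∀ i, simple i → ∃ n : ℕ, χ ((rootSystem H).coroot (e i)) = n

/-- `χ` is regular: it lies on no reflection hyperplane of the Weyl group. -/
def IsRegular (χ : Module.Dual ℂ H) : Prop :=
  ∀ α : H.root, χ ((rootSystem H).coroot α) ≠ 0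

/-- Half the sum of the positive roots, the roots `e i` with `pos i` being the positive ones. -/
def halfSum [Fintype ι] (e : ι ≃ H.root) (pos : ι → Prop) : Module.Dual ℂ H :=
  open Classical in (1 / 2 : ℂ) • ∑ i with pos i, (rootSystem H).root (e i)

end Weights

/-! ### The root lattice in coordinates, and words in the simple reflections -/

section RootData

variable {ι M M' : Type*} [AddCommGroup M] [Module ℝ M] [AddCommGroup M'] [Module ℝ M']
  {P : RootPairing ι ℝ M M'} (b : P.Base)

/-- The root lattice: `k : Lattice b` stands for `∑ j, k j • α j`, the sum being over the simple
roots. Its pointwise order is the order in which `lam ≤ mu` means that `mu - lam` is a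
sum of simple roots with nonnegative coefficients. -/
abbrev Lattice : Type _ := b.support → ℤ

/-- The simple root `α k` as an element of the root lattice. -/
def simpleRoot (k : b.support) : Lattice b := open Classical in Pi.single k 1

/-- The coordinates of the root with index `i` in the basis of simple roots. -/
def rootCoord (i : ι) : Lattice b := fun j ↦ b.toWeightBasisInt.repr (P.rootSpanMem ℤ i) j

/-- The height function `d` on the root lattice. -/
def ht (lam : Lattice b) : ℤ := ∑ j, lam j

/-- The simple roots `α i` and `α j` are adjacent in the Dynkin diagram. -/
def Adj [P.IsCrystallographic] (i j : b.support) : Prop := i ≠ j ∧ b.cartanMatrix i j ≠ 0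

/-- The simple reflection `σ k` on the root lattice:
`σ k lam = lam - ⟨lam, coroot k⟩ • α k`. -/
def simpleRefl [P.IsCrystallographic] (k : b.support) (lam : Lattice b) : Lattice b :=
  lam - (∑ j, lam j * b.cartanMatrix j k) • simpleRoot b k

/-- The product in the Weyl group of a word in the simple reflections. -/
def wordProd (l : List b.support) : P.weylGroup :=
  (l.map fun i ↦ RootPairing.weylGroup.ofIdx P i).prod

/-- The reflection in `σ_j α_i` is `σ_j σ_i σ_j`. -/
theorem reflection_conj (i j : ι) :
    RootPairing.Equiv.reflection P (P.reflectionPerm j i) =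
      RootPairing.Equiv.reflection P j * RootPairing.Equiv.reflection P i *
        RootPairing.Equiv.reflection P j := by
  apply RootPairing.Equiv.weightHom_injective
  ext m
  simp [P.reflection_reflectionPerm]

/-- The simple reflections generate the Weyl group. -/
theorem exists_word [Finite ι] [P.IsCrystallographic] [P.IsReduced]
    (w : P.weylGroup) : ∃ l : List b.support, wordProd b l = w := by
  have coe_prod (l : List b.support) : ((wordProd b l : P.weylGroup) : RootPairing.Aut P) =
      (l.map fun i : b.support ↦ RootPairing.Equiv.reflection P (i : ι)).prod := by
    simp [wordProd, RootPairing.weylGroup.ofIdx, Function.comp_def]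
  suffices h : ∀ g (_ : g ∈ P.weylGroup), ∃ l : List b.support,
      (l.map fun i : b.support ↦ RootPairing.Equiv.reflection P (i : ι)).prod = g by
    obtain ⟨l, hl⟩ := h w.1 w.2
    exact ⟨l, Subtype.ext ((coe_prod l).trans hl)⟩
  intro g hg
  induction hg using RootPairing.weylGroup.induction with
  | mem i =>
    refine b.induction_reflect (p := fun i ↦ ∃ l : List b.support,
      (l.map fun i : b.support ↦ RootPairing.Equiv.reflection P (i : ι)).prod =
        RootPairing.Equiv.reflection P i) i ?_ ?_ ?_
    · rintro i ⟨l, hl⟩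
      refine ⟨l, ?_⟩
      rw [reflection_conj, hl]
      have := RootPairing.Equiv.reflection_inv P i
      rw [inv_eq_iff_mul_eq_one] at this
      rw [this, one_mul]
    · intro i hi
      exact ⟨[⟨i, hi⟩], by simp⟩
    · rintro i j ⟨l, hl⟩ hj
      refine ⟨⟨j, hj⟩ :: (l ++ [⟨j, hj⟩]), ?_⟩
      rw [reflection_conj, ← hl, List.map_cons, List.prod_cons, List.map_append,
        List.prod_append, List.map_singleton, List.prod_singleton, mul_assoc]
  | one => exact ⟨[], rfl⟩
  | mul x y hx hy ihx ihy =>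
    obtain ⟨l, rfl⟩ := ihx
    obtain ⟨l', rfl⟩ := ihy
    exact ⟨l ++ l', by simp⟩

/-- A word in the simple reflections whose product is `w`. -/
def word [Finite ι] [P.IsCrystallographic] [P.IsReduced] (w : P.weylGroup) : List b.support :=
  (exists_word b w).choose

end RootData

/-! ### Rational functions in several variables -/

section RatFun

variable (σ : Type*)

/-- The field `ℂ(x)` of rational functions in the variables `x j`, `j : σ`. -/
abbrev RatField : Type _ := FractionRing (MvPolynomial σ ℂ)

variable {σ}

/-- The variable `x j` as a rational function. -/
def x (j : σ) : RatField σ := algebraMap (MvPolynomial σ ℂ) (RatField σ) (MvPolynomial.X j)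

/-- The constant rational function `c`. -/
def const (c : ℂ) : RatField σ := algebraMap (MvPolynomial σ ℂ) (RatField σ) (MvPolynomial.C c)

/-- The Laurent monomial with exponent vector `k`. -/
def mono [Fintype σ] (k : σ → ℤ) : RatField σ := ∏ j, x j ^ k j

/-- Substitution of `v j` for `x j` in a rational function, numerator and denominator being in
lowest terms. All substitutions below are invertible, so the denominator never becomes zero. -/
def subst (v : σ → RatField σ) (f : RatField σ) : RatField σ :=
  MvPolynomial.aeval v (IsFractionRing.num (MvPolynomial σ ℂ) f) /
    MvPolynomial.aeval v (IsFractionRing.den (MvPolynomial σ ℂ) f : MvPolynomial σ ℂ)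

/-- The coefficient of a polynomial at an integral exponent vector (zero if some exponent
is negative). -/
def coeffZ [Finite σ] (N : MvPolynomial σ ℂ) (k : σ → ℤ) : ℂ :=
  open Classical in
  if ∀ j, 0 ≤ k j then N.coeff (Finsupp.equivFunOnFinite.symm fun j ↦ (k j).toNat) else 0

end RatFun

/-! ### The twisted action, the averaged rational function and its numerator -/

section Denominators

variable {ι M M' : Type*} [Fintype ι] [AddCommGroup M] [Module ℝ M] [AddCommGroup M']
  [Module ℝ M'] {P : RootPairing ι ℝ M M'} (b : P.Base) (q : ℕ)

/-- `Δ(x) = ∏_{α > 0} (1 - q ^ d(α) x ^ (2 α))`. -/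
def Delta : RatField b.support :=
  open Classical in
  ∏ i with b.IsPos i, (1 - const q ^ ht b (rootCoord b i) * mono (2 • rootCoord b i))

/-- `D(x) = ∏_{α > 0} (1 - q ^ (d(α) - 1) x ^ (2 α))`. -/
def denom : RatField b.support :=
  open Classical in
  ∏ i with b.IsPos i, (1 - const q ^ (ht b (rootCoord b i) - 1) * mono (2 • rootCoord b i))

end Denominators

section Average

variable {ι M M' : Type*} [AddCommGroup M] [Module ℝ M] [AddCommGroup M'] [Module ℝ M']
  {P : RootPairing ι ℝ M M'} [P.IsCrystallographic] (b : P.Base) (q : ℕ)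
  (l : b.support → ℕ)

/-- The complex number `√q`. -/
def sqrtq : ℂ := (Real.sqrt q : ℂ)

/-- The point `σ i x`. -/
def reflPt (i : b.support) : b.support → RatField b.support := fun j ↦
  open Classical in
  if j = i then 1 / (const q * x j)
  else if Adj b i j then x i * x j * const (sqrtq q) else x j

/-- The point `ε i x`. -/
def signPt (i : b.support) : b.support → RatField b.support := fun j ↦
  open Classical in if Adj b i j then -x j else x j

/-- The part `f⁺` of `f` with respect to `i` and the twisting parameter `l`. -/
def plusPart (i : b.support) (f : RatField b.support) : RatField b.support :=
  (f + (-1) ^ l i * subst (signPt b i) f) / 2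

/-- The part `f⁻` of `f` with respect to `i` and the twisting parameter `l`. -/
def minusPart (i : b.support) (f : RatField b.support) : RatField b.support :=
  (f - (-1) ^ l i * subst (signPt b i) f) / 2

/-- The `l`-twisted action `f ∣ σ i` of a simple reflection on rational functions. -/
def slashSimple (i : b.support) (f : RatField b.support) : RatField b.support :=
  -((1 - const q * x i) / (const q * x i * (1 - x i))) * (x i * const (sqrtq q)) ^ l i *
      subst (reflPt b q i) (plusPart b l i f) +
    1 / (x i * const (sqrtq q)) * (x i * const (sqrtq q)) ^ l i *
      subst (reflPt b q i) (minusPart b l i f)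

variable [P.IsReduced]

/-- The `l`-twisted right action `f ∣ w` of the Weyl group on rational functions, computed along a
word for `w` by `f ∣ (σ i₁ ⋯ σ iₘ) = (⋯ (f ∣ σ i₁) ⋯) ∣ σ iₘ`. The result does not depend on
the word. -/
def slash [Finite ι] (w : P.weylGroup) (f : RatField b.support) : RatField b.support :=
  (word b w).foldl (fun g i ↦ slashSimple b q l i g) f

/-- The rational function `f (w x)`, where `(σ i₁ ⋯ σ iₘ) x = σ i₁ (⋯ (σ iₘ x))`. -/
def translate [Finite ι] (w : P.weylGroup) (f : RatField b.support) : RatField b.support :=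
  (word b w).foldl (fun g i ↦ subst (reflPt b q i) g) f

variable [Fintype ι]

/-- `j(w, x) = Δ(x) / Δ(w x)`. -/
def cocycle (w : P.weylGroup) : RatField b.support := Delta b q / translate b q w (Delta b q)

/-- The averaged rational function `f(x; l) = Δ(x)⁻¹ ∑_w j(w, x) (1 ∣ w)(x)`. -/
def average : RatField b.support :=
  (Delta b q)⁻¹ * ∑ᶠ w : P.weylGroup, cocycle b q w * slash b q l w 1

/-- The numerator `N(x; l) = f(x; l) D(x)`. -/
def numerator : RatField b.support := average b q l * denom b q

end Average

/-! ### The functional equations of the coefficients -/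

section FunctionalEquations

variable {ι M M' : Type*} [AddCommGroup M] [Module ℝ M] [AddCommGroup M'] [Module ℝ M']
  {P : RootPairing ι ℝ M M'} [P.IsCrystallographic] (b : P.Base) (q : ℕ)
  (l : b.support → ℕ)

/-- `φ k (mu) = l k + ∑ mu j`, the sum being over the `j` adjacent to `k`. -/
def phi (k : b.support) (mu : Lattice b) : ℤ :=
  open Classical in (l k : ℤ) + ∑ j with Adj b j k, mu j

/-- The functional equations of a family `a` of coefficients indexed by the root lattice. -/
def CoeffFE (a : Lattice b → ℂ) : Prop :=
  ∀ (k : b.support) (lam mu : Lattice b),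
    mu = simpleRefl b k lam + (l k + 1) • simpleRoot b k → lam ≤ mu →
    (Even (phi b l k mu) →
      q * a (lam - simpleRoot b k) + a lam =
        sqrtq q ^ ht b (lam - mu + simpleRoot b k) *
          (a mu + a (mu + simpleRoot b k) / q)) ∧
    (Odd (phi b l k mu) →
      q ^ 2 * a (lam - 2 • simpleRoot b k) - a lam =
        sqrtq q * sqrtq q ^ ht b (lam - mu + simpleRoot b k) *
          (a mu - a (mu + 2 • simpleRoot b k) / q ^ 2))

end FunctionalEquations

end

end WeylMDS

/-!
# The numerator of the Weyl group average and its coefficients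

Throughout, `y k = √q * x k` is the rescaled variable, `t = 1 / √q`, and `Y ^ lam` is the monomial
with exponent `lam` in the `y k`. In these terms the substitution `σ k` is the linear action
`Y ^ lam ↦ Y ^ (σ k lam)` of the simple reflection, `ε k` multiplies `Y ^ lam` by the sign
`(-1) ^ ⟨lam, coroot k⟩`, and
`f ∣ σ k = (y - t) / (y (1 - t y)) * f⁺(σ k x) + y⁻¹ * f⁻(σ k x)` with `y = y k`.

*Invariance.* The operators `f ↦ f ∣ σ k` are involutions and satisfy the braid relations. Their
composition along a word therefore depends on its product in `W` only: this is proved by induction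
on the inversions of the product (`foldl_eq_of_wordProd_eq`). Even factors can be pulled out of the
action, so that the average is `∑ w, Δ⁻¹ ∣ w`, and it is invariant under the action
(`slashSimple_average`).

*Polynomiality.* Along a reduced word for `w` the term `Δ * (Δ⁻¹ ∣ w)` acquires denominators only
from the factors of `D` at the inversions of `w`, and once these are cleared each of its exponents
is a sum of all inversions with positive multiplicities
(`prod_denomFactor_mul_mem_positiveSpan`). So `D * Δ * average` is a polynomial with constant
term one. It is divisible by `Δ`: the invariance under `σ k` forces it to vanish modulo
`1 - Y ^ (2 α k)` (`oneSub_simpleRoot_dvd`), hence the average has no pole along this divisor, and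
the invariance under the other simple reflections carries this over to the divisors of all positive
roots (`isRegularAlong_average`). As the factors of `Δ` are not zero divisors modulo each other, `Δ`
divides the product as a Laurent polynomial, and as no variable divides `Δ`, the quotient, which is
the numerator, is a polynomial (`isPolyWithConst_numerator`).

*Functional equations.* Comparing coefficients in the invariance of the even and the odd part of the
numerator (`numerator_even_odd`) gives the functional equations of the coefficients. They have at
most one solution of finite support with given constant term (`CoeffFE.eq_zero`). Indeed, let `mu`
be nonzero, of minimal height in the support of a solution without constant term. As the Cartan
matrix is positive definite, `⟨mu, coroot k⟩ > 0` for some `k` (`exists_latticePairing_pos`). The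
functional equations for `k` relate the coefficients on the string through `mu` in direction `α k`
above `mu` to those below `mu`, which vanish; descending from the top of the string, the coefficient
at `mu` vanishes as well.

*Weights.* The module `V_ρ` is generated from its highest weight vector by the root vectors of
the negative roots (`loweringSpan_eq_top`), so that its weights are `ρ - lam` with `lam ≥ 0` in the
root lattice. As `ρ` pairs to one with each simple coroot, `ρ - lam` is dominant and regular only if
`⟨lam, coroot k⟩ ≤ 0` for all `k`, and then `lam = 0` by positive definiteness again
(`isWeight_isDominant_isRegular_iff`).
-/

namespace WeylMDS

noncomputable section

/-! ### Inversions and words in the Weyl group -/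

section Words

open RootPairing

variable {ι M M' : Type*} [AddCommGroup M] [Module ℝ M] [AddCommGroup M'] [Module ℝ M']
  {P : RootPairing ι ℝ M M'}

/-- The simple reflection with index `k`, as an element of the Weyl group. -/
abbrev simpleElt (P : RootPairing ι ℝ M M') (k : ι) : P.weylGroup := weylGroup.ofIdx P k

lemma root_smul (w : P.weylGroup) (i : ι) : P.root (w • i) = w • P.root i :=
  Equiv.root_indexEquiv_eq_smul P i w.1

lemma simpleElt_smul (k i : ι) : simpleElt P k • i = P.reflectionPerm k i := rfl

lemma simpleElt_smul_smul (k i : ι) : simpleElt P k • simpleElt P k • i = i := by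
  simp [simpleElt_smul]

lemma simpleElt_mul_self (k : ι) : simpleElt P k * simpleElt P k = 1 := by
  apply Subtype.ext
  have := Equiv.reflection_inv P k
  rw [inv_eq_iff_mul_eq_one] at this
  exact this

lemma root_smul_reflectionPerm_self (w : P.weylGroup) (i : ι) :
    P.root (w • P.reflectionPerm i i) = -P.root (w • i) := by
  rw [root_smul, root_smul]
  simp

/-- Conjugation takes the reflection in a root to the reflection in its image. -/
lemma simpleElt_smul_eq_conj (w : P.weylGroup) (k : ι) :
    simpleElt P (w • k) * w = w * simpleElt P k := by
  obtain ⟨w, hw⟩ := w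
  induction hw using weylGroup.induction generalizing k with
  | mem i =>
    have h : simpleElt P (simpleElt P i • k) = simpleElt P i * simpleElt P k * simpleElt P i :=
      Subtype.ext (reflection_conj k i)
    change simpleElt P (simpleElt P i • k) * simpleElt P i = simpleElt P i * simpleElt P k
    rw [h, mul_assoc, simpleElt_mul_self, mul_one]
  | one =>
    change simpleElt P ((1 : P.weylGroup) • k) * 1 = 1 * simpleElt P k
    rw [one_smul, one_mul, mul_one]
  | mul x y hx hy ihx ihy =>
    have h : (⟨x * y, mul_mem hx hy⟩ : P.weylGroup) = ⟨x, hx⟩ * ⟨y, hy⟩ := rfl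
    rw [h, mul_smul, ← mul_assoc, ihx, mul_assoc, ihy, mul_assoc]

variable (b : P.Base)

lemma isPos_reflectionPerm_self (i : ι) :
    b.IsPos (P.reflectionPerm i i) ↔ ¬ b.IsPos i :=
  Base.IsPos.neg_iff_not b i

lemma isPos_iff_of_root_eq_neg {i j : ι} (h : P.root j = -P.root i) :
    b.IsPos j ↔ ¬ b.IsPos i := by
  rw [← isPos_reflectionPerm_self b i]
  have : j = P.reflectionPerm i i := P.root.injective (by simp [h])
  rw [this]

lemma isPos_smul_reflectionPerm_self (w : P.weylGroup) (i : ι) :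
    b.IsPos (w • P.reflectionPerm i i) ↔ ¬ b.IsPos (w • i) :=
  isPos_iff_of_root_eq_neg b (root_smul_reflectionPerm_self w i)

lemma not_isPos_of_root_eq_add {i j k : ι} (h : P.root k = P.root i + P.root j)
    (hi : ¬ b.IsPos i) (hj : ¬ b.IsPos j) : ¬ b.IsPos k := by
  rw [Base.isPos_iff] at *
  rw [b.height_add h]
  lia

@[simp] lemma wordProd_nil : wordProd b [] = 1 := rfl

@[simp] lemma wordProd_cons (k : b.support) (l : List b.support) :
    wordProd b (k :: l) = simpleElt P k * wordProd b l := rfl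

@[simp] lemma wordProd_append (l l' : List b.support) :
    wordProd b (l ++ l') = wordProd b l * wordProd b l' := by
  simp [wordProd]

@[simp] lemma wordProd_singleton (k : b.support) : wordProd b [k] = simpleElt P k := by
  simp [wordProd]

variable [P.IsCrystallographic] [P.IsReduced]

lemma isPos_simpleElt_smul [Finite ι] (k : b.support) {i : ι} (hi : b.IsPos i) (hik : i ≠ k) :
    b.IsPos (simpleElt P k • i) := hi.reflectionPerm k.2 hik

/-- The exchange condition, in the form of a deletion: if the product `w` of a word makes the
simple root `α k` negative, then `w * s k` is the product of a shorter word. -/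
lemma exists_shorter_word [Finite ι] (l : List b.support) (k : b.support)
    (h : ¬ b.IsPos (wordProd b l • (k : ι))) :
    ∃ l' : List b.support, l'.length < l.length ∧
      wordProd b l' = wordProd b l * simpleElt P k := by
  induction l with
  | nil => exact absurd (Base.isPos_of_mem_support k.2) (by simpa using h)
  | cons a l ih =>
    by_cases hl : b.IsPos (wordProd b l • (k : ι))
    · have ha : wordProd b l • (k : ι) = a := by
        by_contra hne
        exact h (by rw [wordProd_cons, mul_smul]; exact isPos_simpleElt_smul b a hl hne)
      refine ⟨l, by simp, ?_⟩
      rw [wordProd_cons, mul_assoc, ← simpleElt_smul_eq_conj, ha, ← mul_assoc,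
        simpleElt_mul_self, one_mul]
    · obtain ⟨l', hlen, hl'⟩ := ih hl
      exact ⟨a :: l', by simpa using hlen, by rw [wordProd_cons, hl', wordProd_cons, mul_assoc]⟩

/-- A Weyl group element preserving the positivity of all simple roots is trivial. -/
lemma eq_one_of_forall_isPos [Finite ι] (w : P.weylGroup)
    (h : ∀ k : b.support, b.IsPos (w • (k : ι))) : w = 1 := by
  obtain ⟨l, hl⟩ := exists_word b w
  induction hn : l.length using Nat.strong_induction_on generalizing l with
  | _ n ih =>
    rcases l.eq_nil_or_concat' with rfl | ⟨l, k, rfl⟩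
    · simpa using hl.symm
    · have hlk : wordProd b l * simpleElt P k = w := by simpa using hl
      have hneg : ¬ b.IsPos (wordProd b l • (k : ι)) := by
        rw [← isPos_smul_reflectionPerm_self, ← simpleElt_smul, ← mul_smul, hlk]
        exact h k
      obtain ⟨l', hlen, hl'⟩ := exists_shorter_word b l k hneg
      refine ih l'.length ?_ l' (hl'.trans hlk) rfl
      simp at hn
      lia

variable [Fintype ι]

/-- The inversions of `w`: the positive roots which `w` makes negative. -/
def inversions (w : P.weylGroup) : Finset ι :=
  open Classical in {i | b.IsPos i ∧ ¬ b.IsPos (w • i)}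

omit [P.IsCrystallographic] [P.IsReduced] in
lemma mem_inversions {w : P.weylGroup} {i : ι} :
    i ∈ inversions b w ↔ b.IsPos i ∧ ¬ b.IsPos (w • i) := by
  simp [inversions]

omit [P.IsCrystallographic] [P.IsReduced] in
@[simp] lemma inversions_one : inversions b 1 = ∅ := by
  ext i
  simp +contextual [mem_inversions]

/-- An ascent `w < w * s k` adds one inversion, the simple root `α k`. -/
lemma inversions_mul_simpleElt [DecidableEq ι] {w : P.weylGroup} {k : b.support}
    (h : b.IsPos (w • (k : ι))) :
    inversions b (w * simpleElt P k) =
      insert (k : ι) ((inversions b w).image fun i ↦ simpleElt P k • i) := by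
  ext i
  simp only [mem_inversions, Finset.mem_insert, Finset.mem_image, mul_smul]
  constructor
  · rintro ⟨hi, hwi⟩
    refine or_iff_not_imp_left.mpr fun hik ↦ ⟨simpleElt P k • i, ⟨?_, hwi⟩, ?_⟩
    · exact isPos_simpleElt_smul b k hi hik
    · exact simpleElt_smul_smul _ _
  · rintro (rfl | ⟨j, ⟨hj, hwj⟩, rfl⟩)
    · exact ⟨Base.isPos_of_mem_support k.2, by
        rw [simpleElt_smul, isPos_smul_reflectionPerm_self]; simpa using h⟩
    · refine ⟨isPos_simpleElt_smul b k hj ?_, by rwa [simpleElt_smul_smul]⟩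
      rintro rfl
      exact hwj h

omit [P.IsCrystallographic] [P.IsReduced] in
lemma notMem_image_inversions [DecidableEq ι] (w : P.weylGroup) (k : b.support) :
    (k : ι) ∉ (inversions b w).image fun i ↦ simpleElt P k • i := by
  simp only [Finset.mem_image, not_exists, not_and, mem_inversions]
  rintro j ⟨hj, -⟩ h
  have hjk : j = P.reflectionPerm k k := by
    rw [← simpleElt_smul_smul (P := P) k j, h, simpleElt_smul]
  rw [hjk, isPos_reflectionPerm_self] at hj
  exact hj (Base.isPos_of_mem_support k.2)

lemma card_inversions_mul_simpleElt {w : P.weylGroup} {k : b.support}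
    (h : b.IsPos (w • (k : ι))) :
    (inversions b (w * simpleElt P k)).card = (inversions b w).card + 1 := by
  classical
  rw [inversions_mul_simpleElt b h, Finset.card_insert_of_notMem (notMem_image_inversions b w k),
    Finset.card_image_of_injective _ (MulAction.injective _)]

omit [Fintype ι] [P.IsCrystallographic] [P.IsReduced] in
lemma isPos_mul_simpleElt_smul {w : P.weylGroup} {k : b.support} :
    b.IsPos ((w * simpleElt P k) • (k : ι)) ↔ ¬ b.IsPos (w • (k : ι)) := by
  rw [mul_smul, simpleElt_smul, isPos_smul_reflectionPerm_self]

lemma card_inversions_of_descent {w : P.weylGroup} {k : b.support}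
    (h : ¬ b.IsPos (w • (k : ι))) :
    (inversions b (w * simpleElt P k)).card + 1 = (inversions b w).card := by
  rw [← card_inversions_mul_simpleElt b (isPos_mul_simpleElt_smul b |>.mpr h), mul_assoc,
    simpleElt_mul_self, mul_one]

/-- A word is reduced if its length is the number of inversions of its product. -/
def IsReducedWord (l : List b.support) : Prop :=
  l.length = (inversions b (wordProd b l)).card

lemma card_inversions_le_length (l : List b.support) :
    (inversions b (wordProd b l)).card ≤ l.length := by
  induction l using List.reverseRecOn with
  | nil => simp
  | append_singleton l k ih =>
    by_cases h : b.IsPos (wordProd b l • (k : ι))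
    · simpa [card_inversions_mul_simpleElt b h] using ih
    · have := card_inversions_of_descent b h
      simp only [wordProd_append, wordProd_singleton, List.length_append, List.length_singleton]
      lia

lemma isReducedWord_append_singleton {l : List b.support} {k : b.support} :
    IsReducedWord b (l ++ [k]) ↔ IsReducedWord b l ∧ b.IsPos (wordProd b l • (k : ι)) := by
  have hle := card_inversions_le_length b l
  by_cases h : b.IsPos (wordProd b l • (k : ι))
  · simp [IsReducedWord, card_inversions_mul_simpleElt b h, h]
  · have := card_inversions_of_descent b h
    simp only [IsReducedWord, wordProd_append, wordProd_singleton, List.length_append,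
      List.length_singleton, h, and_false, iff_false]
    lia

/-- Every Weyl group element is the product of a reduced word. -/
lemma exists_isReducedWord (w : P.weylGroup) :
    ∃ l : List b.support, IsReducedWord b l ∧ wordProd b l = w := by
  induction hn : (inversions b w).card generalizing w with
  | zero =>
    refine ⟨[], by simp [IsReducedWord], ?_⟩
    rw [wordProd_nil, eq_comm]
    refine eq_one_of_forall_isPos b w fun k ↦ ?_
    by_contra hk
    have : (k : ι) ∈ inversions b w :=
      (mem_inversions b).mpr ⟨Base.isPos_of_mem_support k.2, hk⟩
    simp [Finset.card_eq_zero.mp hn] at this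
  | succ n ih =>
    have hw : w ≠ 1 := by rintro rfl; simp at hn
    obtain ⟨k, hk⟩ : ∃ k : b.support, ¬ b.IsPos (w • (k : ι)) := by
      by_contra! h
      exact hw (eq_one_of_forall_isPos b w h)
    have hcard := card_inversions_of_descent b hk
    obtain ⟨l, hl, hlw⟩ := ih (w * simpleElt P k) (by lia)
    refine ⟨l ++ [k], ?_, ?_⟩
    · rw [isReducedWord_append_singleton]
      exact ⟨hl, by rw [hlw, isPos_mul_simpleElt_smul]; exact hk⟩
    · rw [wordProd_append, hlw, wordProd_singleton, mul_assoc, simpleElt_mul_self, mul_one]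

omit [P.IsReduced] [Fintype ι] in
lemma root_simpleElt_smul (k i : b.support) :
    P.root (simpleElt P k • (i : ι)) = P.root i - b.cartanMatrix i k • P.root k := by
  rw [simpleElt_smul, P.root_reflectionPerm, P.reflection_apply_root' ℤ]
  rfl

omit [P.IsReduced] [Fintype ι] in
lemma root_smul_simpleElt_smul (w : P.weylGroup) (k i : b.support) :
    P.root (w • simpleElt P k • (i : ι)) =
      P.root (w • (i : ι)) - b.cartanMatrix i k • P.root (w • (k : ι)) := by
  rw [root_smul, root_simpleElt_smul, smul_sub, smul_comm, ← root_smul, ← root_smul]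

omit [P.IsReduced] [Fintype ι] in
lemma cartanMatrix_symm [Finite ι] (hP : b.cartanMatrix.IsSimplyLaced) (i j : b.support) :
    b.cartanMatrix i j = b.cartanMatrix j i := by
  rcases eq_or_ne i j with rfl | hij
  · rfl
  · have h := b.cartanMatrix_apply_eq_zero_iff_symm (i := i) (j := j)
    rcases hP hij with h1 | h1 <;> rcases hP hij.symm with h2 | h2 <;> simp_all

/-- Consider operators `op k` on a set, one for each simple root, which are involutions and satisfy
the braid relations of a simply-laced Dynkin diagram. Then the result of applying the operators along
a word depends only on the product of the word in the Weyl group. -/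
theorem foldl_eq_of_wordProd_eq (hP : b.cartanMatrix.IsSimplyLaced) {X : Type*}
    (op : b.support → X → X) (op_op : ∀ k f, op k (op k f) = f)
    (op_comm : ∀ i j f, b.cartanMatrix i j = 0 → op i (op j f) = op j (op i f))
    (op_braid : ∀ i j f, b.cartanMatrix i j = -1 →
      op i (op j (op i f)) = op j (op i (op j f)))
    {l l' : List b.support} (h : wordProd b l = wordProd b l') (f : X) :
    l.foldl (fun g k ↦ op k g) f = l'.foldl (fun g k ↦ op k g) f := by
  -- Two reduced words of one element: compare both, if their last letters `i` and `j` differ, with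
  -- words ending in the longest word of the subgroup generated by the reflections `i` and `j`.
  have key : ∀ (n : ℕ) (l l' : List b.support), l.length = n → IsReducedWord b l →
      IsReducedWord b l' → wordProd b l = wordProd b l' →
      l.foldl (fun g k ↦ op k g) f = l'.foldl (fun g k ↦ op k g) f := by
    intro n
    induction n using Nat.strong_induction_on with
    | _ n ih =>
      intro l l' hn hl hl' hw
      have hlen : l.length = l'.length := by rw [hl, hl', hw]
      rcases l.eq_nil_or_concat' with rfl | ⟨l, i, rfl⟩
      · rw [List.length_nil, eq_comm, List.length_eq_zero_iff] at hlen
        rw [hlen]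
      rcases l'.eq_nil_or_concat' with rfl | ⟨l', j, rfl⟩
      · simp at hlen
      rw [isReducedWord_append_singleton] at hl hl'
      simp only [List.length_append, List.length_singleton] at hn hlen
      simp only [wordProd_append, wordProd_singleton] at hw
      simp only [List.foldl_append, List.foldl_cons, List.foldl_nil]
      set v := wordProd b l * simpleElt P i with hv
      have hvi : wordProd b l = v * simpleElt P i := by
        rw [hv, mul_assoc, simpleElt_mul_self, mul_one]
      have hvj : wordProd b l' = v * simpleElt P j := by
        rw [hw, mul_assoc, simpleElt_mul_self, mul_one]
      have hi : ¬ b.IsPos (v • (i : ι)) := by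
        rw [← isPos_mul_simpleElt_smul, ← hvi]; exact hl.2
      have hj : ¬ b.IsPos (v • (j : ι)) := by
        rw [← isPos_mul_simpleElt_smul, ← hvj]; exact hl'.2
      rcases eq_or_ne i j with rfl | hij
      · rw [ih l.length (by lia) l l' rfl hl.1 hl'.1 (hvi.trans hvj.symm)]
      rcases hP hij with hC | hC
      · have hCs := (cartanMatrix_symm b hP i j).symm.trans hC
        have hfix (i j : b.support) (hC : b.cartanMatrix i j = 0) :
            simpleElt P j • (i : ι) = i :=
          P.root.injective (by rw [root_simpleElt_smul, hC]; simp)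
        have hcomm : simpleElt P i * simpleElt P j = simpleElt P j * simpleElt P i := by
          rw [← simpleElt_smul_eq_conj, hfix j i hCs]
        obtain ⟨u, hu, huw⟩ := exists_isReducedWord b (v * simpleElt P i * simpleElt P j)
        have hui : IsReducedWord b (u ++ [i]) := by
          refine (isReducedWord_append_singleton b).mpr ⟨hu, ?_⟩
          rw [huw, mul_assoc, hcomm, ← mul_assoc, isPos_mul_simpleElt_smul, mul_smul,
            hfix i j hC]
          exact hi
        have huj : IsReducedWord b (u ++ [j]) := by
          refine (isReducedWord_append_singleton b).mpr ⟨hu, ?_⟩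
          rw [huw, isPos_mul_simpleElt_smul, mul_smul, hfix j i hCs]
          exact hj
        have e1 := ih l.length (by lia) l (u ++ [j]) rfl hl.1 huj (by
          rw [wordProd_append, huw, wordProd_singleton, mul_assoc _ (simpleElt P j),
            simpleElt_mul_self, mul_one, hvi])
        have e2 := ih l'.length (by lia) l' (u ++ [i]) rfl hl'.1 hui (by
          rw [wordProd_append, huw, wordProd_singleton, mul_assoc v, hcomm, ← mul_assoc,
            mul_assoc _ (simpleElt P i), simpleElt_mul_self, mul_one, hvj])
        rw [e1, e2]
        simp only [List.foldl_append, List.foldl_cons, List.foldl_nil]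
        exact op_comm i j _ hC
      · have hCs := (cartanMatrix_symm b hP i j).symm.trans hC
        have hswap : simpleElt P j • (i : ι) = simpleElt P i • (j : ι) :=
          P.root.injective (by
            rw [root_simpleElt_smul, root_simpleElt_smul, hC, hCs]; simp [add_comm])
        have hneg : ¬ b.IsPos (v • simpleElt P i • (j : ι)) :=
          not_isPos_of_root_eq_add b
            (by rw [root_smul_simpleElt_smul, hCs]; simp) hj hi
        have hbr : simpleElt P i * simpleElt P j * simpleElt P i =
            simpleElt P j * simpleElt P i * simpleElt P j := by
          have h1 := simpleElt_smul_eq_conj (simpleElt P i) (j : ι)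
          have h2 := simpleElt_smul_eq_conj (simpleElt P j) (i : ι)
          rw [← h1, ← h2, hswap, mul_assoc, mul_assoc, simpleElt_mul_self, simpleElt_mul_self]
        have hss (i j : b.support)
            (hswap : simpleElt P j • (i : ι) = simpleElt P i • (j : ι)) :
            simpleElt P i • simpleElt P j • (i : ι) = j := by
          rw [hswap, simpleElt_smul_smul]
        obtain ⟨u, hu, huw⟩ :=
          exists_isReducedWord b (v * (simpleElt P i * simpleElt P j * simpleElt P i))
        have huw' := huw
        rw [hbr] at huw'
        have extend (i j : b.support)
            (hswap : simpleElt P j • (i : ι) = simpleElt P i • (j : ι))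
            (hneg : ¬ b.IsPos (v • simpleElt P i • (j : ι)))
            (hj : ¬ b.IsPos (v • (j : ι)))
            (huw : wordProd b u = v * (simpleElt P i * simpleElt P j * simpleElt P i)) :
            IsReducedWord b (u ++ [i] ++ [j]) ∧
              wordProd b (u ++ [i] ++ [j]) = v * simpleElt P i := by
          have hui : wordProd b u * simpleElt P i = v * simpleElt P i * simpleElt P j := by
            rw [huw]; simp only [mul_assoc, simpleElt_mul_self, mul_one]
          refine ⟨?_, ?_⟩
          · rw [isReducedWord_append_singleton, isReducedWord_append_singleton]
            refine ⟨⟨hu, ?_⟩, ?_⟩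
            · rw [huw, ← mul_assoc, isPos_mul_simpleElt_smul, mul_smul v,
                mul_smul (simpleElt P i), hss i j hswap]
              exact hj
            · rw [wordProd_append, wordProd_singleton, hui, isPos_mul_simpleElt_smul, mul_smul]
              exact hneg
          · rw [wordProd_append, wordProd_append, wordProd_singleton, wordProd_singleton, hui,
              mul_assoc, simpleElt_mul_self, mul_one]
        obtain ⟨r1, p1⟩ := extend i j hswap hneg hj huw
        obtain ⟨r2, p2⟩ := extend j i hswap.symm (hswap ▸ hneg) hi huw'
        rw [ih l.length (by lia) l _ rfl hl.1 r1 (hvi.trans p1.symm),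
          ih l'.length (by lia) l' _ rfl hl'.1 r2 (hvj.trans p2.symm)]
        simp only [List.foldl_append, List.foldl_cons, List.foldl_nil]
        exact op_braid i j _ hC
  -- An arbitrary word is compared with a reduced one letter by letter: if a letter `k` is a descent,
  -- it cancels the last letter of a reduced word ending in `k`, as `op k` is an involution.
  have red (l : List b.support) : ∀ l' : List b.support, IsReducedWord b l' →
      wordProd b l' = wordProd b l →
      l.foldl (fun g k ↦ op k g) f = l'.foldl (fun g k ↦ op k g) f := by
    induction l using List.reverseRecOn with
    | nil => exact fun l' hl' hw ↦ key 0 _ _ rfl (by simp [IsReducedWord]) hl' hw.symm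
    | append_singleton l k ih =>
      intro l' hl' hw
      by_cases hk : b.IsPos (wordProd b l • (k : ι))
      · obtain ⟨u, hu, huw⟩ := exists_isReducedWord b (wordProd b l)
        rw [← key _ (u ++ [k]) l' rfl
          ((isReducedWord_append_singleton b).mpr ⟨hu, by rwa [huw]⟩) hl' (by simp [hw, huw])]
        simp [ih u hu huw]
      · have hlk : wordProd b l' * simpleElt P k = wordProd b l := by
          rw [hw, wordProd_append, wordProd_singleton, mul_assoc, simpleElt_mul_self, mul_one]
        have hr : IsReducedWord b (l' ++ [k]) := by
          refine (isReducedWord_append_singleton b).mpr ⟨hl', ?_⟩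
          rw [hw, wordProd_append, wordProd_singleton, isPos_mul_simpleElt_smul]
          exact hk
        have := ih (l' ++ [k]) hr (by simp [hlk])
        simp only [List.foldl_append, List.foldl_cons, List.foldl_nil, this, op_op]
  obtain ⟨u, hu, huw⟩ := exists_isReducedWord b (wordProd b l)
  rw [red l u hu huw, red l' u hu (huw.trans h)]

end Words

/-! ### Laurent polynomials inside the field of rational functions -/

section Laurent

variable {σ : Type*}

lemma algebraMap_complex_eq_const (c : ℂ) : algebraMap ℂ (RatField σ) c = const c :=
  IsScalarTower.algebraMap_apply ℂ (MvPolynomial σ ℂ) (RatField σ) c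

@[simp] lemma const_one : (const 1 : RatField σ) = 1 := by
  rw [const, map_one, map_one]

lemma const_mul (a a' : ℂ) : (const (a * a') : RatField σ) = const a * const a' := by
  rw [const, map_mul, map_mul, const, const]

lemma const_ne_zero {c : ℂ} (hc : c ≠ 0) : (const c : RatField σ) ≠ 0 := by
  rw [← algebraMap_complex_eq_const]
  exact (map_ne_zero _).mpr hc

lemma x_ne_zero (j : σ) : x j ≠ 0 := by
  rw [x, Ne, IsFractionRing.to_map_eq_zero_iff]
  exact MvPolynomial.X_ne_zero j

variable [Fintype σ] {c : ℂ}

/-- The Laurent monomial with exponent vector `k` in the rescaled variables `c * x j`. -/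
def scaledMono (c : ℂ) (k : σ → ℤ) : RatField σ := const c ^ (∑ j, k j) * mono k

lemma scaledMono_zero : scaledMono c (0 : σ → ℤ) = 1 := by simp [scaledMono, mono]

lemma scaledMono_add (hc : c ≠ 0) (k l : σ → ℤ) :
    scaledMono c (k + l) = scaledMono c k * scaledMono c l := by
  simp only [scaledMono, mono, Pi.add_apply, Finset.sum_add_distrib,
    zpow_add₀ (const_ne_zero hc), zpow_add₀ (x_ne_zero _), Finset.prod_mul_distrib]
  ring

lemma scaledMono_ne_zero (hc : c ≠ 0) (k : σ → ℤ) : scaledMono c k ≠ 0 :=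
  mul_ne_zero (zpow_ne_zero _ (const_ne_zero hc))
    (Finset.prod_ne_zero_iff.mpr fun j _ ↦ zpow_ne_zero _ (x_ne_zero j))

lemma scaledMono_nsmul (hc : c ≠ 0) (n : ℕ) (k : σ → ℤ) :
    scaledMono c (n • k) = scaledMono c k ^ n := by
  induction n with
  | zero => simp [scaledMono_zero]
  | succ n ih => rw [succ_nsmul, scaledMono_add hc, ih, pow_succ]

lemma scaledMono_neg (hc : c ≠ 0) (k : σ → ℤ) :
    scaledMono c (-k) = (scaledMono c k)⁻¹ := by
  rw [← mul_eq_one_iff_eq_inv₀ (scaledMono_ne_zero hc k), ← scaledMono_add hc, neg_add_cancel,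
    scaledMono_zero]

lemma scaledMono_single [DecidableEq σ] (j : σ) :
    scaledMono c (Pi.single j 1) = const c * x j := by
  rw [scaledMono, mono, Finset.sum_eq_single j, Finset.prod_eq_single j] <;>
    simp +contextual

/-- The ring of Laurent polynomials in variables indexed by `σ`. -/
abbrev LaurentRing (σ : Type*) : Type _ := AddMonoidAlgebra ℂ (σ → ℤ)

/-- The embedding of the Laurent polynomials into the rational functions which sends the monomial
with exponent `k` to `scaledMono c k`. -/
def laurentHom (hc : c ≠ 0) : LaurentRing σ →ₐ[ℂ] RatField σ :=
  AddMonoidAlgebra.lift ℂ (RatField σ) (σ → ℤ)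
    { toFun := fun k ↦ scaledMono c k.toAdd
      map_one' := scaledMono_zero
      map_mul' := fun k l ↦ scaledMono_add hc k.toAdd l.toAdd }

@[simp] lemma laurentHom_single (hc : c ≠ 0) (k : σ → ℤ) (a : ℂ) :
    laurentHom hc (AddMonoidAlgebra.single k a) = const a * scaledMono c k := by
  rw [laurentHom, AddMonoidAlgebra.lift_single, Algebra.smul_def, algebraMap_complex_eq_const]
  rfl

lemma laurentHom_apply (hc : c ≠ 0) (G : LaurentRing σ) :
    laurentHom hc G = ∑ k ∈ G.coeff.support, const (G.coeff k) * scaledMono c k := by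
  conv_lhs => rw [← AddMonoidAlgebra.sum_coeff_single G]
  rw [Finsupp.sum, map_sum]
  simp

/-- A nonnegative exponent vector, as an exponent of a polynomial. -/
def natExponent (k : σ → ℤ) : σ →₀ ℕ := Finsupp.equivFunOnFinite.symm fun j ↦ (k j).toNat

lemma natExponent_injOn : Set.InjOn (natExponent (σ := σ)) {k | 0 ≤ k} := by
  intro k hk l hl h
  ext j
  have hj : (k j).toNat = (l j).toNat := DFunLike.congr_fun h j
  have h1 : 0 ≤ k j := hk j
  have h2 : 0 ≤ l j := hl j
  lia

lemma scaledMono_eq_algebraMap {k : σ → ℤ} (hk : 0 ≤ k) (a : ℂ) :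
    const a * scaledMono c k = algebraMap (MvPolynomial σ ℂ) (RatField σ)
      (MvPolynomial.monomial (natExponent k) (a * c ^ (∑ j, k j).toNat)) := by
  have hs : (((∑ j, k j).toNat : ℕ) : ℤ) = ∑ j, k j :=
    Int.toNat_of_nonneg (Finset.sum_nonneg fun j _ ↦ hk j)
  rw [MvPolynomial.monomial_eq, Finsupp.prod_fintype _ _ (by simp), map_mul, map_prod, map_mul,
    map_mul, map_pow, map_pow, scaledMono, mono, ← hs, zpow_natCast, const, const, mul_assoc]
  congr 2
  refine Finset.prod_congr rfl fun j _ ↦ ?_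
  rw [map_pow, ← zpow_natCast, natExponent]
  simp [x, Int.toNat_of_nonneg (hk j)]

omit [Fintype σ] in
/-- Every Laurent polynomial becomes a polynomial after multiplication by a monomial. -/
lemma exists_shift_nonneg (G : LaurentRing σ) :
    ∃ m : σ → ℤ, 0 ≤ m ∧ ∀ k ∈ G.coeff.support, 0 ≤ m + k := by
  refine ⟨fun j ↦ ∑ k ∈ G.coeff.support, |k j|, fun j ↦ Finset.sum_nonneg fun _ _ ↦ abs_nonneg _,
    fun k hk j ↦ ?_⟩
  have h1 := Finset.single_le_sum (f := fun k : σ → ℤ ↦ |k j|) (fun _ _ ↦ abs_nonneg _) hk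
  have h2 := neg_abs_le (k j)
  simp only [Pi.zero_apply, Pi.add_apply]
  lia

lemma scaledMono_mul_laurentHom (hc : c ≠ 0) (G : LaurentRing σ) {m : σ → ℤ}
    (hm : ∀ k ∈ G.coeff.support, 0 ≤ m + k) :
    scaledMono c m * laurentHom hc G = algebraMap (MvPolynomial σ ℂ) (RatField σ)
      (∑ k ∈ G.coeff.support, MvPolynomial.monomial (natExponent (m + k))
        (G.coeff k * c ^ (∑ j, (m + k) j).toNat)) := by
  rw [laurentHom_apply, Finset.mul_sum, map_sum]
  refine Finset.sum_congr rfl fun k hk ↦ ?_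
  rw [← scaledMono_eq_algebraMap (hm k hk), scaledMono_add hc]
  ring

lemma laurentHom_injective (hc : c ≠ 0) : Function.Injective (laurentHom (σ := σ) hc) := by
  classical
  rw [injective_iff_map_eq_zero]
  intro G hG
  obtain ⟨m, -, hm⟩ := exists_shift_nonneg G
  have h := scaledMono_mul_laurentHom hc G hm
  rw [hG, mul_zero, eq_comm, IsFractionRing.to_map_eq_zero_iff] at h
  by_contra hG0
  obtain ⟨k, hk⟩ : G.coeff.support.Nonempty := by
    rw [Finsupp.support_nonempty_iff]
    simpa using hG0
  have h2 := congrArg (MvPolynomial.coeff (natExponent (m + k))) h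
  rw [MvPolynomial.coeff_sum, Finset.sum_eq_single k, MvPolynomial.coeff_monomial, if_pos rfl,
    MvPolynomial.coeff_zero] at h2
  · exact mul_ne_zero (Finsupp.mem_support_iff.mp hk) (pow_ne_zero _ hc) h2
  · intro l hl hlk
    rw [MvPolynomial.coeff_monomial, if_neg]
    intro h3
    exact hlk (by simpa using natExponent_injOn (hm l hl) (hm k hk) h3)
  · exact fun h3 ↦ absurd hk h3

/-- The Laurent polynomial of a polynomial. -/
def polyHom (c : ℂ) : MvPolynomial σ ℂ →ₐ[ℂ] LaurentRing σ :=
  open Classical in MvPolynomial.aeval fun j ↦ AddMonoidAlgebra.single (Pi.single j 1) c⁻¹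

lemma laurentHom_polyHom (hc : c ≠ 0) (p : MvPolynomial σ ℂ) :
    laurentHom hc (polyHom c p) = algebraMap (MvPolynomial σ ℂ) (RatField σ) p := by
  have h : (laurentHom hc).comp (polyHom c) =
      IsScalarTower.toAlgHom ℂ (MvPolynomial σ ℂ) (RatField σ) := by
    classical
    refine MvPolynomial.algHom_ext fun j ↦ ?_
    have h1 : (const c⁻¹ : RatField σ) * const c = 1 := by
      rw [const, const, ← map_mul, ← map_mul, inv_mul_cancel₀ hc, map_one, map_one]
    simp only [AlgHom.comp_apply, polyHom, MvPolynomial.aeval_X, laurentHom_single]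
    convert_to const c⁻¹ * scaledMono c (Pi.single j 1) = x j using 1
    · congr!
    rw [scaledMono_single, ← mul_assoc, h1, one_mul]
  exact DFunLike.congr_fun h p

lemma polyHom_injective (hc : c ≠ 0) : Function.Injective (polyHom (σ := σ) c) := by
  intro p p' h
  have := congrArg (laurentHom hc) h
  rw [laurentHom_polyHom, laurentHom_polyHom] at this
  exact IsFractionRing.injective (MvPolynomial σ ℂ) (RatField σ) this

/-- The extension to rational functions of an injective endomorphism of the Laurent polynomials. -/
def fieldHom (hc : c ≠ 0) (Φ : LaurentRing σ →ₐ[ℂ] LaurentRing σ)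
    (hΦ : Function.Injective Φ) : RatField σ →+* RatField σ :=
  IsFractionRing.lift (A := MvPolynomial σ ℂ)
    (g := ((laurentHom hc).comp (Φ.comp (polyHom c)) : MvPolynomial σ ℂ →+* RatField σ))
    ((laurentHom_injective hc).comp (hΦ.comp (polyHom_injective hc)))

lemma fieldHom_algebraMap (hc : c ≠ 0) (Φ : LaurentRing σ →ₐ[ℂ] LaurentRing σ)
    (hΦ : Function.Injective Φ) (p : MvPolynomial σ ℂ) :
    fieldHom hc Φ hΦ (algebraMap (MvPolynomial σ ℂ) (RatField σ) p) =
      laurentHom hc (Φ (polyHom c p)) :=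
  IsFractionRing.lift_algebraMap _ p

@[simp] lemma fieldHom_const (hc : c ≠ 0) (Φ : LaurentRing σ →ₐ[ℂ] LaurentRing σ)
    (hΦ : Function.Injective Φ) (a : ℂ) : fieldHom hc Φ hΦ (const a) = const a := by
  rw [const, fieldHom_algebraMap, ← MvPolynomial.algebraMap_eq, AlgHom.commutes, AlgHom.commutes,
    AlgHom.commutes, algebraMap_complex_eq_const]
  rfl

/-- A multiplicative map on exponent vectors is determined by the unit vectors. -/
lemma monoidHom_eq_of_single {K : Type*} [Field K] [DecidableEq σ]
    {f g : Multiplicative (σ → ℤ) →* K}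
    (h : ∀ j, f (.ofAdd (Pi.single j 1)) = g (.ofAdd (Pi.single j 1))) : f = g := by
  have key (k : Multiplicative (σ → ℤ)) :
      MonoidHom.toHomUnits f k = MonoidHom.toHomUnits g k := by
    have hk : k = ∏ j, (Multiplicative.ofAdd (Pi.single j 1 : σ → ℤ)) ^ k.toAdd j := by
      apply Multiplicative.toAdd.injective
      rw [toAdd_prod]
      ext i
      simp [Finset.sum_apply, Pi.single_apply]
    rw [hk, map_prod, map_prod]
    refine Finset.prod_congr rfl fun j _ ↦ ?_
    rw [map_zpow, map_zpow]
    congr 1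
    ext
    exact h j
  exact MonoidHom.ext fun k ↦ congrArg Units.val (key k)

lemma fieldHom_laurentHom (hc : c ≠ 0) (Φ : LaurentRing σ →ₐ[ℂ] LaurentRing σ)
    (hΦ : Function.Injective Φ) (G : LaurentRing σ) :
    fieldHom hc Φ hΦ (laurentHom hc G) = laurentHom hc (Φ G) := by
  classical
  have h : (fieldHom hc Φ hΦ).comp (laurentHom hc).toRingHom =
      (laurentHom hc).toRingHom.comp Φ.toRingHom := by
    refine AddMonoidAlgebra.ringHom_ext' ?_ ?_
    · ext a
      change fieldHom hc Φ hΦ (laurentHom hc (algebraMap ℂ (LaurentRing σ) a)) =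
        laurentHom hc (Φ (algebraMap ℂ (LaurentRing σ) a))
      rw [AlgHom.commutes, AlgHom.commutes, AlgHom.commutes, algebraMap_complex_eq_const,
        fieldHom_const]
    · refine monoidHom_eq_of_single fun j ↦ ?_
      have h2 : const c * x j = laurentHom hc (AddMonoidAlgebra.single (Pi.single j 1) 1) := by
        rw [laurentHom_single, scaledMono_single, const_one, one_mul]
      have h3 : (AddMonoidAlgebra.single (Pi.single j 1) 1 : LaurentRing σ) =
          algebraMap ℂ _ c * polyHom c (MvPolynomial.X j) := by
        rw [polyHom, MvPolynomial.aeval_X, ← Algebra.smul_def, AddMonoidAlgebra.smul_single,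
          smul_eq_mul, mul_inv_cancel₀ hc]
      change fieldHom hc Φ hΦ (laurentHom hc (AddMonoidAlgebra.single (Pi.single j 1) 1)) =
        laurentHom hc (Φ (AddMonoidAlgebra.single (Pi.single j 1) 1))
      rw [← h2, map_mul, fieldHom_const, x, fieldHom_algebraMap, h3, map_mul, map_mul,
        AlgHom.commutes, AlgHom.commutes, algebraMap_complex_eq_const]
  exact DFunLike.congr_fun h G

/-- Two endomorphisms of the field of rational functions that agree on Laurent monomials and on
constants are equal. -/
lemma ratField_hom_ext (hc : c ≠ 0) {φ ψ : RatField σ →+* RatField σ}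
    (hconst : ∀ a, φ (const a) = ψ (const a))
    (hmono : ∀ k, φ (scaledMono c k) = ψ (scaledMono c k)) : φ = ψ := by
  refine IsLocalization.ringHom_ext (nonZeroDivisors (MvPolynomial σ ℂ)) ?_
  refine RingHom.ext fun p ↦ ?_
  simp only [RingHom.comp_apply]
  rw [← laurentHom_polyHom hc, laurentHom_apply]
  simp [hconst, hmono]

lemma subst_eq_fieldHom (hc : c ≠ 0) (Φ : LaurentRing σ →ₐ[ℂ] LaurentRing σ)
    (hΦ : Function.Injective Φ) (v : σ → RatField σ)
    (hv : ∀ j, v j = fieldHom hc Φ hΦ (x j)) (f : RatField σ) :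
    subst v f = fieldHom hc Φ hΦ f := by
  have h (p : MvPolynomial σ ℂ) : MvPolynomial.aeval v p =
      fieldHom hc Φ hΦ (algebraMap (MvPolynomial σ ℂ) (RatField σ) p) := by
    have : (MvPolynomial.aeval v : MvPolynomial σ ℂ →ₐ[ℂ] RatField σ) =
        (laurentHom hc).comp (Φ.comp (polyHom c)) := by
      refine MvPolynomial.algHom_ext fun j ↦ ?_
      rw [MvPolynomial.aeval_X, hv, x, fieldHom_algebraMap]
      rfl
    rw [this, fieldHom_algebraMap]
    rfl
  rw [subst, h, h, ← map_div₀, ← IsFractionRing.mk'_eq_div, IsFractionRing.mk'_num_den]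

end Laurent

/-! ### The action of simple reflections on the root lattice -/

section LatticeAction

open RootPairing

variable {ι M M' : Type*} [AddCommGroup M] [Module ℝ M] [AddCommGroup M'] [Module ℝ M']
  {P : RootPairing ι ℝ M M'} (b : P.Base)

@[simp] lemma simpleRoot_self (k : b.support) : simpleRoot b k k = 1 := by simp [simpleRoot]

lemma simpleRoot_of_ne {j k : b.support} (h : j ≠ k) : simpleRoot b k j = 0 := by
  simp [simpleRoot, h]

lemma simpleRoot_nonneg (k : b.support) : 0 ≤ simpleRoot b k := by
  classical
  intro j
  rcases eq_or_ne j k with rfl | h <;> simp [simpleRoot_of_ne, *]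

lemma ht_add (lam mu : Lattice b) : ht b (lam + mu) = ht b lam + ht b mu := by
  simp [ht, Finset.sum_add_distrib]

lemma ht_sub (lam mu : Lattice b) : ht b (lam - mu) = ht b lam - ht b mu := by
  simp [ht, Finset.sum_sub_distrib]

lemma ht_smul (n : ℤ) (lam : Lattice b) : ht b (n • lam) = n * ht b lam := by
  simp [ht, Finset.mul_sum]

lemma ht_simpleRoot (k : b.support) : ht b (simpleRoot b k) = 1 := by
  rw [ht, Finset.sum_eq_single k] <;> simp +contextual [simpleRoot_of_ne]

variable [P.IsCrystallographic]

/-- The pairing of an element of the root lattice with the simple coroot of index `k`. -/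
def latticePairing (k : b.support) : Lattice b →+ ℤ where
  toFun lam := ∑ j, lam j * b.cartanMatrix j k
  map_zero' := by simp
  map_add' lam mu := by simp [add_mul, Finset.sum_add_distrib]

lemma latticePairing_apply (k : b.support) (lam : Lattice b) :
    latticePairing b k lam = ∑ j, lam j * b.cartanMatrix j k := rfl

lemma simpleRefl_eq (k : b.support) (lam : Lattice b) :
    simpleRefl b k lam = lam - latticePairing b k lam • simpleRoot b k := rfl

@[simp] lemma latticePairing_simpleRoot (k j : b.support) :
    latticePairing b k (simpleRoot b j) = b.cartanMatrix j k := by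
  rw [latticePairing_apply, Finset.sum_eq_single j] <;> simp +contextual [simpleRoot_of_ne]

lemma latticePairing_simpleRefl (j k : b.support) (lam : Lattice b) :
    latticePairing b j (simpleRefl b k lam) =
      latticePairing b j lam - latticePairing b k lam * b.cartanMatrix k j := by
  rw [simpleRefl_eq, map_sub, map_zsmul, latticePairing_simpleRoot, smul_eq_mul]

lemma cartanMatrix_self (k : b.support) : b.cartanMatrix k k = 2 := by simp

lemma simpleRefl_simpleRefl (k : b.support) (lam : Lattice b) :
    simpleRefl b k (simpleRefl b k lam) = lam := by
  rw [simpleRefl_eq b k (simpleRefl b k lam), latticePairing_simpleRefl, cartanMatrix_self,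
    simpleRefl_eq]
  module

lemma simpleRefl_add (k : b.support) (lam mu : Lattice b) :
    simpleRefl b k (lam + mu) = simpleRefl b k lam + simpleRefl b k mu := by
  simp only [simpleRefl_eq, map_add]
  module

/-- The simple reflection as an automorphism of the root lattice. -/
def reflEquiv (k : b.support) : Lattice b ≃+ Lattice b where
  toFun := simpleRefl b k
  invFun := simpleRefl b k
  left_inv := simpleRefl_simpleRefl b k
  right_inv := simpleRefl_simpleRefl b k
  map_add' := simpleRefl_add b k

@[simp] lemma reflEquiv_apply (k : b.support) (lam : Lattice b) :
    reflEquiv b k lam = simpleRefl b k lam := rfl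

lemma simpleRefl_comm {i j : b.support} (h : b.cartanMatrix i j = 0)
    (h' : b.cartanMatrix j i = 0) (lam : Lattice b) :
    simpleRefl b i (simpleRefl b j lam) = simpleRefl b j (simpleRefl b i lam) := by
  rw [simpleRefl_eq b i (simpleRefl b j lam), simpleRefl_eq b j (simpleRefl b i lam),
    latticePairing_simpleRefl, latticePairing_simpleRefl, h, h', simpleRefl_eq, simpleRefl_eq]
  module

lemma simpleRefl_braid {i j : b.support} (h : b.cartanMatrix i j = -1)
    (h' : b.cartanMatrix j i = -1) (lam : Lattice b) :
    simpleRefl b i (simpleRefl b j (simpleRefl b i lam)) =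
      simpleRefl b j (simpleRefl b i (simpleRefl b j lam)) := by
  have key (i j : b.support) (h : b.cartanMatrix i j = -1) (h' : b.cartanMatrix j i = -1) :
      simpleRefl b i (simpleRefl b j (simpleRefl b i lam)) =
        lam - (latticePairing b i lam + latticePairing b j lam) •
          (simpleRoot b i + simpleRoot b j) := by
    rw [simpleRefl_eq b i (simpleRefl b j _), latticePairing_simpleRefl,
      latticePairing_simpleRefl, cartanMatrix_self, h', simpleRefl_eq b j (simpleRefl b i lam),
      latticePairing_simpleRefl, h, simpleRefl_eq]
    module
  rw [key i j h h', key j i h' h, add_comm, add_comm (simpleRoot b i)]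

/-! ### Roots in coordinates -/

omit [P.IsCrystallographic] in
lemma root_eq_sum_rootCoord (i : ι) : P.root i = ∑ j, rootCoord b i j • P.root j := by
  have h := congrArg Subtype.val (b.toWeightBasisInt.sum_repr (P.rootSpanMem ℤ i))
  simpa [rootCoord] using h.symm

omit [P.IsCrystallographic] in
/-- Integral combinations of roots which agree have the same coordinates. -/
lemma rootCoord_of_root_eq {i j k : ι} {m : ℤ} (h : P.root k = P.root i + m • P.root j) :
    rootCoord b k = rootCoord b i + m • rootCoord b j := by
  have h' : P.rootSpanMem ℤ k = P.rootSpanMem ℤ i + m • P.rootSpanMem ℤ j := Subtype.ext h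
  ext l
  rw [rootCoord, h', map_add, map_zsmul]
  rfl

omit [P.IsCrystallographic] in
@[simp] lemma rootCoord_coe (k : b.support) : rootCoord b (k : ι) = simpleRoot b k := by
  classical
  have h : P.rootSpanMem ℤ (k : ι) = b.toWeightBasisInt k := Subtype.ext (by simp)
  ext j
  rw [rootCoord, h, Module.Basis.repr_self, simpleRoot, Finsupp.single_apply, Pi.single_apply]
  simp [eq_comm]

lemma latticePairing_rootCoord (k : b.support) (i : ι) :
    latticePairing b k (rootCoord b i) = P.pairingIn ℤ i k := by
  apply (algebraMap ℤ ℝ).injective_int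
  rw [algebraMap_pairingIn, latticePairing_apply, ← P.root_coroot_eq_pairing i,
    root_eq_sum_rootCoord b i, map_sum]
  simp only [map_mul, map_sum, map_zsmul, LinearMap.sum_apply, LinearMap.smul_apply,
    root_coroot_eq_pairing, zsmul_eq_mul]
  refine Finset.sum_congr rfl fun j _ ↦ ?_
  congr 1
  exact P.algebraMap_pairingIn ℤ j k

lemma simpleRefl_rootCoord (k : b.support) (i : ι) :
    simpleRefl b k (rootCoord b i) = rootCoord b (simpleElt P k • i) := by
  have h : P.root (simpleElt P k • i) = P.root i + (-P.pairingIn ℤ i k) • P.root k := by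
    rw [simpleElt_smul, P.root_reflectionPerm, P.reflection_apply_root' ℤ, neg_smul, sub_eq_add_neg]
  rw [rootCoord_of_root_eq b h, simpleRefl_eq, latticePairing_rootCoord, rootCoord_coe, neg_smul,
    sub_eq_add_neg]

omit [P.IsCrystallographic] in
lemma height_eq_ht (i : ι) : b.height i = ht b (rootCoord b i) := by
  classical
  have h : P.root i = ∑ j ∈ b.support,
      (fun j ↦ if h : j ∈ b.support then rootCoord b i ⟨j, h⟩ else 0) j • P.root j := by
    rw [← Finset.sum_coe_sort]
    simpa using root_eq_sum_rootCoord b i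
  rw [Base.height_eq_sum h, ← Finset.sum_coe_sort]
  simp [ht]

omit [P.IsCrystallographic] in
lemma rootCoord_nonneg {i : ι} (hi : b.IsPos i) : 0 ≤ rootCoord b i := by
  classical
  obtain ⟨f, -, hf, hsum⟩ := b.exists_root_eq_sum_int i
  have h2 : ∀ j : b.support, rootCoord b i j = f j := by
    intro j
    have h := root_eq_sum_rootCoord b i
    rw [hsum, ← Finset.sum_coe_sort] at h
    exact (Fintype.linearIndependent_iffₛ.mp (b.linearIndepOn_root.restrict_scalars' ℤ)
      (f ∘ (↑)) (rootCoord b i) (by simpa using h) j).symm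
  rcases hf with hf | hf
  · exact fun j ↦ (h2 j).symm ▸ hf.le j
  · exfalso
    rw [Base.isPos_iff, height_eq_ht, ht] at hi
    exact not_lt.mpr (Finset.sum_nonpos fun j _ ↦ (h2 j).symm ▸ hf.le j) hi

omit [P.IsCrystallographic] in
lemma ht_rootCoord_pos {i : ι} (hi : b.IsPos i) : 0 < ht b (rootCoord b i) := by
  rw [← height_eq_ht]; exact hi

omit [P.IsCrystallographic] in
/-- Positive roots which are proportional are equal. -/
lemma eq_of_smul_rootCoord_eq [Finite ι] [P.IsReduced] {i j : ι} (hi : b.IsPos i)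
    (hj : b.IsPos j) {m n : ℤ} (hn : n ≠ 0)
    (h : n • rootCoord b i = m • rootCoord b j) : i = j := by
  by_contra hij
  have hroot : (n : ℝ) • P.root i = (m : ℝ) • P.root j := by
    rw [root_eq_sum_rootCoord b i, root_eq_sum_rootCoord b j, Int.cast_smul_eq_zsmul,
      Int.cast_smul_eq_zsmul, Finset.smul_sum, Finset.smul_sum]
    refine Finset.sum_congr rfl fun l _ ↦ ?_
    rw [smul_smul, smul_smul]
    congr 1
    exact congrFun h l
  have hlin := IsReduced.linearIndependent P hij fun hneg ↦
    ((isPos_iff_of_root_eq_neg b hneg).mp hi) hj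
  rw [LinearIndependent.pair_iff] at hlin
  have := (hlin (n : ℝ) (-(m : ℝ)) (by rw [hroot]; module)).1
  exact hn (by exact_mod_cast this)

/-- A nonzero nonnegative element of the root lattice pairs positively with some simple coroot:
this is the positive definiteness of the Cartan matrix. -/
lemma exists_latticePairing_pos [Finite ι] [P.IsRootSystem] {mu : Lattice b} (hmu : 0 ≤ mu)
    (h0 : mu ≠ 0) : ∃ k, 0 < latticePairing b k mu := by
  classical
  obtain ⟨d, hd, hpos⟩ := b.exists_cartanMatrix_mul_diagaonal_posDef
  by_contra! hle
  have hq := hpos.dotProduct_mulVec_pos h0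
  refine not_lt.mpr ?_ hq
  rw [star_trivial, Matrix.dotProduct_mulVec, ← Matrix.vecMul_vecMul]
  refine Finset.sum_nonpos fun k _ ↦ ?_
  rw [Matrix.vecMul_diagonal]
  exact mul_nonpos_of_nonpos_of_nonneg
    (mul_nonpos_of_nonpos_of_nonneg (hle k) (hd k).le) (hmu k)

end LatticeAction

/-! ### Rank two relations for operators twisted by signs -/

section RankTwo

variable {K : Type*} [Field K]

/-- The coefficient of `f (σ x)` in `f ∣ σ`, as a function of the rescaled variable `u`. -/
def slashCoeff (t u : K) : K := (1 - t) * (1 + u) / (2 * u * (1 - t * u))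

/-- The coefficient of `f (ε (σ x))` in `f ∣ σ`, as a function of the rescaled variable `u`. -/
def slashCoeffSign (t u : K) : K := (1 + t) * (u - 1) / (2 * u * (1 - t * u))

lemma map_slashCoeff (φ : K →+* K) {t : K} (ht : φ t = t) (u : K) :
    φ (slashCoeff t u) = slashCoeff t (φ u) := by
  simp only [slashCoeff, map_div₀, map_mul, map_sub, map_add, map_one, map_ofNat, ht]

lemma map_slashCoeffSign (φ : K →+* K) {t : K} (ht : φ t = t) (u : K) :
    φ (slashCoeffSign t u) = slashCoeffSign t (φ u) := by
  simp only [slashCoeffSign, map_div₀, map_mul, map_sub, map_add, map_one, map_ofNat, ht]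

/-- The operator attached to a reflection `S` and a sign change `E` of a field. -/
def slashOp (S E : K →+* K) (t u f : K) : K :=
  slashCoeff t u * S f + slashCoeffSign t u * S (E f)

lemma slashOp_slashOp [CharZero K] {S E : K →+* K} {t u : K} (hSt : S t = t) (hEt : E t = t)
    (hSu : S u = u⁻¹) (hEu : E u = u) (hSS : ∀ f, S (S f) = f) (hEE : ∀ f, E (E f) = f)
    (hES : ∀ f, E (S f) = S (E f)) (hu : u ≠ 0) (h1 : 1 - t * u ≠ 0) (h2 : u - t ≠ 0) (f : K) :
    slashOp S E t u (slashOp S E t u f) = f := by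
  have e1 : slashCoeff t u * slashCoeff t u⁻¹ + slashCoeffSign t u * slashCoeffSign t u⁻¹ = 1 := by
    simp only [slashCoeff, slashCoeffSign]
    field_simp
    ring
  have e2 : slashCoeff t u * slashCoeffSign t u⁻¹ + slashCoeffSign t u * slashCoeff t u⁻¹ = 0 := by
    simp only [slashCoeff, slashCoeffSign]
    field_simp
    ring
  simp only [slashOp, map_add, map_mul, map_slashCoeff S hSt, map_slashCoeff E hEt,
    map_slashCoeffSign S hSt, map_slashCoeffSign E hEt, hSu, hEu, hSS, hES, hEE]
  linear_combination f * e1 + E f * e2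

lemma slashOp_comm {S E T F : K →+* K} {t u v : K} (hSt : S t = t) (hEt : E t = t)
    (hTt : T t = t) (hFt : F t = t)
    (hSv : S v = v) (hEv : E v = v) (hTu : T u = u) (hFu : F u = u)
    (hST : ∀ f, S (T f) = T (S f)) (hEF : ∀ f, E (F f) = F (E f))
    (hET : ∀ f, E (T f) = T (E f)) (hFS : ∀ f, F (S f) = S (F f)) (f : K) :
    slashOp S E t u (slashOp T F t v f) = slashOp T F t v (slashOp S E t u f) := by
  simp only [slashOp, map_add, map_mul, map_slashCoeff S hSt, map_slashCoeff E hEt,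
    map_slashCoeffSign S hSt, map_slashCoeffSign E hEt, map_slashCoeff T hTt, map_slashCoeff F hFt,
    map_slashCoeffSign T hTt, map_slashCoeffSign F hFt, hSv, hEv, hTu, hFu, hET, hFS, hST, hEF]
  ring

/-- The braid relation. Both sides are combinations of the four functions `f (γ w x)`, where `w` is
the longest element and `γ` runs over the group generated by the two sign changes; the coefficients
agree as rational functions of `u` and `v`. -/
lemma slashOp_braid [CharZero K] {S E T F : K →+* K} {t u v : K} (hSt : S t = t) (hEt : E t = t)
    (hTt : T t = t) (hFt : F t = t)
    (hSu : S u = u⁻¹) (hTv : T v = v⁻¹) (hSv : S v = u * v) (hTu : T u = u * v)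
    (hEu : E u = u) (hFv : F v = v) (hEv : E v = -v) (hFu : F u = -u)
    (hEE : ∀ f, E (E f) = f) (hFF : ∀ f, F (F f) = f) (hFE : ∀ f, F (E f) = E (F f))
    (hES : ∀ f, E (S f) = S (E f)) (hFT : ∀ f, F (T f) = T (F f))
    (hET : ∀ f, E (T f) = T (E (F f))) (hFS : ∀ f, F (S f) = S (E (F f)))
    (hTST : ∀ f, T (S (T f)) = S (T (S f)))
    (hu : u ≠ 0) (hv : v ≠ 0) (h1 : 1 - t * u ≠ 0) (h2 : 1 - t * v ≠ 0)
    (h3 : 1 - t * u * v ≠ 0) (h4 : 1 + t * u ≠ 0) (h5 : 1 + t * v ≠ 0)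
    (h6 : 1 + t * u * v ≠ 0) (f : K) :
    slashOp S E t u (slashOp T F t v (slashOp S E t u f)) =
      slashOp T F t v (slashOp S E t u (slashOp T F t v f)) := by
  have e11 : slashCoeff t u * slashCoeffSign t (u * v) * slashCoeff t (-v) +
      slashCoeffSign t u * slashCoeff t (-(u * v)) * slashCoeffSign t (-v) =
      slashCoeff t v * slashCoeffSign t (u * v) * slashCoeff t (-u) +
      slashCoeffSign t v * slashCoeff t (-(u * v)) * slashCoeffSign t (-u) := by
    simp only [slashCoeff, slashCoeffSign, mul_neg, sub_neg_eq_add, ← mul_assoc]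
    field_simp
    ring
  have e (u v : K) (hu : u ≠ 0) (hv : v ≠ 0) (h1 : 1 - t * u ≠ 0) (h2 : 1 - t * v ≠ 0)
      (h3 : 1 - t * u * v ≠ 0) (h4 : 1 + t * u ≠ 0) (h6 : 1 + t * u * v ≠ 0) :
      slashCoeff t u * slashCoeff t (u * v) * slashCoeffSign t v +
      slashCoeffSign t u * slashCoeffSign t (-(u * v)) * slashCoeff t v =
      slashCoeff t v * slashCoeffSign t (u * v) * slashCoeffSign t (-u) +
      slashCoeffSign t v * slashCoeff t (-(u * v)) * slashCoeff t (-u) := by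
    simp only [slashCoeff, slashCoeffSign, mul_neg, sub_neg_eq_add, ← mul_assoc]
    field_simp
    ring
  have e10 := e u v hu hv h1 h2 h3 h4 h6
  have e01 := e v u hv hu h2 h1 (by rwa [mul_right_comm]) h5 (by rwa [mul_right_comm])
  rw [mul_comm v u] at e01
  have r1 : u⁻¹ * (u * v) = v := by field_simp
  have r2 : u * v * v⁻¹ = u := by field_simp
  simp only [slashOp, map_add, map_mul, map_neg, map_slashCoeff S hSt, map_slashCoeff E hEt,
    map_slashCoeffSign S hSt, map_slashCoeffSign E hEt, map_slashCoeff T hTt, map_slashCoeff F hFt,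
    map_slashCoeffSign T hTt, map_slashCoeffSign F hFt, hSu, hTv, hSv, hTu, hEu, hFv, hEv, hFu,
    hES, hFT, hET, hFS, hEE, hFF, hFE, hTST, neg_mul, mul_neg, neg_neg, r1, r2]
  linear_combination S (T (S (E (F f)))) * e11 + S (T (S (E f))) * e10 - S (T (S (F f))) * e01

end RankTwo

/-! ### Reflections and sign changes as automorphisms of the field of rational functions -/

section FieldAction

open RootPairing

variable {ι M M' : Type*} [AddCommGroup M] [Module ℝ M] [AddCommGroup M'] [Module ℝ M']
  {P : RootPairing ι ℝ M M'} [P.IsCrystallographic] (b : P.Base)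

/-- The action of a simple reflection on Laurent polynomials. -/
def laurentRefl (k : b.support) : LaurentRing b.support →ₐ[ℂ] LaurentRing b.support :=
  (AddMonoidAlgebra.domCongr ℂ ℂ (reflEquiv b k)).toAlgHom

@[simp] lemma laurentRefl_single (k : b.support) (lam : Lattice b) (a : ℂ) :
    laurentRefl b k (AddMonoidAlgebra.single lam a) =
      AddMonoidAlgebra.single (simpleRefl b k lam) a :=
  AddMonoidAlgebra.domCongr_single ..

lemma coeff_laurentRefl (k : b.support) (G : LaurentRing b.support) (lam : Lattice b) :
    (laurentRefl b k G).coeff lam = G.coeff (simpleRefl b k lam) :=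
  AddMonoidAlgebra.coeff_domCongr ..

lemma laurentRefl_injective (k : b.support) : Function.Injective (laurentRefl b k) :=
  (AddMonoidAlgebra.domCongr ℂ ℂ (reflEquiv b k)).injective

/-- The sign change `ε k` on Laurent polynomials. -/
def laurentSign (k : b.support) : LaurentRing b.support →ₐ[ℂ] LaurentRing b.support :=
  AddMonoidAlgebra.lift ℂ _ _
    { toFun := fun lam ↦ AddMonoidAlgebra.single lam.toAdd
        ((-1 : ℂ) ^ latticePairing b k lam.toAdd)
      map_one' := by simp [AddMonoidAlgebra.one_def]
      map_mul' := fun lam mu ↦ by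
        rw [AddMonoidAlgebra.single_mul_single, toAdd_mul, map_add, zpow_add₀ (by norm_num)] }

@[simp] lemma laurentSign_single (k : b.support) (lam : Lattice b) (a : ℂ) :
    laurentSign b k (AddMonoidAlgebra.single lam a) =
      AddMonoidAlgebra.single lam (a * (-1 : ℂ) ^ latticePairing b k lam) := by
  rw [laurentSign, AddMonoidAlgebra.lift_single]
  exact AddMonoidAlgebra.smul_single ..

lemma neg_one_zpow_mul_self (n : ℤ) : (-1 : ℂ) ^ n * (-1 : ℂ) ^ n = 1 := by
  rw [← mul_zpow]; simp

lemma coeff_laurentSign (k : b.support) (G : LaurentRing b.support) (lam : Lattice b) :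
    (laurentSign b k G).coeff lam = G.coeff lam * (-1 : ℂ) ^ latticePairing b k lam := by
  classical
  induction G using AddMonoidAlgebra.induction_linear with
  | zero => simp
  | add G H hG hH => rw [map_add, AddMonoidAlgebra.coeff_add, AddMonoidAlgebra.coeff_add,
      Finsupp.add_apply, Finsupp.add_apply, hG, hH, add_mul]
  | single mu a =>
    rw [laurentSign_single, AddMonoidAlgebra.coeff_single, AddMonoidAlgebra.coeff_single,
      Finsupp.single_apply, Finsupp.single_apply]
    split_ifs with h
    · rw [h]
    · rw [zero_mul]

lemma laurentSign_laurentSign (k : b.support) (G : LaurentRing b.support) :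
    laurentSign b k (laurentSign b k G) = G := by
  ext lam
  rw [coeff_laurentSign, coeff_laurentSign, mul_assoc, neg_one_zpow_mul_self, mul_one]

lemma laurentSign_injective (k : b.support) : Function.Injective (laurentSign b k) :=
  Function.LeftInverse.injective (laurentSign_laurentSign b k)

variable {b} {c : ℂ} (hc : c ≠ 0)

/-- The automorphism `f(x) ↦ f(σ k x)` of the field of rational functions. -/
def reflHom (k : b.support) : RatField b.support →+* RatField b.support :=
  fieldHom hc (laurentRefl b k) (laurentRefl_injective b k)

/-- The automorphism `f(x) ↦ f(ε k x)` of the field of rational functions. -/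
def signHom (k : b.support) : RatField b.support →+* RatField b.support :=
  fieldHom hc (laurentSign b k) (laurentSign_injective b k)

@[simp] lemma reflHom_const (k : b.support) (a : ℂ) : reflHom hc k (const a) = const a :=
  fieldHom_const ..

@[simp] lemma signHom_const (k : b.support) (a : ℂ) : signHom hc k (const a) = const a :=
  fieldHom_const ..

lemma reflHom_laurentHom (k : b.support) (G : LaurentRing b.support) :
    reflHom hc k (laurentHom hc G) = laurentHom hc (laurentRefl b k G) := fieldHom_laurentHom ..

lemma signHom_laurentHom (k : b.support) (G : LaurentRing b.support) :
    signHom hc k (laurentHom hc G) = laurentHom hc (laurentSign b k G) := fieldHom_laurentHom ..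

omit [P.IsCrystallographic] in
include hc in
lemma scaledMono_eq_laurentHom (lam : Lattice b) :
    scaledMono c lam = laurentHom hc (AddMonoidAlgebra.single lam 1) := by simp

@[simp] lemma reflHom_scaledMono (k : b.support) (lam : Lattice b) :
    reflHom hc k (scaledMono c lam) = scaledMono c (simpleRefl b k lam) := by
  rw [scaledMono_eq_laurentHom hc, reflHom_laurentHom, laurentRefl_single,
    ← scaledMono_eq_laurentHom]

@[simp] lemma signHom_scaledMono (k : b.support) (lam : Lattice b) :
    signHom hc k (scaledMono c lam) = const ((-1) ^ latticePairing b k lam) * scaledMono c lam := by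
  rw [scaledMono_eq_laurentHom hc, signHom_laurentHom, laurentSign_single, one_mul,
    laurentHom_single, scaledMono_eq_laurentHom hc]

lemma reflHom_reflHom (k : b.support) (f : RatField b.support) :
    reflHom hc k (reflHom hc k f) = f := by
  have : (reflHom hc k).comp (reflHom hc k) = RingHom.id _ :=
    ratField_hom_ext hc (by simp) (by simp [simpleRefl_simpleRefl])
  exact DFunLike.congr_fun this f

lemma signHom_signHom (k : b.support) (f : RatField b.support) :
    signHom hc k (signHom hc k f) = f := by
  have : (signHom hc k).comp (signHom hc k) = RingHom.id _ :=
    ratField_hom_ext hc (by simp) fun lam ↦ by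
      simp only [RingHom.comp_apply, signHom_scaledMono, map_mul, signHom_const, RingHom.id_apply]
      rw [← mul_assoc, ← const_mul, neg_one_zpow_mul_self, const_one, one_mul]
  exact DFunLike.congr_fun this f

lemma signHom_comm (j k : b.support) (f : RatField b.support) :
    signHom hc j (signHom hc k f) = signHom hc k (signHom hc j f) := by
  have : (signHom hc j).comp (signHom hc k) = (signHom hc k).comp (signHom hc j) :=
    ratField_hom_ext hc (by simp) fun lam ↦ by
      simp only [RingHom.comp_apply, signHom_scaledMono, map_mul, signHom_const]
      ring
  exact DFunLike.congr_fun this f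

/-- Past a reflection with even Cartan integer, a sign change is unaffected. -/
lemma signHom_reflHom_of_even {j k : b.support} (h : Even (b.cartanMatrix k j))
    (f : RatField b.support) :
    signHom hc j (reflHom hc k f) = reflHom hc k (signHom hc j f) := by
  have : (signHom hc j).comp (reflHom hc k) = (reflHom hc k).comp (signHom hc j) :=
    ratField_hom_ext hc (by simp) fun lam ↦ by
      simp only [RingHom.comp_apply, signHom_scaledMono, reflHom_scaledMono, map_mul,
        reflHom_const]
      rw [latticePairing_simpleRefl, zpow_sub₀ (by norm_num), (h.mul_left _).neg_one_zpow, div_one]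
  exact DFunLike.congr_fun this f

/-- Past a reflection with odd Cartan integer, a sign change acquires the sign change of the
reflection. -/
lemma signHom_reflHom_of_odd {j k : b.support} (h : Odd (b.cartanMatrix k j))
    (f : RatField b.support) :
    signHom hc j (reflHom hc k f) = reflHom hc k (signHom hc k (signHom hc j f)) := by
  have : (signHom hc j).comp (reflHom hc k) =
      (reflHom hc k).comp ((signHom hc k).comp (signHom hc j)) :=
    ratField_hom_ext hc (by simp) fun lam ↦ by
      simp only [RingHom.comp_apply, signHom_scaledMono, reflHom_scaledMono, map_mul,
        reflHom_const, signHom_const]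
      rw [← mul_assoc, ← const_mul]
      congr 2
      rw [latticePairing_simpleRefl, zpow_sub₀ (by norm_num), div_eq_mul_inv]
      congr 1
      rcases Int.even_or_odd (latticePairing b k lam) with h' | h'
      · rw [(h'.mul_right _).neg_one_zpow, h'.neg_one_zpow, inv_one]
      · rw [(h'.mul h).neg_one_zpow, h'.neg_one_zpow, inv_neg, inv_one]
  exact DFunLike.congr_fun this f

lemma reflHom_comm {i j : b.support} (h : b.cartanMatrix i j = 0)
    (h' : b.cartanMatrix j i = 0) (f : RatField b.support) :
    reflHom hc i (reflHom hc j f) = reflHom hc j (reflHom hc i f) := by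
  have : (reflHom hc i).comp (reflHom hc j) = (reflHom hc j).comp (reflHom hc i) :=
    ratField_hom_ext hc (by simp) (by simp [simpleRefl_comm b h h'])
  exact DFunLike.congr_fun this f

lemma reflHom_braid {i j : b.support} (h : b.cartanMatrix i j = -1)
    (h' : b.cartanMatrix j i = -1) (f : RatField b.support) :
    reflHom hc i (reflHom hc j (reflHom hc i f)) =
      reflHom hc j (reflHom hc i (reflHom hc j f)) := by
  have : (reflHom hc i).comp ((reflHom hc j).comp (reflHom hc i)) =
      (reflHom hc j).comp ((reflHom hc i).comp (reflHom hc j)) :=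
    ratField_hom_ext hc (by simp) (by simp [simpleRefl_braid b h h'])
  exact DFunLike.congr_fun this f

/-- A binomial `1 - a * Y` with a nontrivial monomial `Y` is nonzero. -/
lemma one_sub_const_mul_ne_zero {σ : Type*} [Fintype σ] {c : ℂ} (hc : c ≠ 0) (a : ℂ)
    {k : σ → ℤ} (hk : k ≠ 0) : 1 - const a * scaledMono c k ≠ 0 := by
  have h : 1 - const a * scaledMono c k = laurentHom hc (1 - AddMonoidAlgebra.single k a) := by
    rw [map_sub, map_one, laurentHom_single]
  rw [h, Ne, map_eq_zero_iff _ (laurentHom_injective hc)]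
  intro h0
  have := DFunLike.congr_fun (congrArg AddMonoidAlgebra.coeff h0) 0
  rw [AddMonoidAlgebra.coeff_sub, AddMonoidAlgebra.one_def, Finsupp.sub_apply,
    AddMonoidAlgebra.coeff_single, AddMonoidAlgebra.coeff_single, Finsupp.single_eq_same,
    Finsupp.single_eq_of_ne hk.symm] at this
  simp at this

end FieldAction

/-! ### The twisted action -/

section Slash

open RootPairing

variable {ι M M' : Type*} [AddCommGroup M] [Module ℝ M] [AddCommGroup M'] [Module ℝ M']
  {P : RootPairing ι ℝ M M'} [P.IsCrystallographic] {b : P.Base} {q : ℕ}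

lemma sqrtq_mul_self (q : ℕ) : sqrtq q * sqrtq q = q := by
  rw [sqrtq, ← Complex.ofReal_mul, Real.mul_self_sqrt (Nat.cast_nonneg q), Complex.ofReal_natCast]

lemma sqrtq_ne_zero (hq : q ≠ 0) : sqrtq q ≠ 0 := by
  intro h
  have := sqrtq_mul_self q
  rw [h, zero_mul] at this
  exact hq (by exact_mod_cast this.symm)

variable (b q) in
/-- The rescaled variable `√q * x k`. -/
def scaledVar (k : b.support) : RatField b.support := const (sqrtq q) * x k

omit [P.IsCrystallographic] in
lemma scaledVar_eq (k : b.support) : scaledVar b q k = scaledMono (sqrtq q) (simpleRoot b k) := by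
  classical
  rw [scaledVar, simpleRoot, ← scaledMono_single]

variable (q) in
/-- The constant `1 / √q`. -/
def invSqrt (σ : Type*) : RatField σ := const (sqrtq q)⁻¹

omit [P.IsCrystallographic] in
lemma simpleRoot_ne_zero (k : b.support) : simpleRoot b k ≠ 0 := fun h ↦ by
  simpa using congrFun h k

omit [P.IsCrystallographic] in
lemma simpleRoot_add_ne_zero (j k : b.support) : simpleRoot b j + simpleRoot b k ≠ 0 := fun h ↦ by
  have h1 := congrFun h k
  have h2 := simpleRoot_nonneg b j k
  simp at h1 h2
  lia

variable (hc : sqrtq q ≠ 0)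

include hc

omit [P.IsCrystallographic] in
lemma const_sqrtq_mul_invSqrt : const (sqrtq q) * invSqrt q b.support = 1 := by
  rw [invSqrt, ← const_mul, mul_inv_cancel₀ hc, const_one]

lemma reflHom_invSqrt (k : b.support) : reflHom hc k (invSqrt q _) = invSqrt q _ :=
  reflHom_const ..

lemma signHom_invSqrt (k : b.support) : signHom hc k (invSqrt q _) = invSqrt q _ :=
  signHom_const ..

omit [P.IsCrystallographic] in
lemma x_eq (k : b.support) : x k = invSqrt q _ * scaledVar b q k := by
  rw [scaledVar, ← mul_assoc, mul_comm (invSqrt _ _), const_sqrtq_mul_invSqrt hc, one_mul]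

lemma reflHom_scaledVar_self (k : b.support) :
    reflHom hc k (scaledVar b q k) = (scaledVar b q k)⁻¹ := by
  rw [scaledVar_eq, reflHom_scaledMono, simpleRefl_eq, latticePairing_simpleRoot,
    cartanMatrix_self, ← scaledMono_neg hc]
  congr 1
  module

lemma reflHom_scaledVar_of_zero {j k : b.support} (h : b.cartanMatrix j k = 0) :
    reflHom hc k (scaledVar b q j) = scaledVar b q j := by
  rw [scaledVar_eq, reflHom_scaledMono, simpleRefl_eq, latticePairing_simpleRoot, h, zero_smul,
    sub_zero]

lemma reflHom_scaledVar_of_neg_one {j k : b.support} (h : b.cartanMatrix j k = -1) :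
    reflHom hc k (scaledVar b q j) = scaledVar b q k * scaledVar b q j := by
  rw [scaledVar_eq, scaledVar_eq, reflHom_scaledMono, simpleRefl_eq, latticePairing_simpleRoot, h,
    ← scaledMono_add hc]
  congr 1
  module

lemma signHom_scaledVar_of_even {j k : b.support} (h : Even (b.cartanMatrix j k)) :
    signHom hc k (scaledVar b q j) = scaledVar b q j := by
  rw [scaledVar_eq, signHom_scaledMono, latticePairing_simpleRoot, h.neg_one_zpow, const_one,
    one_mul]

lemma signHom_scaledVar_of_odd {j k : b.support} (h : Odd (b.cartanMatrix j k)) :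
    signHom hc k (scaledVar b q j) = -scaledVar b q j := by
  rw [scaledVar_eq, signHom_scaledMono, latticePairing_simpleRoot, h.neg_one_zpow, const,
    map_neg, map_neg, map_one, map_one, neg_one_mul]

omit [P.IsCrystallographic] in
lemma scaledVar_ne_zero (k : b.support) : scaledVar b q k ≠ 0 := by
  rw [scaledVar_eq]; exact scaledMono_ne_zero hc _

omit [P.IsCrystallographic] in
lemma one_sub_mul_scaledVar_ne_zero (a : ℂ) (k : b.support) :
    1 - const a * scaledVar b q k ≠ 0 := by
  rw [scaledVar_eq]; exact one_sub_const_mul_ne_zero hc a (simpleRoot_ne_zero k)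

omit [P.IsCrystallographic] in
lemma scaledVar_sub_invSqrt_ne_zero (k : b.support) :
    scaledVar b q k - invSqrt q _ ≠ 0 := by
  have h := one_sub_mul_scaledVar_ne_zero hc (sqrtq q) k
  intro h0
  rw [sub_eq_zero] at h0
  rw [h0, const_sqrtq_mul_invSqrt hc, sub_self] at h
  exact h rfl

variable (hP : b.cartanMatrix.IsSimplyLaced)
include hP

/-- Substituting `σ k x` is the field automorphism induced by the reflection of exponents. -/
lemma subst_reflPt [Finite ι] (k : b.support) (f : RatField b.support) :
    subst (reflPt b q k) f = reflHom hc k f := by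
  refine subst_eq_fieldHom hc _ _ _ (fun j ↦ ?_) f
  change _ = reflHom hc k (x j)
  have hs := const_sqrtq_mul_invSqrt (b := b) hc
  have hx := x_ne_zero j
  have hs0 : (const (sqrtq q) : RatField b.support) ≠ 0 := const_ne_zero hc
  rw [x_eq hc, map_mul, reflHom_invSqrt, reflPt]
  rcases eq_or_ne j k with rfl | hjk
  · rw [if_pos rfl, reflHom_scaledVar_self, ← sqrtq_mul_self, const_mul, scaledVar]
    field_simp
    linear_combination -hs
  · rw [if_neg hjk]
    have hsymm := cartanMatrix_symm b hP j k
    rcases hP hjk with h | h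
    · rw [if_neg (by rw [Adj, ← hsymm]; simp [h]), reflHom_scaledVar_of_zero hc h, scaledVar]
      linear_combination -x j * hs
    · rw [if_pos ⟨hjk.symm, by rw [← hsymm, h]; decide⟩, reflHom_scaledVar_of_neg_one hc h,
        scaledVar, scaledVar]
      linear_combination -x j * x k * const (sqrtq q) * hs

/-- Substituting `ε k x` is the field automorphism `Y ^ lam ↦ (-1) ^ ⟨lam, coroot k⟩ * Y ^ lam`: in a
simply-laced diagram the nodes adjacent to `k` are those with odd Cartan integer. -/
lemma subst_signPt [Finite ι] (k : b.support) (f : RatField b.support) :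
    subst (signPt b k) f = signHom hc k f := by
  refine subst_eq_fieldHom hc _ _ _ (fun j ↦ ?_) f
  change _ = signHom hc k (x j)
  have hs := const_sqrtq_mul_invSqrt (b := b) hc
  rw [x_eq hc, map_mul, signHom_invSqrt, signPt]
  rcases eq_or_ne j k with rfl | hjk
  · rw [if_neg (by simp [Adj]), signHom_scaledVar_of_even hc (by simp), scaledVar]
    linear_combination -x j * hs
  · have hsymm := cartanMatrix_symm b hP j k
    rcases hP hjk with h | h
    · rw [if_neg (by rw [Adj, ← hsymm]; simp [h]), signHom_scaledVar_of_even hc (by simp [h]),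
        scaledVar]
      linear_combination -x j * hs
    · rw [if_pos ⟨hjk.symm, by rw [← hsymm, h]; decide⟩, signHom_scaledVar_of_odd hc (by simp [h]),
        scaledVar]
      linear_combination x j * hs

/-- The slash action in terms of the rescaled variable `y k` and the field automorphism `σ k`. -/
lemma slashSimple_eq_plus_minus [Finite ι] (k : b.support) (f : RatField b.support) :
    slashSimple b q 0 k f =
      (scaledVar b q k - invSqrt q _) /
          (scaledVar b q k * (1 - invSqrt q _ * scaledVar b q k)) *
        reflHom hc k (plusPart b 0 k f) +
      (scaledVar b q k)⁻¹ * reflHom hc k (minusPart b 0 k f) := by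
  have hs := const_sqrtq_mul_invSqrt (b := b) hc
  have hs0 : (const (sqrtq q) : RatField b.support) ≠ 0 := const_ne_zero hc
  have hx := x_ne_zero k
  have h1 := one_sub_mul_scaledVar_ne_zero (b := b) hc (sqrtq q)⁻¹ k
  have hxe := x_eq (b := b) hc k
  have h1' : 1 - x k ≠ 0 := by rw [hxe]; exact h1
  rw [slashSimple, subst_reflPt hc hP, subst_reflPt hc hP, ← sqrtq_mul_self, const_mul, ← hxe]
  simp only [Pi.zero_apply, pow_zero, mul_one]
  congr 2
  · have hi : invSqrt q _ = (const (sqrtq q) : RatField b.support)⁻¹ :=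
      eq_inv_of_mul_eq_one_right hs
    rw [hi, scaledVar]
    field_simp
    ring
  · rw [scaledVar, one_div, mul_comm]

lemma slashSimple_eq [Finite ι] (k : b.support) (f : RatField b.support) :
    slashSimple b q 0 k f =
      slashOp (reflHom hc k) (signHom hc k) (invSqrt q _) (scaledVar b q k) f := by
  have h1 := one_sub_mul_scaledVar_ne_zero (b := b) hc (sqrtq q)⁻¹ k
  have h1' : 1 - scaledVar b q k * invSqrt q _ ≠ 0 := by rw [mul_comm]; exact h1
  have hy := scaledVar_ne_zero (b := b) hc k
  rw [slashSimple_eq_plus_minus hc hP, plusPart, minusPart, subst_signPt hc hP, slashOp,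
    slashCoeff, slashCoeffSign]
  simp only [Pi.zero_apply, pow_zero, one_mul, map_div₀, map_add, map_sub, map_ofNat]
  field_simp
  ring

lemma slashSimple_slashSimple [Finite ι] (k : b.support) (f : RatField b.support) :
    slashSimple b q 0 k (slashSimple b q 0 k f) = f := by
  rw [slashSimple_eq hc hP, slashSimple_eq hc hP]
  exact slashOp_slashOp (reflHom_invSqrt hc k) (signHom_invSqrt hc k) (reflHom_scaledVar_self hc k)
    (signHom_scaledVar_of_even hc (by simp)) (reflHom_reflHom hc k) (signHom_signHom hc k)
    (signHom_reflHom_of_even hc (by simp)) (scaledVar_ne_zero hc k)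
    (one_sub_mul_scaledVar_ne_zero hc _ k) (scaledVar_sub_invSqrt_ne_zero hc k) f

lemma slashSimple_comm [Finite ι] {i j : b.support} (h : b.cartanMatrix i j = 0)
    (f : RatField b.support) :
    slashSimple b q 0 i (slashSimple b q 0 j f) = slashSimple b q 0 j (slashSimple b q 0 i f) := by
  have h' := (cartanMatrix_symm b hP i j).symm.trans h
  have he : Even (b.cartanMatrix i j) := by simp [h]
  have he' : Even (b.cartanMatrix j i) := by simp [h']
  simp only [slashSimple_eq hc hP]
  exact slashOp_comm (reflHom_invSqrt hc i) (signHom_invSqrt hc i) (reflHom_invSqrt hc j)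
    (signHom_invSqrt hc j) (reflHom_scaledVar_of_zero hc h') (signHom_scaledVar_of_even hc he')
    (reflHom_scaledVar_of_zero hc h) (signHom_scaledVar_of_even hc he) (reflHom_comm hc h h')
    (signHom_comm hc i j) (signHom_reflHom_of_even hc he') (signHom_reflHom_of_even hc he) f

lemma slashSimple_braid [Finite ι] {i j : b.support} (h : b.cartanMatrix i j = -1)
    (f : RatField b.support) :
    slashSimple b q 0 i (slashSimple b q 0 j (slashSimple b q 0 i f)) =
      slashSimple b q 0 j (slashSimple b q 0 i (slashSimple b q 0 j f)) := by
  have h' := (cartanMatrix_symm b hP i j).symm.trans h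
  have ho : Odd (b.cartanMatrix i j) := by simp [h]
  have ho' : Odd (b.cartanMatrix j i) := by simp [h']
  have hi (k : b.support) : Even (b.cartanMatrix k k) := by simp
  have hsub (a : ℂ) : 1 - const a * scaledVar b q i * scaledVar b q j ≠ 0 := by
    rw [scaledVar_eq, scaledVar_eq, mul_assoc, ← scaledMono_add hc]
    exact one_sub_const_mul_ne_zero hc a (simpleRoot_add_ne_zero i j)
  have hneg : invSqrt q b.support = -const (-(sqrtq q)⁻¹) := by
    rw [invSqrt, const, const, map_neg, map_neg, neg_neg]
  simp only [slashSimple_eq hc hP]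
  refine slashOp_braid (reflHom_invSqrt hc i) (signHom_invSqrt hc i) (reflHom_invSqrt hc j)
    (signHom_invSqrt hc j) (reflHom_scaledVar_self hc i) (reflHom_scaledVar_self hc j)
    (reflHom_scaledVar_of_neg_one hc h') ?_ (signHom_scaledVar_of_even hc (hi i))
    (signHom_scaledVar_of_even hc (hi j)) (signHom_scaledVar_of_odd hc ho')
    (signHom_scaledVar_of_odd hc ho) (signHom_signHom hc i) (signHom_signHom hc j)
    (signHom_comm hc j i) (signHom_reflHom_of_even hc (hi i)) (signHom_reflHom_of_even hc (hi j))
    ?_ (signHom_reflHom_of_odd hc ho) (fun f ↦ (reflHom_braid hc h h' f).symm)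
    (scaledVar_ne_zero hc i) (scaledVar_ne_zero hc j) (one_sub_mul_scaledVar_ne_zero hc _ i)
    (one_sub_mul_scaledVar_ne_zero hc _ j) (hsub _) ?_ ?_ ?_ f
  · rw [reflHom_scaledVar_of_neg_one hc h, mul_comm]
  · intro f
    rw [signHom_reflHom_of_odd hc ho', signHom_comm]
  · rw [hneg, neg_mul, ← sub_eq_add_neg]
    exact one_sub_mul_scaledVar_ne_zero hc _ i
  · rw [hneg, neg_mul, ← sub_eq_add_neg]
    exact one_sub_mul_scaledVar_ne_zero hc _ j
  · rw [hneg, neg_mul, neg_mul, ← sub_eq_add_neg]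
    exact hsub _

/-- The action along a word depends only on the product of the word in the Weyl group. -/
lemma foldl_slashSimple_eq [Fintype ι] [P.IsReduced] {l l' : List b.support}
    (h : wordProd b l = wordProd b l') (f : RatField b.support) :
    l.foldl (fun g i ↦ slashSimple b q 0 i g) f = l'.foldl (fun g i ↦ slashSimple b q 0 i g) f :=
  foldl_eq_of_wordProd_eq b hP _ (slashSimple_slashSimple hc hP)
    (fun _ _ f h ↦ slashSimple_comm hc hP h f) (fun _ _ f h ↦ slashSimple_braid hc hP h f) h f

end Slash

/-! ### Invariance of the average -/

section Average

open RootPairing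

variable {ι M M' : Type*} [AddCommGroup M] [Module ℝ M] [AddCommGroup M'] [Module ℝ M']
  {P : RootPairing ι ℝ M M'} [P.IsCrystallographic] {b : P.Base} {q : ℕ}

/-- A rational function is even if it is unchanged by all sign changes `ε k`. -/
def IsEvenFun (hc : sqrtq q ≠ 0) (h : RatField b.support) : Prop :=
  ∀ k, signHom hc k h = h

/-- The factor `1 - q ^ d(α) x ^ (2 α)` of `Δ`. -/
def deltaFactor (b : P.Base) (q : ℕ) (i : ι) : RatField b.support :=
  1 - scaledMono (sqrtq q) (2 • rootCoord b i)

/-- The factor `1 - q ^ (d(α) - 1) x ^ (2 α)` of `D`. -/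
def denomFactor (b : P.Base) (q : ℕ) (i : ι) : RatField b.support :=
  1 - const (q : ℂ)⁻¹ * scaledMono (sqrtq q) (2 • rootCoord b i)

omit [P.IsCrystallographic] in
lemma scaledMono_two_smul (lam : Lattice b) :
    scaledMono (sqrtq q) (2 • lam) = const (q : ℂ) ^ ht b lam * mono (2 • lam) := by
  rw [scaledMono, ← sqrtq_mul_self, const_mul, ← pow_two, ← zpow_natCast, ← zpow_mul]
  congr 2
  simp [ht, Finset.mul_sum]

variable [Fintype ι]

variable (b) in
/-- The positive roots. -/
def posRoots : Finset ι := open Classical in {i | b.IsPos i}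

omit [P.IsCrystallographic] in
@[simp] lemma mem_posRoots {i : ι} : i ∈ posRoots b ↔ b.IsPos i := by simp [posRoots]

omit [P.IsCrystallographic] in
lemma Delta_eq_prod : Delta b q = ∏ i ∈ posRoots b, deltaFactor b q i := by
  rw [Delta, posRoots]
  refine Finset.prod_congr rfl fun i _ ↦ ?_
  rw [deltaFactor, scaledMono_two_smul]

omit [P.IsCrystallographic] in
lemma denom_eq_prod (hq : q ≠ 0) : denom b q = ∏ i ∈ posRoots b, denomFactor b q i := by
  rw [denom, posRoots]
  refine Finset.prod_congr rfl fun i _ ↦ ?_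
  have h0 : (q : ℂ) ≠ 0 := by exact_mod_cast hq
  have h1 : (const (q : ℂ)⁻¹ : RatField b.support) = (const (q : ℂ))⁻¹ := by
    rw [← algebraMap_complex_eq_const, ← algebraMap_complex_eq_const, map_inv₀]
  rw [denomFactor, scaledMono_two_smul, zpow_sub_one₀ (const_ne_zero h0), h1]
  ring

omit [P.IsCrystallographic] [Fintype ι] in
lemma two_smul_rootCoord_ne_zero (i : ι) : 2 • rootCoord b i ≠ 0 := by
  intro h
  have h1 := b.height_ne_zero i
  rw [height_eq_ht, ht] at h1
  refine h1 (Finset.sum_eq_zero fun j _ ↦ ?_)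
  have := congrFun h j
  simp only [Pi.smul_apply, Pi.zero_apply] at this
  simpa using this

/-- A simple reflection permutes the positive roots other than the simple root itself. -/
lemma prod_posRoots_smul [P.IsReduced] {K : Type*} [CommMonoid K] (F : ι → K) (k : b.support) :
    (∏ i ∈ posRoots b, F (simpleElt P k • i)) * F k =
      (∏ i ∈ posRoots b, F i) * F (simpleElt P k • (k : ι)) := by
  classical
  have hk : (k : ι) ∈ posRoots b := by simpa using Base.isPos_of_mem_support k.2
  have h : ∏ i ∈ (posRoots b).erase k, F (simpleElt P k • i) =
      ∏ i ∈ (posRoots b).erase k, F i := by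
    refine Finset.prod_bij' (fun i _ ↦ simpleElt P k • i) (fun i _ ↦ simpleElt P k • i)
      ?_ ?_ (fun i _ ↦ simpleElt_smul_smul _ _) (fun i _ ↦ simpleElt_smul_smul _ _)
      (fun _ _ ↦ rfl) <;>
    · intro i hi
      rw [Finset.mem_erase, mem_posRoots] at hi ⊢
      refine ⟨fun hik ↦ ?_, isPos_simpleElt_smul b k hi.2 hi.1⟩
      have : i = P.reflectionPerm k k := by
        rw [← simpleElt_smul_smul (P := P) k i, hik, simpleElt_smul]
      rw [this, isPos_reflectionPerm_self] at hi
      exact hi.2 (Base.isPos_of_mem_support k.2)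
  rw [← Finset.mul_prod_erase (posRoots b) (fun i ↦ F (simpleElt P k • i)) hk, h,
    ← Finset.mul_prod_erase (posRoots b) F hk]
  ac_rfl

variable (hc : sqrtq q ≠ 0)

include hc

omit [P.IsCrystallographic] [Fintype ι] in
lemma deltaFactor_ne_zero (i : ι) : deltaFactor b q i ≠ 0 := by
  have := one_sub_const_mul_ne_zero hc 1 (two_smul_rootCoord_ne_zero (b := b) i)
  rwa [const_one, one_mul] at this

omit [P.IsCrystallographic] [Fintype ι] in
lemma denomFactor_ne_zero (i : ι) : denomFactor b q i ≠ 0 :=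
  one_sub_const_mul_ne_zero hc _ (two_smul_rootCoord_ne_zero (b := b) i)

omit [P.IsCrystallographic] in
lemma Delta_ne_zero : Delta b q ≠ 0 := by
  rw [Delta_eq_prod]
  exact Finset.prod_ne_zero_iff.mpr fun i _ ↦ deltaFactor_ne_zero hc i

omit hc [Fintype ι] in
lemma simpleRefl_two_smul_rootCoord (k : b.support) (i : ι) :
    simpleRefl b k (2 • rootCoord b i) = 2 • rootCoord b (simpleElt P k • i) := by
  rw [two_smul, simpleRefl_add, simpleRefl_rootCoord, ← two_smul ℕ]

omit [Fintype ι] in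
lemma reflHom_deltaFactor (k : b.support) (i : ι) :
    reflHom hc k (deltaFactor b q i) = deltaFactor b q (simpleElt P k • i) := by
  rw [deltaFactor, map_sub, map_one, reflHom_scaledMono, simpleRefl_two_smul_rootCoord]
  rfl

omit [Fintype ι] in
lemma reflHom_denomFactor (k : b.support) (i : ι) :
    reflHom hc k (denomFactor b q i) = denomFactor b q (simpleElt P k • i) := by
  rw [denomFactor, map_sub, map_one, map_mul, reflHom_const, reflHom_scaledMono,
    simpleRefl_two_smul_rootCoord]
  rfl

omit [Fintype ι] in
lemma signHom_scaledMono_two_smul (k : b.support) (lam : Lattice b) :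
    signHom hc k (scaledMono (sqrtq q) (2 • lam)) = scaledMono (sqrtq q) (2 • lam) := by
  rw [signHom_scaledMono, map_nsmul, Even.neg_one_zpow (by simp), const_one, one_mul]

omit [Fintype ι] in
lemma isEvenFun_deltaFactor (i : ι) : IsEvenFun hc (deltaFactor b q i) := fun k ↦ by
  rw [deltaFactor, map_sub, map_one, signHom_scaledMono_two_smul]

omit [Fintype ι] in
lemma isEvenFun_denomFactor (i : ι) : IsEvenFun hc (denomFactor b q i) := fun k ↦ by
  rw [denomFactor, map_sub, map_one, map_mul, signHom_const, signHom_scaledMono_two_smul]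

omit [Fintype ι] in
lemma IsEvenFun.prod {κ : Type*} {S : Finset κ} {F : κ → RatField b.support}
    (h : ∀ i ∈ S, IsEvenFun hc (F i)) : IsEvenFun hc (∏ i ∈ S, F i) := fun k ↦ by
  rw [map_prod]
  exact Finset.prod_congr rfl fun i hi ↦ h i hi k

omit [Fintype ι] in
lemma IsEvenFun.inv {h : RatField b.support} (hh : IsEvenFun hc h) : IsEvenFun hc h⁻¹ :=
  fun k ↦ by rw [map_inv₀, hh k]

lemma isEvenFun_Delta : IsEvenFun hc (Delta b q) := by
  rw [Delta_eq_prod]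
  exact IsEvenFun.prod hc fun i _ ↦ isEvenFun_deltaFactor hc i

lemma reflHom_Delta [P.IsReduced] (k : b.support) :
    reflHom hc k (Delta b q) * scaledVar b q k ^ 2 = -Delta b q := by
  have hy := scaledVar_ne_zero (b := b) hc k
  have h := prod_posRoots_smul (b := b) (deltaFactor b q) k
  have hk : deltaFactor b q (k : ι) = 1 - scaledVar b q k ^ 2 := by
    rw [deltaFactor, rootCoord_coe, scaledMono_nsmul hc, scaledVar_eq]
  have hk0 := deltaFactor_ne_zero (b := b) hc (k : ι)
  rw [← reflHom_deltaFactor hc, hk, map_sub, map_pow, map_one, reflHom_scaledVar_self] at h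
  rw [hk] at hk0
  rw [Delta_eq_prod, map_prod]
  simp only [reflHom_deltaFactor]
  apply mul_right_cancel₀ hk0
  rw [mul_right_comm, h]
  field_simp
  ring

variable (hP : b.cartanMatrix.IsSimplyLaced)
include hP

omit [Fintype ι] in
lemma IsEvenFun.reflHom [Finite ι] {h : RatField b.support} (hh : IsEvenFun hc h) (k : b.support) :
    IsEvenFun hc (reflHom hc k h) := fun j ↦ by
  rcases eq_or_ne k j with rfl | hkj
  · rw [signHom_reflHom_of_even hc (by simp), hh]
  rcases hP hkj with h0 | h0
  · rw [signHom_reflHom_of_even hc (by simp [h0]), hh]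
  · rw [signHom_reflHom_of_odd hc (by simp [h0]), hh, hh]

lemma slashSimple_mul {h : RatField b.support} (hh : IsEvenFun hc h) (k : b.support)
    (f : RatField b.support) :
    slashSimple b q 0 k (h * f) = reflHom hc k h * slashSimple b q 0 k f := by
  rw [slashSimple_eq hc hP, slashSimple_eq hc hP, slashOp, slashOp, map_mul, map_mul, map_mul, hh]
  ring

lemma slashSimple_add (k : b.support) (f g : RatField b.support) :
    slashSimple b q 0 k (f + g) = slashSimple b q 0 k f + slashSimple b q 0 k g := by
  simp only [slashSimple_eq hc hP, slashOp, map_add]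
  ring

lemma slashSimple_sum {κ : Type*} (S : Finset κ) (F : κ → RatField b.support) (k : b.support) :
    slashSimple b q 0 k (∑ i ∈ S, F i) = ∑ i ∈ S, slashSimple b q 0 k (F i) := by
  classical
  induction S using Finset.induction_on with
  | empty => simp [slashSimple_eq hc hP, slashOp]
  | insert a S ha ih => rw [Finset.sum_insert ha, Finset.sum_insert ha, slashSimple_add hc hP, ih]

lemma foldl_slashSimple_mul (l : List b.support) {h : RatField b.support} (hh : IsEvenFun hc h)
    (f : RatField b.support) :
    l.foldl (fun g i ↦ slashSimple b q 0 i g) (h * f) =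
      l.foldl (fun g i ↦ subst (reflPt b q i) g) h *
        l.foldl (fun g i ↦ slashSimple b q 0 i g) f := by
  induction l generalizing h f with
  | nil => rfl
  | cons k l ih =>
    rw [List.foldl_cons, List.foldl_cons, List.foldl_cons, slashSimple_mul hc hP hh,
      ih (hh.reflHom hc hP k), subst_reflPt hc hP]

lemma foldl_subst_inv (l : List b.support) (h : RatField b.support) :
    l.foldl (fun g i ↦ subst (reflPt b q i) g) h⁻¹ =
      (l.foldl (fun g i ↦ subst (reflPt b q i) g) h)⁻¹ := by
  induction l generalizing h with
  | nil => rfl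
  | cons k l ih =>
    rw [List.foldl_cons, List.foldl_cons, subst_reflPt hc hP, subst_reflPt hc hP, map_inv₀, ih]

variable [P.IsReduced]

lemma cocycle_mul_slash (w : P.weylGroup) :
    cocycle b q w * slash b q 0 w 1 = Delta b q * slash b q 0 w (Delta b q)⁻¹ := by
  have h := foldl_slashSimple_mul hc hP (word b w) ((isEvenFun_Delta (b := b) hc).inv hc) 1
  rw [mul_one] at h
  rw [slash, slash, h, foldl_subst_inv hc hP, cocycle, translate, div_eq_mul_inv, mul_assoc]

omit hc hP in
lemma finite_weylGroup (b : P.Base) : Finite P.weylGroup := by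
  refine Finite.of_injective (fun (w : P.weylGroup) (i : ι) ↦ w • i) fun w w' h ↦ ?_
  rw [← inv_mul_eq_one]
  refine eq_one_of_forall_isPos b _ fun k ↦ ?_
  have hk : w • (k : ι) = w' • (k : ι) := congrFun h k
  rw [mul_smul, ← hk, inv_smul_smul]
  exact Base.isPos_of_mem_support k.2

omit hc hP in
lemma wordProd_word (w : P.weylGroup) : wordProd b (word b w) = w := (exists_word b w).choose_spec

variable [Fintype P.weylGroup]

lemma average_eq_sum : average b q 0 = ∑ w : P.weylGroup, slash b q 0 w (Delta b q)⁻¹ := by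
  rw [average, finsum_eq_sum_of_fintype]
  simp only [cocycle_mul_slash hc hP]
  rw [← Finset.mul_sum, ← mul_assoc, inv_mul_cancel₀ (Delta_ne_zero hc), one_mul]

/-- The average is invariant under the twisted action. -/
lemma slashSimple_average (k : b.support) :
    slashSimple b q 0 k (average b q 0) = average b q 0 := by
  rw [average_eq_sum hc hP, slashSimple_sum hc hP]
  refine Fintype.sum_equiv (Equiv.mulRight (simpleElt P k)) _ _ fun w ↦ ?_
  have h := foldl_slashSimple_eq hc hP (l := word b w ++ [k])
    (l' := word b (w * simpleElt P k)) (by simp [wordProd_word]) (Delta b q)⁻¹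
  rw [List.foldl_append] at h
  exact h

end Average

/-! ### The terms of the average are regular at the origin -/

section Polynomial

variable {σ : Type*}

/-- A rational function which is a polynomial with constant term `a`. -/
def IsPolyWithConst (a : ℂ) (f : RatField σ) : Prop :=
  ∃ p : MvPolynomial σ ℂ, algebraMap (MvPolynomial σ ℂ) (RatField σ) p = f ∧
    MvPolynomial.constantCoeff p = a

lemma IsPolyWithConst.add {a a' : ℂ} {f f' : RatField σ} (h : IsPolyWithConst a f)
    (h' : IsPolyWithConst a' f') : IsPolyWithConst (a + a') (f + f') := by
  obtain ⟨p, rfl, rfl⟩ := h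
  obtain ⟨p', rfl, rfl⟩ := h'
  exact ⟨p + p', map_add .., map_add ..⟩

lemma IsPolyWithConst.mul {a a' : ℂ} {f f' : RatField σ} (h : IsPolyWithConst a f)
    (h' : IsPolyWithConst a' f') : IsPolyWithConst (a * a') (f * f') := by
  obtain ⟨p, rfl, rfl⟩ := h
  obtain ⟨p', rfl, rfl⟩ := h'
  exact ⟨p * p', map_mul .., map_mul ..⟩

lemma isPolyWithConst_const (a : ℂ) : IsPolyWithConst a (const a : RatField σ) :=
  ⟨MvPolynomial.C a, rfl, by simp⟩

lemma isPolyWithConst_zero : IsPolyWithConst 0 (0 : RatField σ) := ⟨0, by simp, by simp⟩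

lemma IsPolyWithConst.prod {κ : Type*} {S : Finset κ} {F : κ → RatField σ}
    (h : ∀ i ∈ S, IsPolyWithConst 1 (F i)) : IsPolyWithConst 1 (∏ i ∈ S, F i) := by
  classical
  induction S using Finset.induction_on with
  | empty => simpa using isPolyWithConst_const 1
  | insert a S ha ih =>
    rw [Finset.prod_insert ha, ← one_mul (1 : ℂ)]
    exact (h a (by simp)).mul (ih fun i hi ↦ h i (by simp [hi]))

lemma IsPolyWithConst.sum {κ : Type*} {S : Finset κ} {F : κ → RatField σ} {a : κ → ℂ}
    (h : ∀ i ∈ S, IsPolyWithConst (a i) (F i)) :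
    IsPolyWithConst (∑ i ∈ S, a i) (∑ i ∈ S, F i) := by
  classical
  induction S using Finset.induction_on with
  | empty => simpa using isPolyWithConst_zero
  | insert a S ha ih =>
    rw [Finset.sum_insert ha, Finset.sum_insert ha]
    exact (h a (by simp)).add (ih fun i hi ↦ h i (by simp [hi]))

variable [Fintype σ] {c : ℂ}

lemma isPolyWithConst_mono {k : σ → ℤ} (hk : 0 ≤ k) (hk0 : k ≠ 0) (a : ℂ) :
    IsPolyWithConst 0 (const a * scaledMono c k) := by
  classical
  refine ⟨_, (scaledMono_eq_algebraMap hk a).symm, ?_⟩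
  rw [MvPolynomial.constantCoeff_monomial, if_neg]
  intro h
  have h0 : natExponent (0 : σ → ℤ) = 0 := by ext; simp [natExponent]
  exact hk0 (natExponent_injOn hk (by simp) (h.trans h0.symm))

lemma isPolyWithConst_one_sub {k : σ → ℤ} (hk : 0 ≤ k) (hk0 : k ≠ 0) (a : ℂ) :
    IsPolyWithConst 1 (1 - const a * scaledMono c k) := by
  have h := (isPolyWithConst_const (σ := σ) 1).add
    (((isPolyWithConst_const (σ := σ) (-1)).mul (isPolyWithConst_mono (c := c) hk hk0 a)))
  have hneg : (const (-1) : RatField σ) = -1 := by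
    rw [const, map_neg, map_neg, map_one, map_one]
  rw [hneg] at h
  simpa [sub_eq_add_neg] using h

end Polynomial

section Terms

open RootPairing

variable {ι M M' : Type*} [AddCommGroup M] [Module ℝ M] [AddCommGroup M'] [Module ℝ M']
  {P : RootPairing ι ℝ M M'} {b : P.Base} {q : ℕ}

variable (b) in
/-- The sums of the roots in `S`, each taken with a positive multiplicity. -/
def positiveSums (S : Finset ι) : Set (Lattice b) :=
  {lam | ∃ n : ι → ℕ, lam = ∑ i ∈ S, (n i + 1) • rootCoord b i}

variable (b q) in
/-- The Laurent polynomials whose exponents are sums of all roots in `S` with positive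
multiplicities. -/
def positiveSpan (S : Finset ι) : Submodule ℂ (RatField b.support) :=
  Submodule.span ℂ (scaledMono (sqrtq q) '' positiveSums b S)

lemma isPolyWithConst_of_mem_positiveSpan {S : Finset ι} (hS : ∀ i ∈ S, b.IsPos i)
    (hne : S.Nonempty) {f : RatField b.support} (hf : f ∈ positiveSpan b q S) :
    IsPolyWithConst 0 f := by
  induction hf using Submodule.span_induction with
  | mem f hf =>
    obtain ⟨lam, ⟨n, rfl⟩, rfl⟩ := hf
    rw [← one_mul (scaledMono _ _), ← const_one]
    refine isPolyWithConst_mono (Finset.sum_nonneg fun i hi ↦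
      nsmul_nonneg (rootCoord_nonneg b (hS i hi)) _) (fun h0 ↦ ?_) 1
    have hht : ∀ S : Finset ι, ht b (∑ i ∈ S, (n i + 1) • rootCoord b i) =
        ∑ i ∈ S, (n i + 1) • ht b (rootCoord b i) := fun S ↦
      map_sum ({ toFun := ht b, map_zero' := by simp [ht], map_add' := ht_add b } :
        Lattice b →+ ℤ) _ _ |>.trans (Finset.sum_congr rfl fun i _ ↦ map_nsmul
        ({ toFun := ht b, map_zero' := by simp [ht], map_add' := ht_add b } :
        Lattice b →+ ℤ) _ _)
    have hpos : 0 < ∑ i ∈ S, (n i + 1) • ht b (rootCoord b i) :=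
      Finset.sum_pos (fun i hi ↦ nsmul_pos (ht_rootCoord_pos b (hS i hi)) (by lia)) hne
    rw [← hht, h0] at hpos
    simp [ht] at hpos
  | zero => exact isPolyWithConst_zero
  | add f g _ _ hf hg => simpa using hf.add hg
  | smul a f _ hf =>
    rw [Algebra.smul_def, algebraMap_complex_eq_const]
    simpa using (isPolyWithConst_const a).mul hf

lemma const_mul_mem_positiveSpan {S : Finset ι} {f : RatField b.support}
    (hf : f ∈ positiveSpan b q S) (a : ℂ) : const a * f ∈ positiveSpan b q S := by
  rw [← algebraMap_complex_eq_const, ← Algebra.smul_def]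
  exact Submodule.smul_mem _ _ hf

variable [P.IsCrystallographic] (hc : sqrtq q ≠ 0)

include hc

omit [P.IsCrystallographic] in
lemma scaledVar_pow_mul_mem_positiveSpan [DecidableEq ι] {S : Finset ι} {k : b.support}
    (hk : (k : ι) ∉ S) {f : RatField b.support} (hf : f ∈ positiveSpan b q S) (m : ℕ) :
    scaledVar b q k ^ (m + 1) * f ∈ positiveSpan b q (insert (k : ι) S) := by
  induction hf using Submodule.span_induction with
  | mem f hf =>
    obtain ⟨lam, ⟨n, rfl⟩, rfl⟩ := hf
    refine Submodule.subset_span ⟨_, ⟨Function.update n k m, rfl⟩, ?_⟩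
    rw [scaledVar_eq, ← scaledMono_nsmul hc, ← scaledMono_add hc, Finset.sum_insert hk,
      Function.update_self, rootCoord_coe]
    congr 2
    refine Finset.sum_congr rfl fun i hi ↦ ?_
    rw [Function.update_of_ne (by rintro rfl; exact hk hi)]
  | zero => simp
  | add f g _ _ hf hg => rw [mul_add]; exact add_mem hf hg
  | smul a f _ hf => rw [mul_smul_comm]; exact Submodule.smul_mem _ _ hf

lemma reflHom_smul (k : b.support) (a : ℂ) (f : RatField b.support) :
    reflHom hc k (a • f) = a • reflHom hc k f := by
  rw [Algebra.smul_def, Algebra.smul_def, map_mul, algebraMap_complex_eq_const, reflHom_const]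

lemma signHom_smul (k : b.support) (a : ℂ) (f : RatField b.support) :
    signHom hc k (a • f) = a • signHom hc k f := by
  rw [Algebra.smul_def, Algebra.smul_def, map_mul, algebraMap_complex_eq_const, signHom_const]

lemma reflHom_mem_positiveSpan [DecidableEq ι] {S : Finset ι} (k : b.support)
    {f : RatField b.support} (hf : f ∈ positiveSpan b q S) :
    reflHom hc k f ∈ positiveSpan b q (S.image fun i ↦ simpleElt P k • i) := by
  induction hf using Submodule.span_induction with
  | mem f hf =>
    obtain ⟨lam, ⟨n, rfl⟩, rfl⟩ := hf
    refine Submodule.subset_span ⟨_, ⟨fun i ↦ n (simpleElt P k • i), rfl⟩, ?_⟩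
    rw [reflHom_scaledMono, Finset.sum_image (by simp)]
    congr 1
    rw [← reflEquiv_apply, map_sum]
    refine Finset.sum_congr rfl fun i _ ↦ ?_
    rw [map_nsmul, reflEquiv_apply, simpleRefl_rootCoord]
    beta_reduce
    rw [simpleElt_smul_smul]
  | zero => simp
  | add f g _ _ hf hg => rw [map_add]; exact add_mem hf hg
  | smul a f _ hf => rw [reflHom_smul]; exact Submodule.smul_mem _ _ hf

lemma signHom_mem_positiveSpan {S : Finset ι} (k : b.support)
    {f : RatField b.support} (hf : f ∈ positiveSpan b q S) :
    signHom hc k f ∈ positiveSpan b q S := by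
  induction hf using Submodule.span_induction with
  | mem f hf =>
    obtain ⟨lam, hlam, rfl⟩ := hf
    rw [signHom_scaledMono]
    exact const_mul_mem_positiveSpan (Submodule.subset_span ⟨_, hlam, rfl⟩) _
  | zero => simp
  | add f g _ _ hf hg => rw [map_add]; exact add_mem hf hg
  | smul a f _ hf => rw [signHom_smul]; exact Submodule.smul_mem _ _ hf

variable [Fintype ι] [P.IsReduced] (hP : b.cartanMatrix.IsSimplyLaced)
include hP

/-- The term `Δ * (Δ⁻¹ ∣ w)` of the average, computed along a reduced word for `w`. Its only
denominators are the factors of `D` belonging to the inversions of `w`, and once they are cleared,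
every exponent is a sum of all inversions with positive multiplicities. -/
lemma prod_denomFactor_mul_mem_positiveSpan (l : List b.support) (hl : IsReducedWord b l) :
    (∏ i ∈ inversions b (wordProd b l), denomFactor b q i) *
      (Delta b q * l.foldl (fun g i ↦ slashSimple b q 0 i g) (Delta b q)⁻¹) ∈
      positiveSpan b q (inversions b (wordProd b l)) := by
  classical
  have hD0 := Delta_ne_zero (b := b) hc
  induction l using List.reverseRecOn with
  | nil =>
    rw [List.foldl_nil, mul_inv_cancel₀ hD0, wordProd_nil, inversions_one, Finset.prod_empty,
      mul_one]
    exact Submodule.subset_span ⟨0, ⟨0, by simp⟩, scaledMono_zero⟩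
  | append_singleton l k ih =>
    rw [isReducedWord_append_singleton] at hl
    have hQ := ih hl.1
    rw [wordProd_append, wordProd_singleton, inversions_mul_simpleElt b hl.2,
      Finset.prod_insert (notMem_image_inversions b _ k), Finset.prod_image (by simp),
      List.foldl_append, List.foldl_cons, List.foldl_nil]
    set S := inversions b (wordProd b l) with hS
    set F := l.foldl (fun g i ↦ slashSimple b q 0 i g) (Delta b q)⁻¹ with hF
    set y := scaledVar b q k with hy
    set DS := ∏ i ∈ S, denomFactor b q i with hDS
    set Q := DS * (Delta b q * F) with hQdef
    have hDSeven : IsEvenFun hc DS := IsEvenFun.prod hc fun i _ ↦ isEvenFun_denomFactor hc i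
    have hy0 : y ≠ 0 := scaledVar_ne_zero hc k
    have h1 : slashSimple b q 0 k Q =
        reflHom hc k DS * (reflHom hc k (Delta b q) * slashSimple b q 0 k F) := by
      rw [hQdef, slashSimple_mul hc hP hDSeven, slashSimple_mul hc hP (isEvenFun_Delta hc)]
    have hDSk : ∏ i ∈ S, denomFactor b q (simpleElt P k • i) = reflHom hc k DS := by
      rw [hDS, map_prod]
      simp only [reflHom_denomFactor]
    set t := invSqrt q b.support with ht
    have htt : (const (q : ℂ)⁻¹ : RatField b.support) = t ^ 2 := by
      rw [ht, invSqrt, pow_two, ← const_mul, ← mul_inv, sqrtq_mul_self]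
    have hfk : denomFactor b q (k : ι) = 1 - t ^ 2 * y ^ 2 := by
      rw [denomFactor, rootCoord_coe, scaledMono_nsmul hc, ← scaledVar_eq, htt]
    have h2 : (denomFactor b q (k : ι) * ∏ i ∈ S, denomFactor b q (simpleElt P k • i)) *
        (Delta b q * slashSimple b q 0 k F) =
        -(y ^ 2 * (1 - t ^ 2 * y ^ 2)) * slashSimple b q 0 k Q := by
      rw [h1, hDSk, hfk]
      linear_combination ((1 - t ^ 2 * y ^ 2) * reflHom hc k DS * slashSimple b q 0 k F) *
        reflHom_Delta (b := b) hc k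
    have hty : 1 - t * y ≠ 0 := one_sub_mul_scaledVar_ne_zero hc _ k
    have hty' : 1 - y * t ≠ 0 := by rwa [mul_comm]
    set Q1 := reflHom hc k Q with hQ1
    set Q2 := reflHom hc k (signHom hc k Q) with hQ2
    have h2inv : (const (1 / 2 : ℂ) : RatField b.support) = 1 / 2 := by
      rw [← algebraMap_complex_eq_const, map_div₀, map_one, map_ofNat]
    have h3 : -(y ^ 2 * (1 - t ^ 2 * y ^ 2)) * slashSimple b q 0 k Q =
        const (1 / 2) * (y ^ (0 + 1) * ((t - 1) * Q1 + (t + 1) * Q2) +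
          y ^ (1 + 1) * ((t - 1) * (1 + t) * Q1 + (t + 1) * (t - 1) * Q2) +
          y ^ (2 + 1) * ((t - 1) * t * Q1 - (t + 1) * t * Q2)) := by
      rw [slashSimple_eq hc hP, slashOp, slashCoeff, slashCoeffSign, h2inv, ← hQ1, ← hQ2, ← ht,
        ← hy]
      field_simp
      ring
    have hmem1 := reflHom_mem_positiveSpan hc k hQ
    have hmem2 := reflHom_mem_positiveSpan hc k (signHom_mem_positiveSpan hc k hQ)
    have hk : (k : ι) ∉ S.image fun i ↦ simpleElt P k • i :=
      notMem_image_inversions b (wordProd b l) k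
    set τ := (sqrtq q)⁻¹ with hτ
    have htc : t = const τ := rfl
    have hcs (a a' : ℂ) : (const (a - a') : RatField b.support) = const a - const a' := by
      simp [const]
    have hca (a a' : ℂ) : (const (a + a') : RatField b.support) = const a + const a' := by
      simp [const]
    have hcomb (a a' : ℂ) : const a * Q1 + const a' * Q2 ∈
        positiveSpan b q (S.image fun i ↦ simpleElt P k • i) :=
      add_mem (const_mul_mem_positiveSpan hmem1 a) (const_mul_mem_positiveSpan hmem2 a')
    rw [h2, h3]
    refine const_mul_mem_positiveSpan (add_mem (add_mem ?_ ?_) ?_) _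
    · convert scaledVar_pow_mul_mem_positiveSpan hc hk (hcomb (τ - 1) (τ + 1)) 0 using 2
      simp only [htc, hcs, hca, const_one]
    · convert scaledVar_pow_mul_mem_positiveSpan hc hk
        (hcomb ((τ - 1) * (1 + τ)) ((τ + 1) * (τ - 1))) 1 using 2
      simp only [htc, hcs, hca, const_mul, const_one]
    · convert scaledVar_pow_mul_mem_positiveSpan hc hk
        (hcomb ((τ - 1) * τ) (0 - (τ + 1) * τ)) 2 using 2
      simp only [htc, hcs, hca, const_mul, const_one]
      simp [const]
      ring

/-- Up to the factor `D`, the numerator of the average over `W` is a polynomial with constant term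
one: only the trivial element contributes to the constant term. -/
lemma isPolyWithConst_denom_mul_Delta_mul_average (hq : q ≠ 0) :
    IsPolyWithConst 1 (denom b q * Delta b q * average b q 0) := by
  classical
  have := finite_weylGroup b
  have : Fintype P.weylGroup := Fintype.ofFinite _
  have hpos (S : Finset ι) (hS : ∀ i ∈ S, b.IsPos i) :
      IsPolyWithConst 1 (∏ i ∈ S, denomFactor b q i) :=
    IsPolyWithConst.prod fun i hi ↦ isPolyWithConst_one_sub
      (nsmul_nonneg (rootCoord_nonneg b (hS i hi)) 2) (two_smul_rootCoord_ne_zero i) _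
  have key (w : P.weylGroup) : IsPolyWithConst (if w = 1 then 1 else 0)
      (denom b q * (Delta b q * slash b q 0 w (Delta b q)⁻¹)) := by
    obtain ⟨l, hl, rfl⟩ := exists_isReducedWord b w
    have h1 : slash b q 0 (wordProd b l) (Delta b q)⁻¹ =
        l.foldl (fun g i ↦ slashSimple b q 0 i g) (Delta b q)⁻¹ :=
      foldl_slashSimple_eq hc hP (wordProd_word _) _
    have h2 := prod_denomFactor_mul_mem_positiveSpan hc hP l hl
    rw [← h1] at h2
    set S := inversions b (wordProd b l) with hS
    have hSpos : S ⊆ posRoots b := fun i hi ↦ by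
      rw [hS, mem_inversions] at hi
      exact mem_posRoots.mpr hi.1
    rw [denom_eq_prod hq, ← Finset.prod_sdiff hSpos, mul_assoc]
    have h3 := hpos (posRoots b \ S) fun i hi ↦ mem_posRoots.mp (Finset.mem_sdiff.mp hi).1
    split_ifs with hw
    · have hS0 : S = ∅ := by rw [hS, hw, inversions_one]
      have h4 : slash b q 0 (wordProd b l) (Delta b q)⁻¹ = (Delta b q)⁻¹ :=
        foldl_slashSimple_eq hc hP (l' := []) ((wordProd_word _).trans hw) _
      rw [hS0] at h3
      rw [h4, hS0, mul_inv_cancel₀ (Delta_ne_zero (b := b) hc), Finset.prod_empty, mul_one,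
        mul_one]
      exact h3
    · have hne : S.Nonempty := by
        rw [Finset.nonempty_iff_ne_empty]
        intro h0
        refine hw (eq_one_of_forall_isPos b _ fun k ↦ ?_)
        by_contra hk
        have : (k : ι) ∈ S := by
          rw [hS, mem_inversions]
          exact ⟨Base.isPos_of_mem_support k.2, hk⟩
        simp [h0] at this
      simpa using h3.mul (isPolyWithConst_of_mem_positiveSpan
        (fun i hi ↦ mem_posRoots.mp (hSpos hi)) hne h2)
  rw [average_eq_sum hc hP, Finset.mul_sum]
  simpa [mul_assoc] using IsPolyWithConst.sum (S := Finset.univ) fun w _ ↦ key w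

end Terms

/-! ### Divisibility of Laurent polynomials by `1 - Y ^ lam` -/

section Residue

variable {σ : Type*}

/-- The quotient of the exponent lattice by the multiples of `lam`. -/
abbrev ResidueLattice (lam : σ → ℤ) : Type _ := (σ → ℤ) ⧸ AddSubgroup.zmultiples lam

/-- Reduction of Laurent polynomials modulo `1 - Y ^ lam`, with values in the group ring of the
quotient lattice. -/
def residueHom (lam : σ → ℤ) : LaurentRing σ →ₐ[ℂ] AddMonoidAlgebra ℂ (ResidueLattice lam) :=
  AddMonoidAlgebra.mapDomainAlgHom ℂ ℂ (QuotientAddGroup.mk' (AddSubgroup.zmultiples lam))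

@[simp] lemma residueHom_single (lam mu : σ → ℤ) (a : ℂ) :
    residueHom lam (AddMonoidAlgebra.single mu a) =
      AddMonoidAlgebra.single (mu : ResidueLattice lam) a :=
  AddMonoidAlgebra.mapDomain_single

/-- The Laurent polynomial `1 - a Y ^ mu`. -/
abbrev oneSub (a : ℂ) (mu : σ → ℤ) : LaurentRing σ := 1 - AddMonoidAlgebra.single mu a

lemma residueHom_oneSub_self (lam : σ → ℤ) : residueHom lam (oneSub 1 lam) = 0 := by
  have h : ((lam : σ → ℤ) : ResidueLattice lam) = 0 := by simp
  rw [oneSub, map_sub, map_one, residueHom_single, h, AddMonoidAlgebra.one_def, sub_self]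

lemma oneSub_dvd_oneSub_zsmul (lam : σ → ℤ) (n : ℤ) : oneSub 1 lam ∣ oneSub 1 (n • lam) := by
  have hnat (m : ℕ) : oneSub 1 lam ∣ oneSub 1 (m • lam) := by
    have h := sub_dvd_pow_sub_pow (1 : LaurentRing σ) (AddMonoidAlgebra.single lam 1) m
    rwa [one_pow, AddMonoidAlgebra.single_pow, one_pow] at h
  obtain ⟨m, rfl | rfl⟩ := n.eq_nat_or_neg
  · rw [natCast_zsmul]; exact hnat m
  · have h : oneSub 1 (-(m : ℤ) • lam) =
        oneSub 1 (m • lam) * -AddMonoidAlgebra.single (-(m : ℤ) • lam) 1 := by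
      rw [oneSub, oneSub, mul_neg, sub_mul, one_mul, AddMonoidAlgebra.single_mul_single,
        neg_smul, natCast_zsmul, add_neg_cancel, one_mul, ← AddMonoidAlgebra.one_def]
      ring
    rw [h]
    exact (hnat m).mul_right _

lemma oneSub_dvd_iff (lam : σ → ℤ) (G : LaurentRing σ) :
    oneSub 1 lam ∣ G ↔ residueHom lam G = 0 := by
  constructor
  · rintro ⟨H, rfl⟩
    rw [map_mul, residueHom_oneSub_self, zero_mul]
  · intro h0
    have key (G : LaurentRing σ) : oneSub 1 lam ∣
        G - AddMonoidAlgebra.mapDomain Quotient.out (residueHom lam G) := by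
      induction G using AddMonoidAlgebra.induction_linear with
      | zero => simp
      | add G H hG hH =>
        rw [map_add, AddMonoidAlgebra.mapDomain_add, add_sub_add_comm]
        exact dvd_add hG hH
      | single mu a =>
        rw [residueHom_single, AddMonoidAlgebra.mapDomain_single]
        obtain ⟨n, hn⟩ : ∃ n : ℤ, n • lam = -mu + (mu : ResidueLattice lam).out :=
          AddSubgroup.mem_zmultiples_iff.mp
            (QuotientAddGroup.eq.mp (QuotientAddGroup.out_eq' (mu : ResidueLattice lam)).symm)
        have h : AddMonoidAlgebra.single mu a -
            AddMonoidAlgebra.single ((mu : ResidueLattice lam).out) a =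
            AddMonoidAlgebra.single mu a * oneSub 1 (n • lam) := by
          rw [oneSub, mul_sub, mul_one, AddMonoidAlgebra.single_mul_single, hn, mul_one,
            add_neg_cancel_left]
        rw [h]
        exact (oneSub_dvd_oneSub_zsmul lam n).mul_left _
    have h := key G
    rwa [h0, AddMonoidAlgebra.mapDomain_zero, sub_zero] at h

/-- `E` is regular modulo `1 - Y ^ lam`. -/
def RegularMod (lam : σ → ℤ) (E : LaurentRing σ) : Prop :=
  ∀ G, oneSub 1 lam ∣ E * G → oneSub 1 lam ∣ G

lemma regularMod_one (lam : σ → ℤ) : RegularMod lam 1 := fun G h ↦ by rwa [one_mul] at h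

lemma RegularMod.mul {lam : σ → ℤ} {E F : LaurentRing σ} (hE : RegularMod lam E)
    (hF : RegularMod lam F) : RegularMod lam (E * F) := fun G h ↦
  hF G (hE _ (by rwa [← mul_assoc]))

lemma RegularMod.prod {lam : σ → ℤ} {κ : Type*} {S : Finset κ} {F : κ → LaurentRing σ}
    (h : ∀ i ∈ S, RegularMod lam (F i)) : RegularMod lam (∏ i ∈ S, F i) := by
  classical
  induction S using Finset.induction_on with
  | empty => exact regularMod_one lam
  | insert a S ha ih =>
    rw [Finset.prod_insert ha]
    exact (h a (by simp)).mul (ih fun i hi ↦ h i (by simp [hi]))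

/-- In a group ring, `1 - a [m]` is not a zero divisor if `m` has infinite order. -/
lemma eq_zero_of_one_sub_single_mul {M : Type*} [AddCommGroup M] {m : M}
    (hm : ∀ n : ℕ, n ≠ 0 → n • m ≠ 0) {a : ℂ} (ha : a ≠ 0) {G : AddMonoidAlgebra ℂ M}
    (h : (1 - AddMonoidAlgebra.single m a) * G = 0) : G = 0 := by
  have h1 (z : M) : G.coeff z = a * G.coeff (-m + z) := by
    have h2 := congrArg (fun F ↦ AddMonoidAlgebra.coeff F z) h
    simp only [sub_mul, one_mul, AddMonoidAlgebra.coeff_sub, Finsupp.sub_apply,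
      AddMonoidAlgebra.coeff_single_mul_apply, AddMonoidAlgebra.coeff_zero,
      Finsupp.zero_apply] at h2
    exact sub_eq_zero.mp h2
  by_contra hG
  obtain ⟨z, hz⟩ : ∃ z, G.coeff z ≠ 0 := by
    by_contra! hall
    exact hG (by ext z; simpa using hall z)
  have hne (n : ℕ) : G.coeff (n • m + z) ≠ 0 := by
    induction n with
    | zero => simpa using hz
    | succ n ih =>
      rw [h1, succ_nsmul', add_assoc, neg_add_cancel_left]
      exact mul_ne_zero ha ih
  have hinj : Function.Injective fun n : ℕ ↦ n • m + z := by
    intro n n' hnn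
    wlog hle : n ≤ n' generalizing n n'
    · exact (this hnn.symm (le_of_not_ge hle)).symm
    by_contra hne'
    refine hm (n' - n) (by lia) ?_
    have hnn' : n • m = n' • m := add_right_cancel hnn
    rw [sub_nsmul m hle, hnn', add_neg_cancel]
  exact Set.infinite_range_of_injective hinj
    (G.coeff.support.finite_toSet.subset (by rintro _ ⟨n, rfl⟩; simpa using hne n))

/-- `1 - a Y ^ mu` is regular modulo `1 - Y ^ lam` if `mu` and `lam` are not proportional. -/
lemma regularMod_oneSub {lam mu : σ → ℤ} (h : ∀ (n : ℕ) (m : ℤ), n ≠ 0 → n • mu ≠ m • lam) {a : ℂ}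
    (ha : a ≠ 0) : RegularMod lam (oneSub a mu) := by
  intro G hG
  rw [oneSub_dvd_iff] at hG ⊢
  rw [oneSub, map_mul, map_sub, map_one, residueHom_single] at hG
  refine eq_zero_of_one_sub_single_mul (fun n hn h0 ↦ ?_) ha hG
  rw [← QuotientAddGroup.mk_nsmul, QuotientAddGroup.eq_zero_iff,
    AddSubgroup.mem_zmultiples_iff] at h0
  obtain ⟨m, hm⟩ := h0
  exact h n m hn hm.symm

/-- `1 - a Y ^ lam` is regular modulo `1 - Y ^ lam` if `a ≠ 1`. -/
lemma regularMod_oneSub_self (lam : σ → ℤ) {a : ℂ} (ha : a ≠ 1) :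
    RegularMod lam (oneSub a lam) := by
  intro G hG
  rw [oneSub_dvd_iff] at hG ⊢
  have h : ((lam : σ → ℤ) : ResidueLattice lam) = 0 := by simp
  have h1 : (AddMonoidAlgebra.single 0 a : AddMonoidAlgebra ℂ (ResidueLattice lam)) =
      a • 1 := by
    rw [AddMonoidAlgebra.one_def, AddMonoidAlgebra.smul_single, smul_eq_mul, mul_one]
  rw [oneSub, map_mul, map_sub, map_one, residueHom_single, h, h1, sub_mul, one_mul,
    smul_mul_assoc, one_mul] at hG
  have h2 : (1 - a) • residueHom lam G = 0 := by rw [sub_smul, one_smul, hG]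
  exact (smul_eq_zero.mp h2).resolve_left (sub_ne_zero.mpr ha.symm)

/-- A Laurent polynomial divisible by several `1 - Y ^ lam i`, which are regular modulo each
other, is divisible by their product. -/
lemma prod_oneSub_dvd {κ : Type*} {S : Finset κ} {lam : κ → σ → ℤ}
    (hreg : ∀ i ∈ S, ∀ j ∈ S, i ≠ j → RegularMod (lam i) (oneSub 1 (lam j)))
    {G : LaurentRing σ} (hG : ∀ i ∈ S, oneSub 1 (lam i) ∣ G) : ∏ i ∈ S, oneSub 1 (lam i) ∣ G := by
  classical
  induction S using Finset.induction_on with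
  | empty => simp
  | insert a S ha ih =>
    obtain ⟨H, rfl⟩ := ih (fun i hi j hj ↦ hreg i (by simp [hi]) j (by simp [hj]))
      (fun i hi ↦ hG i (by simp [hi]))
    rw [Finset.prod_insert ha, mul_comm]
    refine mul_dvd_mul_left _ (RegularMod.prod (fun j hj ↦ ?_) H (hG a (by simp)))
    exact hreg a (by simp) j (by simp [hj]) (by rintro rfl; exact ha hj)

variable [Fintype σ] {c : ℂ}

/-- A rational function which is regular along the divisor of `1 - Y ^ lam`: it has a denominator
which is regular modulo `1 - Y ^ lam`. -/
def IsRegularAlong (hc : c ≠ 0) (lam : σ → ℤ) (f : RatField σ) : Prop :=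
  ∃ E G : LaurentRing σ, RegularMod lam E ∧ laurentHom hc E * f = laurentHom hc G

variable (hc : c ≠ 0)
include hc

lemma isRegularAlong_laurentHom (lam : σ → ℤ) (G : LaurentRing σ) :
    IsRegularAlong hc lam (laurentHom hc G) :=
  ⟨1, G, regularMod_one lam, by simp⟩

lemma isRegularAlong_const (lam : σ → ℤ) (a : ℂ) : IsRegularAlong hc lam (const a) := by
  have h := isRegularAlong_laurentHom hc lam (AddMonoidAlgebra.single 0 a)
  rwa [laurentHom_single, scaledMono_zero, mul_one] at h

lemma isRegularAlong_scaledMono (lam mu : σ → ℤ) : IsRegularAlong hc lam (scaledMono c mu) := by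
  have h := isRegularAlong_laurentHom hc lam (AddMonoidAlgebra.single mu 1)
  rwa [laurentHom_single, const_one, one_mul] at h

lemma IsRegularAlong.mul {lam : σ → ℤ} {f g : RatField σ} (hf : IsRegularAlong hc lam f)
    (hg : IsRegularAlong hc lam g) : IsRegularAlong hc lam (f * g) := by
  obtain ⟨E, G, hE, h⟩ := hf
  obtain ⟨E', G', hE', h'⟩ := hg
  exact ⟨E * E', G * G', hE.mul hE', by rw [map_mul, map_mul, ← h, ← h']; ring⟩

lemma IsRegularAlong.add {lam : σ → ℤ} {f g : RatField σ} (hf : IsRegularAlong hc lam f)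
    (hg : IsRegularAlong hc lam g) : IsRegularAlong hc lam (f + g) := by
  obtain ⟨E, G, hE, h⟩ := hf
  obtain ⟨E', G', hE', h'⟩ := hg
  exact ⟨E * E', G * E' + E * G', hE.mul hE', by
    rw [map_add, map_mul, map_mul, map_mul, ← h, ← h']; ring⟩

lemma IsRegularAlong.sub {lam : σ → ℤ} {f g : RatField σ} (hf : IsRegularAlong hc lam f)
    (hg : IsRegularAlong hc lam g) : IsRegularAlong hc lam (f - g) := by
  have h := hf.add hc ((isRegularAlong_const hc lam (-1)).mul hc hg)
  have h1 : (const (-1) : RatField σ) = -1 := by simp [const]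
  rwa [h1, neg_one_mul, ← sub_eq_add_neg] at h

lemma isRegularAlong_inv {lam : σ → ℤ} {E : LaurentRing σ} (hE : RegularMod lam E)
    (h0 : laurentHom hc E ≠ 0) : IsRegularAlong hc lam (laurentHom hc E)⁻¹ :=
  ⟨E, 1, hE, by rw [mul_inv_cancel₀ h0, map_one]⟩

/-- If `F * f` is a Laurent polynomial `G`, where `1 - Y ^ lam` divides `F` and `f` is regular
along its divisor, then `1 - Y ^ lam` divides `G`. -/
lemma IsRegularAlong.oneSub_dvd {lam : σ → ℤ} {f : RatField σ} (hf : IsRegularAlong hc lam f)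
    {F G : LaurentRing σ} (hF : oneSub 1 lam ∣ F)
    (hG : laurentHom hc F * f = laurentHom hc G) : oneSub 1 lam ∣ G := by
  obtain ⟨E, G', hE, h⟩ := hf
  refine hE G ?_
  have h1 : E * G = F * G' := by
    apply laurentHom_injective hc
    rw [map_mul, map_mul, ← h, ← hG]
    ring
  rw [h1]
  exact hF.mul_right _

end Residue

/-! ### The functional equations of the numerator -/

section Numerator

open RootPairing

variable {ι M M' : Type*} [AddCommGroup M] [Module ℝ M] [AddCommGroup M'] [Module ℝ M']
  {P : RootPairing ι ℝ M M'} [P.IsCrystallographic] {b : P.Base} {q : ℕ} (hc : sqrtq q ≠ 0)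
  (hP : b.cartanMatrix.IsSimplyLaced)

include hc hP in
/-- The even and odd parts of a function invariant under `σ k` are separately invariant. -/
lemma even_odd_of_slashSimple_eq [Finite ι] {k : b.support} {f : RatField b.support}
    (hf : slashSimple b q 0 k f = f) :
    scaledVar b q k * (1 - invSqrt q _ * scaledVar b q k) * (f + signHom hc k f) =
      (scaledVar b q k - invSqrt q _) * reflHom hc k (f + signHom hc k f) ∧
    scaledVar b q k * (f - signHom hc k f) = reflHom hc k (f - signHom hc k f) := by
  have hy := scaledVar_ne_zero (b := b) hc k
  have h1 : 1 - invSqrt q _ * scaledVar b q k ≠ 0 := one_sub_mul_scaledVar_ne_zero hc _ k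
  have h1' : 1 - scaledVar b q k * invSqrt q _ ≠ 0 := by rwa [mul_comm]
  have hk : Even (b.cartanMatrix k k) := by simp
  rw [slashSimple_eq hc hP, slashOp] at hf
  have hE := congrArg (signHom hc k) hf
  rw [map_add, map_mul, map_mul, map_slashCoeff _ (signHom_invSqrt hc k),
    map_slashCoeffSign _ (signHom_invSqrt hc k), signHom_scaledVar_of_even hc hk,
    signHom_reflHom_of_even hc hk, signHom_reflHom_of_even hc hk, signHom_signHom] at hE
  rw [map_add, map_sub]
  generalize signHom hc k f = g at hf hE ⊢
  generalize reflHom hc k f = u at hf hE ⊢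
  generalize reflHom hc k g = v at hf hE ⊢
  rw [← hf, ← hE, slashCoeff, slashCoeffSign]
  constructor <;>
  · field_simp
    ring

variable [Fintype ι] [P.IsReduced]

include hc in
lemma reflHom_denom (hq : q ≠ 0) (k : b.support) :
    scaledVar b q k ^ 2 * (1 - invSqrt q _ ^ 2 * scaledVar b q k ^ 2) *
        reflHom hc k (denom b q) =
      denom b q * (scaledVar b q k ^ 2 - invSqrt q _ ^ 2) := by
  have hy := scaledVar_ne_zero (b := b) hc k
  have h := prod_posRoots_smul (b := b) (denomFactor b q) k
  have htt : (const (q : ℂ)⁻¹ : RatField b.support) = invSqrt q _ ^ 2 := by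
    rw [invSqrt, pow_two, ← const_mul, ← mul_inv, sqrtq_mul_self]
  have hk : denomFactor b q (k : ι) = 1 - invSqrt q _ ^ 2 * scaledVar b q k ^ 2 := by
    rw [denomFactor, rootCoord_coe, scaledMono_nsmul hc, scaledVar_eq, htt]
  rw [← reflHom_denomFactor hc, hk, map_sub, map_mul, map_pow, map_pow, map_one,
    reflHom_scaledVar_self, reflHom_invSqrt] at h
  rw [denom_eq_prod hq, map_prod]
  simp only [reflHom_denomFactor]
  rw [mul_assoc, mul_comm _ (∏ i ∈ posRoots b, _), h]
  field_simp

omit [P.IsReduced] in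
include hc in
lemma isEvenFun_denom (hq : q ≠ 0) : IsEvenFun hc (denom b q) := by
  rw [denom_eq_prod hq]
  exact IsEvenFun.prod hc fun i _ ↦ isEvenFun_denomFactor hc i

include hP in
/-- The functional equations of the numerator, as identities between rational functions. -/
lemma numerator_even_odd [Fintype P.weylGroup] (hq : q ≠ 0) (k : b.support) :
    (scaledVar b q k + invSqrt q _) * (numerator b q 0 + signHom hc k (numerator b q 0)) =
      scaledVar b q k * (1 + invSqrt q _ * scaledVar b q k) *
        reflHom hc k (numerator b q 0 + signHom hc k (numerator b q 0)) ∧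
    (scaledVar b q k ^ 2 - invSqrt q _ ^ 2) *
        (numerator b q 0 - signHom hc k (numerator b q 0)) =
      scaledVar b q k * (1 - invSqrt q _ ^ 2 * scaledVar b q k ^ 2) *
        reflHom hc k (numerator b q 0 - signHom hc k (numerator b q 0)) := by
  obtain ⟨h1, h2⟩ := even_odd_of_slashSimple_eq hc hP (slashSimple_average hc hP k)
  have h3 := reflHom_denom (b := b) hc hq k
  have hy := scaledVar_ne_zero (b := b) hc k
  have hy1 : 1 - invSqrt q _ * scaledVar b q k ≠ 0 := one_sub_mul_scaledVar_ne_zero hc _ k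
  rw [numerator, map_mul, isEvenFun_denom hc hq k, ← add_mul, ← sub_mul, map_mul, map_mul]
  constructor
  · apply mul_left_cancel₀ (mul_ne_zero hy hy1)
    linear_combination (scaledVar b q k + invSqrt q _) * denom b q * h1 -
      reflHom hc k (average b q 0 + signHom hc k (average b q 0)) * h3
  · apply mul_left_cancel₀ hy
    linear_combination (scaledVar b q k ^ 2 - invSqrt q _ ^ 2) * denom b q * h2 -
      reflHom hc k (average b q 0 - signHom hc k (average b q 0)) * h3

/-! ### The numerator is a polynomial -/

variable (b q) in
/-- `Δ` as a Laurent polynomial. -/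
def laurentDelta : LaurentRing b.support := ∏ i ∈ posRoots b, oneSub 1 (2 • rootCoord b i)

variable (b q) in
/-- `D` as a Laurent polynomial. -/
def laurentDenom : LaurentRing b.support :=
  ∏ i ∈ posRoots b, oneSub (q : ℂ)⁻¹ (2 • rootCoord b i)

omit [P.IsCrystallographic] [P.IsReduced] in
lemma laurentHom_laurentDelta : laurentHom hc (laurentDelta b) = Delta b q := by
  rw [laurentDelta, Delta_eq_prod, map_prod]
  simp [deltaFactor]

omit [P.IsCrystallographic] [P.IsReduced] in
lemma laurentHom_laurentDenom (hq : q ≠ 0) :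
    laurentHom hc (laurentDenom b q) = denom b q := by
  rw [laurentDenom, denom_eq_prod hq, map_prod]
  simp [denomFactor]

include hP in
lemma exists_laurent_eq_denom_mul_Delta_mul_average (hq : q ≠ 0) :
    ∃ G, laurentHom hc G = denom b q * Delta b q * average b q 0 := by
  obtain ⟨p, hp, -⟩ := isPolyWithConst_denom_mul_Delta_mul_average hc hP hq
  exact ⟨polyHom (sqrtq q) p, by rw [laurentHom_polyHom, hp]⟩

omit [Fintype ι] [P.IsReduced] in
/-- Modulo `1 - Y ^ (2 α k)`, the reflection `σ k` fixes the even part of a Laurent polynomial. -/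
lemma residueHom_laurentRefl_even (k : b.support) (G : LaurentRing b.support) :
    residueHom (2 • simpleRoot b k) (laurentRefl b k (G + laurentSign b k G)) =
      residueHom (2 • simpleRoot b k) (G + laurentSign b k G) := by
  induction G using AddMonoidAlgebra.induction_linear with
  | zero => simp
  | add G H hG hH =>
    rw [map_add (laurentSign b k), add_add_add_comm,
      map_add (laurentRefl b k) (G + laurentSign b k G), map_add (residueHom _),
      map_add (residueHom _) (G + laurentSign b k G), hG, hH]
  | single lam a =>
    rw [laurentSign_single, ← AddMonoidAlgebra.single_add, laurentRefl_single, residueHom_single,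
      residueHom_single]
    rcases Int.even_or_odd (latticePairing b k lam) with h | h
    · congr 1
      rw [QuotientAddGroup.eq, AddSubgroup.mem_zmultiples_iff]
      obtain ⟨n, hn⟩ := h
      exact ⟨n, by rw [simpleRefl_eq, hn]; module⟩
    · rw [h.neg_one_zpow, mul_neg_one, add_neg_cancel, AddMonoidAlgebra.single_zero,
        AddMonoidAlgebra.single_zero]

omit [Fintype ι] [P.IsReduced] in
/-- Modulo `1 - Y ^ (2 α k)`, the reflection `σ k` multiplies the odd part of a Laurent polynomial
by `Y ^ α k`. -/
lemma residueHom_laurentRefl_odd (k : b.support) (G : LaurentRing b.support) :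
    residueHom (2 • simpleRoot b k) (laurentRefl b k (G - laurentSign b k G)) =
      residueHom (2 • simpleRoot b k)
        (AddMonoidAlgebra.single (simpleRoot b k) 1 * (G - laurentSign b k G)) := by
  induction G using AddMonoidAlgebra.induction_linear with
  | zero => simp
  | add G H hG hH =>
    rw [map_add (laurentSign b k), add_sub_add_comm, mul_add,
      map_add (laurentRefl b k) (G - laurentSign b k G), map_add (residueHom _),
      map_add (residueHom _) (_ * (G - laurentSign b k G)), hG, hH]
  | single lam a =>
    rw [laurentSign_single, ← AddMonoidAlgebra.single_sub, laurentRefl_single,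
      AddMonoidAlgebra.single_mul_single, residueHom_single, residueHom_single, one_mul]
    rcases Int.even_or_odd (latticePairing b k lam) with h | h
    · rw [h.neg_one_zpow, mul_one, sub_self, AddMonoidAlgebra.single_zero,
        AddMonoidAlgebra.single_zero]
    · congr 1
      rw [QuotientAddGroup.eq, AddSubgroup.mem_zmultiples_iff]
      obtain ⟨n, hn⟩ := h
      exact ⟨n + 1, by rw [simpleRefl_eq, hn]; module⟩

include hP in
/-- The poles of the average along the divisor of a simple root cancel. -/
lemma oneSub_simpleRoot_dvd [Fintype P.weylGroup] (hq : 1 < q) (k : b.support)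
    {G : LaurentRing b.support}
    (hG : laurentHom hc G = denom b q * Delta b q * average b q 0) :
    oneSub 1 (2 • simpleRoot b k) ∣ G := by
  obtain ⟨h1, h2⟩ := numerator_even_odd hc hP (by lia) k
  have h3 := reflHom_Delta (b := b) hc k
  have hGN : laurentHom hc G = Delta b q * numerator b q 0 := by rw [hG, numerator]; ring
  have hGE : signHom hc k (laurentHom hc G) = Delta b q * signHom hc k (numerator b q 0) := by
    rw [hGN, map_mul, isEvenFun_Delta hc k]
  have hA : laurentHom hc (G + laurentSign b k G) =
      Delta b q * (numerator b q 0 + signHom hc k (numerator b q 0)) := by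
    rw [map_add, ← signHom_laurentHom, hGE, hGN]; ring
  have hB : laurentHom hc (G - laurentSign b k G) =
      Delta b q * (numerator b q 0 - signHom hc k (numerator b q 0)) := by
    rw [map_sub, ← signHom_laurentHom, hGE, hGN]; ring
  set τ := (sqrtq q)⁻¹ with hτ
  have hτ2 : 1 - τ ^ 2 ≠ 0 := by
    rw [hτ, inv_pow, pow_two, sqrtq_mul_self, sub_ne_zero, ne_comm, ne_eq, inv_eq_one]
    exact_mod_cast hq.ne'
  let Y : LaurentRing b.support := AddMonoidAlgebra.single (simpleRoot b k) 1
  let T : LaurentRing b.support := algebraMap ℂ _ τ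
  have hY : laurentHom hc Y = scaledVar b q k := by
    rw [laurentHom_single, const_one, one_mul, scaledVar_eq]
  have hT : laurentHom hc T = invSqrt q _ := by
    rw [AlgHom.commutes, algebraMap_complex_eq_const]; rfl
  have e1 : (Y + T) * (G + laurentSign b k G) =
      -(Y ^ 3 * (1 + T * Y)) * laurentRefl b k (G + laurentSign b k G) := by
    apply laurentHom_injective hc
    simp only [map_mul, map_neg, map_pow, hY]
    rw [map_add (laurentHom hc) Y T, map_add (laurentHom hc) 1 (T * Y), map_one, map_mul, hY, hT,
      ← reflHom_laurentHom, hA, map_mul]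
    linear_combination Delta b q * h1 + scaledVar b q k * (1 + invSqrt q _ * scaledVar b q k) *
      reflHom hc k (numerator b q 0 + signHom hc k (numerator b q 0)) * h3
  have e2 : (Y ^ 2 - T ^ 2) * (G - laurentSign b k G) =
      -(Y ^ 3 * (1 - T ^ 2 * Y ^ 2)) * laurentRefl b k (G - laurentSign b k G) := by
    apply laurentHom_injective hc
    simp only [map_mul, map_neg, map_pow, hY]
    rw [map_sub (laurentHom hc) (Y ^ 2), map_sub (laurentHom hc) 1, map_one, map_mul, map_pow,
      map_pow, hY, hT, ← reflHom_laurentHom, hB, map_mul]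
    linear_combination Delta b q * h2 + scaledVar b q k *
      (1 - invSqrt q _ ^ 2 * scaledVar b q k ^ 2) *
      reflHom hc k (numerator b q 0 - signHom hc k (numerator b q 0)) * h3
  set R := residueHom (2 • simpleRoot b k) with hR
  have hY2 : R Y ^ 2 = 1 := by
    have h := residueHom_oneSub_self (2 • simpleRoot b k)
    rw [oneSub, map_sub, map_one, sub_eq_zero] at h
    rw [← map_pow, AddMonoidAlgebra.single_pow, one_pow]
    exact h.symm
  have hscal {g : AddMonoidAlgebra ℂ (ResidueLattice (2 • simpleRoot b k))}
      (h : 2 * (1 - R T ^ 2) * g = 0) : g = 0 := by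
    have h4 : (2 * (1 - τ ^ 2)) • g = 0 := by
      rw [Algebra.smul_def (2 * (1 - τ ^ 2)) g, map_mul, map_sub, map_pow, map_one, map_ofNat, ← h, AlgHom.commutes]
    exact (smul_eq_zero.mp h4).resolve_left (mul_ne_zero two_ne_zero hτ2)
  have hplus : R (G + laurentSign b k G) = 0 := by
    have h := congrArg R e1
    rw [map_mul R, map_mul R, residueHom_laurentRefl_even, map_add R Y T, map_neg R, map_mul R,
      map_pow R, map_add R 1, map_one, map_mul R] at h
    refine hscal ?_
    linear_combination (R Y - R T) * h - R (G + laurentSign b k G) *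
      (2 + R Y ^ 2 + R T * R Y ^ 3 - R T ^ 2 * R Y ^ 2 - R T ^ 2) * hY2
  have hminus : R (G - laurentSign b k G) = 0 := by
    have h := congrArg R e2
    rw [map_mul R, map_mul R, residueHom_laurentRefl_odd, map_sub R (Y ^ 2), map_neg R,
      map_mul R, map_pow R, map_sub R 1, map_one, map_mul R, map_mul R, map_pow R,
      map_pow R Y 3, map_pow R Y 2] at h
    refine hscal ?_
    linear_combination h - R (G - laurentSign b k G) *
      (2 + R Y ^ 2 - R T ^ 2 * (R Y ^ 4 + R Y ^ 2 + 1)) * hY2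
  rw [oneSub_dvd_iff]
  rw [map_add] at hplus
  rw [map_sub, sub_eq_zero] at hminus
  rw [← hminus] at hplus
  have h5 : (2 : ℂ) • R G = 0 := (two_smul ℂ (R G)).trans hplus
  exact (smul_eq_zero.mp h5).resolve_left two_ne_zero

end Numerator

section LaurentPolynomial

variable {σ : Type*} [Fintype σ] {c : ℂ}

lemma exists_monomial_mul_eq (hc : c ≠ 0) (H : LaurentRing σ) :
    ∃ (m : σ → ℕ) (p : MvPolynomial σ ℂ),
      algebraMap (MvPolynomial σ ℂ) (RatField σ) (∏ j, MvPolynomial.X j ^ m j) *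
        laurentHom hc H = algebraMap (MvPolynomial σ ℂ) (RatField σ) p := by
  obtain ⟨m, hm0, hm⟩ := exists_shift_nonneg H
  obtain ⟨p, hp⟩ : ∃ p : MvPolynomial σ ℂ,
      scaledMono c m * laurentHom hc H = algebraMap (MvPolynomial σ ℂ) (RatField σ) p :=
    ⟨_, scaledMono_mul_laurentHom hc H hm⟩
  have ha : c ^ (∑ j, m j) ≠ 0 := zpow_ne_zero _ hc
  have hX : const (c ^ (∑ j, m j)) * algebraMap (MvPolynomial σ ℂ) (RatField σ)
      (∏ j, MvPolynomial.X j ^ (m j).toNat) = scaledMono c m := by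
    rw [scaledMono, mono, map_prod, ← algebraMap_complex_eq_const, map_zpow₀,
      algebraMap_complex_eq_const]
    congr 1
    refine Finset.prod_congr rfl fun j _ ↦ ?_
    rw [map_pow, ← zpow_natCast, Int.toNat_of_nonneg (hm0 j), x]
  refine ⟨fun j ↦ (m j).toNat, MvPolynomial.C (c ^ (∑ j, m j))⁻¹ * p, ?_⟩
  have h1 : (const (c ^ (∑ j, m j))⁻¹ : RatField σ) * const (c ^ (∑ j, m j)) = 1 := by
    rw [← const_mul, inv_mul_cancel₀ ha, const_one]
  rw [map_mul, ← hp, ← hX, ← mul_assoc, ← mul_assoc]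
  change _ = const _ * const _ * _ * _
  rw [h1, one_mul]

/-- If a Laurent polynomial becomes a polynomial after multiplication by a polynomial with constant
term one, then it is a polynomial, since no variable divides the multiplier. -/
lemma isPolyWithConst_of_mul (hc : c ≠ 0) {H : LaurentRing σ} {f g : RatField σ}
    (hf : laurentHom hc H = f) (hg : IsPolyWithConst 1 g) (hgf : IsPolyWithConst 1 (g * f)) :
    IsPolyWithConst 1 f := by
  obtain ⟨m, p', hp'⟩ := exists_monomial_mul_eq hc H
  obtain ⟨d, rfl, hd⟩ := hg
  obtain ⟨p, hp, hp1⟩ := hgf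
  have hinj := IsFractionRing.injective (MvPolynomial σ ℂ) (RatField σ)
  rw [hf] at hp'
  have hX : (∏ j, MvPolynomial.X j ^ m j : MvPolynomial σ ℂ) ≠ 0 :=
    Finset.prod_ne_zero_iff.mpr fun j _ ↦ pow_ne_zero _ (MvPolynomial.X_ne_zero j)
  have hrel : IsRelPrime (∏ j, MvPolynomial.X j ^ m j) d := by
    refine IsRelPrime.prod_left fun j _ ↦ IsRelPrime.pow_left ?_
    have hj : Prime (MvPolynomial.X j : MvPolynomial σ ℂ) := MvPolynomial.X_prime
    refine hj.irreducible.isRelPrime_iff_not_dvd.mpr fun hdvd ↦ ?_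
    obtain ⟨e, he⟩ := hdvd
    rw [he, map_mul, MvPolynomial.constantCoeff_X, zero_mul] at hd
    exact zero_ne_one hd
  generalize (∏ j, MvPolynomial.X j ^ m j : MvPolynomial σ ℂ) = X at hp' hX hrel
  have hmul : d * p' = X * p := by
    apply hinj
    rw [map_mul, map_mul, ← hp', hp]
    ring
  have hdvd : X ∣ d * p' := ⟨p, hmul⟩
  obtain ⟨n, hn'⟩ := hrel.dvd_of_dvd_mul_left hdvd
  have hX0 : algebraMap (MvPolynomial σ ℂ) (RatField σ) X ≠ 0 := by
    rwa [Ne, IsFractionRing.to_map_eq_zero_iff]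
  have hn : algebraMap (MvPolynomial σ ℂ) (RatField σ) n = f := by
    apply mul_left_cancel₀ hX0
    rw [hp', hn', map_mul]
  refine ⟨n, hn, ?_⟩
  have h2 : d * n = p := by
    apply hinj
    rw [map_mul, hn, hp]
  rw [← hp1, ← h2, map_mul, hd, one_mul]

end LaurentPolynomial

section NumeratorPolynomial

open RootPairing

variable {ι M M' : Type*} [AddCommGroup M] [Module ℝ M] [AddCommGroup M'] [Module ℝ M']
  {P : RootPairing ι ℝ M M'} [P.IsCrystallographic] {b : P.Base} {q : ℕ}

lemma laurentRefl_laurentRefl (k : b.support) (G : LaurentRing b.support) :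
    laurentRefl b k (laurentRefl b k G) = G := by
  ext lam
  rw [coeff_laurentRefl, coeff_laurentRefl, simpleRefl_simpleRefl]

lemma laurentRefl_oneSub (k : b.support) (a : ℂ) (lam : Lattice b) :
    laurentRefl b k (oneSub a lam) = oneSub a (simpleRefl b k lam) := by
  rw [oneSub, map_sub, map_one, laurentRefl_single]

lemma laurentSign_oneSub_two_smul (k : b.support) (a : ℂ) (lam : Lattice b) :
    laurentSign b k (oneSub a (2 • lam)) = oneSub a (2 • lam) := by
  rw [oneSub, map_sub, map_one, laurentSign_single, map_nsmul, Even.neg_one_zpow (by simp), mul_one]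

lemma RegularMod.laurentRefl {lam : Lattice b} {E : LaurentRing b.support} (hE : RegularMod lam E)
    (k : b.support) : RegularMod (simpleRefl b k lam) (laurentRefl b k E) := by
  intro G h
  have h1 := map_dvd (WeylMDS.laurentRefl b k) h
  rw [map_mul, laurentRefl_laurentRefl, laurentRefl_oneSub, simpleRefl_simpleRefl] at h1
  have h2 := map_dvd (WeylMDS.laurentRefl b k) (hE _ h1)
  rwa [laurentRefl_laurentRefl, laurentRefl_oneSub] at h2

lemma RegularMod.laurentSign {lam : Lattice b} {E : LaurentRing b.support}
    (hE : RegularMod (2 • lam) E) (k : b.support) :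
    RegularMod (2 • lam) (laurentSign b k E) := by
  intro G h
  have h1 := map_dvd (WeylMDS.laurentSign b k) h
  rw [map_mul, laurentSign_laurentSign, laurentSign_oneSub_two_smul] at h1
  have h2 := map_dvd (WeylMDS.laurentSign b k) (hE _ h1)
  rwa [laurentSign_laurentSign, laurentSign_oneSub_two_smul] at h2

lemma IsRegularAlong.reflHom {c : ℂ} {hc : c ≠ 0} {lam : Lattice b} {f : RatField b.support}
    (hf : IsRegularAlong hc lam f) (k : b.support) :
    IsRegularAlong hc (simpleRefl b k lam) (reflHom hc k f) := by
  obtain ⟨E, G, hE, h⟩ := hf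
  exact ⟨laurentRefl b k E, laurentRefl b k G, hE.laurentRefl k, by
    rw [← reflHom_laurentHom, ← map_mul, h, reflHom_laurentHom]⟩

lemma IsRegularAlong.signHom {c : ℂ} {hc : c ≠ 0} {lam : Lattice b} {f : RatField b.support}
    (hf : IsRegularAlong hc (2 • lam) f) (k : b.support) :
    IsRegularAlong hc (2 • lam) (signHom hc k f) := by
  obtain ⟨E, G, hE, h⟩ := hf
  exact ⟨laurentSign b k E, laurentSign b k G, hE.laurentSign k, by
    rw [← signHom_laurentHom, ← map_mul, h, signHom_laurentHom]⟩

omit [P.IsCrystallographic] in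
/-- The factors of `Δ` and of `D` are regular modulo the other factors of `Δ`. -/
lemma regularMod_oneSub_rootCoord [Finite ι] [P.IsReduced] {i j : ι} (hi : b.IsPos i)
    (hj : b.IsPos j) (hij : i ≠ j) {a : ℂ} (ha : a ≠ 0) :
    RegularMod (2 • rootCoord b i) (oneSub a (2 • rootCoord b j)) := by
  refine regularMod_oneSub (fun n m hn h ↦ hij ?_) ha
  refine (eq_of_smul_rootCoord_eq b hj hi (m := m * 2) (n := n * 2) (by lia) ?_).symm
  rw [mul_smul, mul_smul, natCast_zsmul, ofNat_zsmul, ofNat_zsmul]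
  exact h

variable (hc : sqrtq q ≠ 0) (hP : b.cartanMatrix.IsSimplyLaced)

include hc hP

/-- The twisted action of `σ k` does not create poles along the divisors of the positive roots. -/
lemma IsRegularAlong.slashSimple [Finite ι] [P.IsReduced] (hq : 1 < q) {i : ι} {k : b.support}
    (hi : b.IsPos (simpleElt P k • i)) {f : RatField b.support}
    (hf : IsRegularAlong hc (2 • rootCoord b i) f) :
    IsRegularAlong hc (2 • rootCoord b (simpleElt P k • i)) (slashSimple b q 0 k f) := by
  have hy := scaledVar_ne_zero (b := b) hc k
  have h1 : 1 - invSqrt q _ * scaledVar b q k ≠ 0 := one_sub_mul_scaledVar_ne_zero hc _ k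
  have hqne : (q : ℂ) ≠ 0 := by exact_mod_cast (by lia : q ≠ 0)
  set lam := 2 • rootCoord b (simpleElt P k • i) with hlam
  have hE : RegularMod lam (oneSub (q : ℂ)⁻¹ (2 • rootCoord b (k : ι))) := by
    rcases eq_or_ne (simpleElt P k • i) k with h | h
    · rw [hlam, h]
      exact regularMod_oneSub_self _ (by rw [ne_eq, inv_eq_one]; exact_mod_cast hq.ne')
    · exact regularMod_oneSub_rootCoord hi (Base.isPos_of_mem_support k.2) h
        (inv_ne_zero hqne)
  have hEeq : laurentHom hc (oneSub (q : ℂ)⁻¹ (2 • rootCoord b (k : ι))) =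
      1 - invSqrt q _ ^ 2 * scaledVar b q k ^ 2 := by
    rw [oneSub, map_sub, map_one, laurentHom_single, rootCoord_coe, scaledMono_nsmul hc,
      ← scaledVar_eq, invSqrt, pow_two (const _), ← const_mul, ← mul_inv, sqrtq_mul_self]
  have hE0 : laurentHom hc (oneSub (q : ℂ)⁻¹ (2 • rootCoord b (k : ι))) ≠ 0 := by
    simpa [denomFactor] using denomFactor_ne_zero (b := b) hc (k : ι)
  have hinv := isRegularAlong_inv hc hE hE0
  rw [hEeq] at hinv hE0
  have ht : IsRegularAlong hc lam (invSqrt q _) := isRegularAlong_const hc _ _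
  have hyr : IsRegularAlong hc lam (scaledVar b q k) := by
    rw [scaledVar_eq]; exact isRegularAlong_scaledMono hc _ _
  have hyi : IsRegularAlong hc lam (scaledVar b q k)⁻¹ := by
    rw [scaledVar_eq, ← scaledMono_neg hc]; exact isRegularAlong_scaledMono hc _ _
  have hone : IsRegularAlong hc lam 1 := by
    rw [← const_one]; exact isRegularAlong_const hc _ _
  have h2 : IsRegularAlong hc lam (const (1 / 2)) := isRegularAlong_const hc _ _
  have h2inv : (const (1 / 2 : ℂ) : RatField b.support) = 1 / 2 := by
    rw [← algebraMap_complex_eq_const, map_div₀, map_one, map_ofNat]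
  have hcom := ((h2.mul hc hyi).mul hc (hone.add hc (ht.mul hc hyr))).mul hc hinv
  have hfac : 1 - invSqrt q _ ^ 2 * scaledVar b q k ^ 2 =
      (1 - invSqrt q _ * scaledVar b q k) * (1 + invSqrt q _ * scaledVar b q k) := by ring
  have h3 : 1 + invSqrt q _ * scaledVar b q k ≠ 0 := fun h ↦ hE0 (by rw [hfac, h, mul_zero])
  have h1' : 1 - scaledVar b q k * invSqrt q _ ≠ 0 := by rwa [mul_comm]
  have hA : IsRegularAlong hc lam (slashCoeff (invSqrt q _) (scaledVar b q k)) := by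
    have := ((hone.sub hc ht).mul hc (hone.add hc hyr)).mul hc hcom
    convert this using 1
    rw [slashCoeff, hfac, h2inv]
    field_simp
  have hB : IsRegularAlong hc lam (slashCoeffSign (invSqrt q _) (scaledVar b q k)) := by
    have := ((hone.add hc ht).mul hc (hyr.sub hc hone)).mul hc hcom
    convert this using 1
    rw [slashCoeffSign, hfac, h2inv]
    field_simp
  rw [slashSimple_eq hc hP, slashOp]
  have hS := hf.reflHom k
  have hSE := (hf.signHom k).reflHom k
  rw [simpleRefl_two_smul_rootCoord] at hS hSE
  exact (hA.mul hc hS).add hc (hB.mul hc hSE)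

variable [Fintype ι] [P.IsReduced] [Fintype P.weylGroup]

/-- The average has no poles along the divisors of the roots. -/
lemma isRegularAlong_average (hq : 1 < q) {i : ι} (hi : b.IsPos i) :
    IsRegularAlong hc (2 • rootCoord b i) (average b q 0) := by
  classical
  have hsimple (k : b.support) : IsRegularAlong hc (2 • rootCoord b (k : ι)) (average b q 0) := by
    obtain ⟨G, hG⟩ := exists_laurent_eq_denom_mul_Delta_mul_average hc hP (by lia : q ≠ 0)
    have hk : (k : ι) ∈ posRoots b := by simpa using Base.isPos_of_mem_support k.2
    obtain ⟨H, hH⟩ := oneSub_simpleRoot_dvd hc hP hq k hG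
    rw [← rootCoord_coe] at hH
    refine ⟨laurentDenom b q * ∏ i ∈ (posRoots b).erase k, oneSub 1 (2 • rootCoord b i), H,
      RegularMod.mul (RegularMod.prod fun j hj ↦ ?_) (RegularMod.prod fun j hj ↦ ?_), ?_⟩
    · have hq0 : (q : ℂ)⁻¹ ≠ 0 := inv_ne_zero (by exact_mod_cast (by lia : q ≠ 0))
      rcases eq_or_ne (k : ι) j with rfl | h
      · exact regularMod_oneSub_self _ (by rw [ne_eq, inv_eq_one]; exact_mod_cast hq.ne')
      · exact regularMod_oneSub_rootCoord (mem_posRoots.mp hk) (mem_posRoots.mp hj) h hq0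
    · rw [Finset.mem_erase] at hj
      exact regularMod_oneSub_rootCoord (mem_posRoots.mp hk) (mem_posRoots.mp hj.2) hj.1.symm
        one_ne_zero
    · have h0 : laurentHom hc (oneSub 1 (2 • rootCoord b (k : ι))) ≠ 0 := by
        simpa [deltaFactor] using deltaFactor_ne_zero (b := b) hc (k : ι)
      apply mul_left_cancel₀ h0
      rw [← map_mul (laurentHom hc) _ H, ← hH, hG, ← laurentHom_laurentDelta hc,
        ← laurentHom_laurentDenom hc (by lia), laurentDelta, ← Finset.mul_prod_erase _ _ hk,
        map_mul, map_mul]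
      ring
  refine (hi.induction_on_reflect (p := fun i ↦ b.IsPos i →
    IsRegularAlong hc (2 • rootCoord b i) (average b q 0)) (fun k hk _ ↦ hsimple ⟨k, hk⟩)
    fun i k ih hk hpos ↦ ?_) hi
  change b.IsPos (simpleElt P k • i) at hpos
  change IsRegularAlong hc (2 • rootCoord b (simpleElt P k • i)) _
  rcases eq_or_ne (simpleElt P k • i) k with h | h
  · rw [h]; exact hsimple ⟨k, hk⟩
  · have hi' : b.IsPos i := by
      have := isPos_simpleElt_smul b ⟨k, hk⟩ hpos h
      rwa [simpleElt_smul_smul] at this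
    rw [← slashSimple_average hc hP ⟨k, hk⟩]
    exact IsRegularAlong.slashSimple hc hP hq (k := ⟨k, hk⟩) hpos (ih hi')

/-- The numerator is a Laurent polynomial. -/
lemma exists_laurent_eq_numerator (hq : 1 < q) : ∃ H, laurentHom hc H = numerator b q 0 := by
  obtain ⟨G, hG⟩ := exists_laurent_eq_denom_mul_Delta_mul_average hc hP (by lia : q ≠ 0)
  have hdvd : laurentDelta b ∣ G := by
    refine prod_oneSub_dvd (fun i hi j hj hij ↦ regularMod_oneSub_rootCoord (mem_posRoots.mp hi)
      (mem_posRoots.mp hj) hij one_ne_zero) fun i hi ↦ ?_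
    refine (isRegularAlong_average hc hP hq (mem_posRoots.mp hi)).oneSub_dvd hc
      (F := laurentDenom b q * laurentDelta b) ?_ ?_
    · exact (Finset.dvd_prod_of_mem (fun i ↦ oneSub 1 (2 • rootCoord b i)) hi).mul_left _
    · rw [hG, map_mul, laurentHom_laurentDelta, laurentHom_laurentDenom hc (by lia)]
  obtain ⟨H, rfl⟩ := hdvd
  refine ⟨H, mul_left_cancel₀ (Delta_ne_zero (b := b) hc) ?_⟩
  rw [map_mul, laurentHom_laurentDelta] at hG
  rw [hG, numerator]
  ring

/-- The numerator is a polynomial with constant term one. -/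
lemma isPolyWithConst_numerator (hq : 1 < q) : IsPolyWithConst 1 (numerator b q 0) := by
  obtain ⟨H, hH⟩ := exists_laurent_eq_numerator hc hP hq
  have hD : IsPolyWithConst 1 (Delta b q) := by
    rw [Delta_eq_prod]
    refine IsPolyWithConst.prod fun i hi ↦ ?_
    have := isPolyWithConst_one_sub (c := sqrtq q) (nsmul_nonneg (rootCoord_nonneg b
      (mem_posRoots.mp hi)) 2) (two_smul_rootCoord_ne_zero i) 1
    rwa [const_one, one_mul] at this
  refine isPolyWithConst_of_mul hc hH hD ?_
  have h : Delta b q * numerator b q 0 = denom b q * Delta b q * average b q 0 := by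
    rw [numerator]; ring
  rw [h]
  exact isPolyWithConst_denom_mul_Delta_mul_average hc hP (by lia : q ≠ 0)

end NumeratorPolynomial

/-! ### The functional equations of the coefficients -/

section Coefficients

variable {σ : Type*} [Fintype σ] {c : ℂ}

lemma polyHom_monomial (hc : c ≠ 0) (m : σ →₀ ℕ) (a : ℂ) :
    polyHom c (MvPolynomial.monomial m a) =
      AddMonoidAlgebra.single (fun j ↦ (m j : ℤ)) (a * c⁻¹ ^ ∑ j, m j) := by
  apply laurentHom_injective hc
  have hnat : natExponent (fun j ↦ (m j : ℤ)) = m := by ext j; simp [natExponent]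
  have hsum : (∑ j, (m j : ℤ)).toNat = ∑ j, m j := by
    rw [← Nat.cast_sum, Int.toNat_natCast]
  rw [laurentHom_polyHom, laurentHom_single,
    scaledMono_eq_algebraMap (fun j ↦ Int.natCast_nonneg (m j)), hnat, hsum, mul_assoc, ← mul_pow,
    inv_mul_cancel₀ hc, one_pow, mul_one]

omit [Fintype σ] in
lemma coeffZ_of_nonneg [Finite σ] (p : MvPolynomial σ ℂ) {k : σ → ℤ} (hk : 0 ≤ k) :
    coeffZ p k = p.coeff (Finsupp.equivFunOnFinite.symm fun j ↦ (k j).toNat) :=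
  if_pos hk

omit [Fintype σ] in
lemma coeffZ_of_not_nonneg [Finite σ] (p : MvPolynomial σ ℂ) {k : σ → ℤ} (hk : ¬0 ≤ k) :
    coeffZ p k = 0 :=
  if_neg hk

omit [Fintype σ] in
lemma coeffZ_natCast [Finite σ] (p : MvPolynomial σ ℂ) (m : σ →₀ ℕ) :
    coeffZ p (fun j ↦ (m j : ℤ)) = p.coeff m := by
  rw [coeffZ_of_nonneg p fun j ↦ Int.natCast_nonneg _]
  congr 1
  ext j
  simp

omit [Fintype σ] in
lemma coeffZ_add [Finite σ] (p p' : MvPolynomial σ ℂ) (k : σ → ℤ) :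
    coeffZ (p + p') k = coeffZ p k + coeffZ p' k := by
  unfold coeffZ
  split_ifs <;> simp

omit [Fintype σ] in
lemma coeffZ_sub [Finite σ] (p p' : MvPolynomial σ ℂ) (k : σ → ℤ) :
    coeffZ (p - p') k = coeffZ p k - coeffZ p' k := by
  unfold coeffZ
  split_ifs <;> simp

omit [Fintype σ] in
lemma coeffZ_zero_right [Finite σ] (p : MvPolynomial σ ℂ) :
    coeffZ p 0 = MvPolynomial.constantCoeff p := by
  have h := coeffZ_natCast p 0
  rwa [← MvPolynomial.constantCoeff_eq] at h

omit [Fintype σ] in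
lemma eq_zero_of_coeffZ_eq_zero [Finite σ] {p : MvPolynomial σ ℂ} (h : coeffZ p = 0) : p = 0 := by
  ext m
  rw [← coeffZ_natCast, h]
  simp

omit [Fintype σ] in
lemma coeffZ_eq_zero_of_degreeOf_lt [Finite σ] (p : MvPolynomial σ ℂ) {k : σ → ℤ} {j : σ}
    (h : (p.degreeOf j : ℤ) < k j) : coeffZ p k = 0 := by
  by_cases hk : 0 ≤ k
  · rw [coeffZ_of_nonneg p hk]
    by_contra h0
    have h1 := MvPolynomial.monomial_le_degreeOf j (MvPolynomial.mem_support_iff.mpr h0)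
    simp only [Finsupp.equivFunOnFinite_symm_apply_apply] at h1
    lia
  · exact coeffZ_of_not_nonneg p hk

lemma coeff_polyHom (hc : c ≠ 0) (p : MvPolynomial σ ℂ) (k : σ → ℤ) :
    coeffZ p k = c ^ (∑ j, k j) * (polyHom c p).coeff k := by
  classical
  induction p using MvPolynomial.induction_on' with
  | monomial u a =>
    rw [polyHom_monomial hc, AddMonoidAlgebra.coeff_single, Finsupp.single_apply]
    split_ifs with h
    · subst h
      rw [coeffZ_natCast, MvPolynomial.coeff_monomial, if_pos rfl, ← Nat.cast_sum, zpow_natCast,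
        mul_left_comm, ← mul_pow, mul_inv_cancel₀ hc, one_pow, mul_one]
    · rw [mul_zero]
      by_cases hk : 0 ≤ k
      · rw [coeffZ_of_nonneg _ hk, MvPolynomial.coeff_monomial, if_neg]
        rintro rfl
        refine h (funext fun j ↦ ?_)
        simpa using hk j
      · exact coeffZ_of_not_nonneg _ hk
  | add p p' hp hp' =>
    rw [coeffZ_add, hp, hp', map_add, AddMonoidAlgebra.coeff_add, Finsupp.add_apply, mul_add]

end Coefficients

section FunctionalEquations

open RootPairing

variable {ι M M' : Type*} [AddCommGroup M] [Module ℝ M] [AddCommGroup M'] [Module ℝ M']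
  {P : RootPairing ι ℝ M M'} [P.IsCrystallographic] {b : P.Base} {q : ℕ}

lemma latticePairing_eq_two_mul_sub_phi (hP : b.cartanMatrix.IsSimplyLaced) (k : b.support)
    (mu : Lattice b) : latticePairing b k mu = 2 * mu k - phi b 0 k mu := by
  classical
  rw [latticePairing_apply, phi, Finset.sum_filter, Pi.zero_apply, Nat.cast_zero, zero_add,
    ← Finset.add_sum_erase _ _ (Finset.mem_univ k),
    ← Finset.add_sum_erase _ (fun j ↦ if Adj b j k then mu j else 0) (Finset.mem_univ k),
    if_neg (by simp [Adj]), cartanMatrix_self, zero_add, mul_comm 2, sub_eq_add_neg,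
    ← Finset.sum_neg_distrib]
  congr 1
  refine Finset.sum_congr rfl fun j hj ↦ ?_
  have hjk : j ≠ k := Finset.ne_of_mem_erase hj
  rcases hP hjk with h | h
  · rw [h, if_neg (by simp [Adj, h]), mul_zero, neg_zero]
  · rw [h, if_pos ⟨hjk, by rw [h]; decide⟩, mul_neg_one]

lemma even_phi_iff (hP : b.cartanMatrix.IsSimplyLaced) (k : b.support) (mu : Lattice b) :
    Even (phi b 0 k mu) ↔ Even (latticePairing b k mu) := by
  rw [latticePairing_eq_two_mul_sub_phi hP, Int.even_sub]
  simp

lemma odd_phi_iff (hP : b.cartanMatrix.IsSimplyLaced) (k : b.support) (mu : Lattice b) :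
    Odd (phi b 0 k mu) ↔ Odd (latticePairing b k mu) := by
  rw [← Int.not_even_iff_odd, even_phi_iff hP, Int.not_even_iff_odd]

lemma latticePairing_simpleRoot_self (k : b.support) :
    latticePairing b k (simpleRoot b k) = 2 := by
  rw [latticePairing_simpleRoot, cartanMatrix_self]

lemma simpleRefl_add_zsmul (k : b.support) (lam : Lattice b) (n : ℤ) :
    simpleRefl b k (lam + n • simpleRoot b k) = simpleRefl b k lam - n • simpleRoot b k := by
  rw [simpleRefl_eq, simpleRefl_eq, map_add, map_zsmul, latticePairing_simpleRoot_self,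
    smul_eq_mul]
  module

section Existence

variable [Fintype ι] [P.IsReduced]

/-- The functional equations of the numerator in terms of its coefficients with respect to the
monomials in the rescaled variables. -/
lemma coeff_even_odd (hc : sqrtq q ≠ 0) (hP : b.cartanMatrix.IsSimplyLaced) (hq : q ≠ 0)
    {G : LaurentRing b.support} (hG : laurentHom hc G = numerator b q 0) (k : b.support)
    (lam : Lattice b) :
    (Even (latticePairing b k lam) →
      G.coeff lam + (sqrtq q)⁻¹ * G.coeff (lam + simpleRoot b k) =
        G.coeff (simpleRefl b k lam) +
          (sqrtq q)⁻¹ * G.coeff (simpleRefl b k lam + simpleRoot b k)) ∧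
    (Odd (latticePairing b k lam) →
      G.coeff lam - (q : ℂ)⁻¹ * G.coeff (lam + 2 • simpleRoot b k) =
        G.coeff (simpleRefl b k lam - simpleRoot b k) -
          (q : ℂ)⁻¹ * G.coeff (simpleRefl b k lam + simpleRoot b k)) := by
  have := finite_weylGroup b
  have : Fintype P.weylGroup := Fintype.ofFinite _
  obtain ⟨h1, h2⟩ := numerator_even_odd hc hP hq k
  set τ := (sqrtq q)⁻¹ with hτ
  have hτ2 : (q : ℂ)⁻¹ = τ * τ := by rw [hτ, ← mul_inv, sqrtq_mul_self]
  set α := simpleRoot b k with hα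
  have hT (a : ℂ) (n : ℕ) : laurentHom hc (AddMonoidAlgebra.single (n • α) a) =
      const a * scaledVar b q k ^ n := by
    rw [laurentHom_single, scaledVar_eq, scaledMono_nsmul hc]
  have ht : invSqrt q b.support = const τ := rfl
  have hA : laurentHom hc (G + laurentSign b k G) =
      numerator b q 0 + signHom hc k (numerator b q 0) := by
    rw [map_add, ← signHom_laurentHom, hG]
  have hB : laurentHom hc (G - laurentSign b k G) =
      numerator b q 0 - signHom hc k (numerator b q 0) := by
    rw [map_sub, ← signHom_laurentHom, hG]
  have e1 : AddMonoidAlgebra.single (1 • α) 1 * (G + laurentSign b k G) +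
      AddMonoidAlgebra.single (0 • α) τ * (G + laurentSign b k G) =
      AddMonoidAlgebra.single (1 • α) 1 * laurentRefl b k (G + laurentSign b k G) +
      AddMonoidAlgebra.single (2 • α) τ * laurentRefl b k (G + laurentSign b k G) := by
    apply laurentHom_injective hc
    rw [map_add, map_mul, map_mul, map_add (laurentHom hc) (_ * laurentRefl b k _),
      map_mul _ _ (laurentRefl b k _), map_mul _ _ (laurentRefl b k _), ← reflHom_laurentHom, hA, hT, hT, hT,
      const_one, ← ht]
    linear_combination h1
  have e2 : AddMonoidAlgebra.single (2 • α) 1 * (G - laurentSign b k G) -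
      AddMonoidAlgebra.single (0 • α) (τ * τ) * (G - laurentSign b k G) =
      AddMonoidAlgebra.single (1 • α) 1 * laurentRefl b k (G - laurentSign b k G) -
      AddMonoidAlgebra.single (3 • α) (τ * τ) * laurentRefl b k (G - laurentSign b k G) := by
    apply laurentHom_injective hc
    rw [map_sub, map_mul, map_mul, map_sub (laurentHom hc) (_ * laurentRefl b k _),
      map_mul _ _ (laurentRefl b k _), map_mul _ _ (laurentRefl b k _), ← reflHom_laurentHom, hB, hT, hT, hT,
      hT, const_one, const_mul, ← ht]
    linear_combination h2
  have hpar (n : ℤ) : (-1 : ℂ) ^ latticePairing b k (lam + n • α) =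
      (-1) ^ latticePairing b k lam := by
    rw [map_add, map_zsmul, latticePairing_simpleRoot_self, zpow_add₀ (by norm_num)]
    simp [zpow_mul']
  have hparS (n : ℤ) : (-1 : ℂ) ^ latticePairing b k (simpleRefl b k lam + n • α) =
      (-1) ^ latticePairing b k lam := by
    rw [← hpar (n - latticePairing b k lam), simpleRefl_eq]
    congr 2
    module
  have hsingle (n : ℕ) (a : ℂ) (F : LaurentRing b.support) (m : ℤ) :
      (AddMonoidAlgebra.single (n • α) a * F).coeff (lam + m • α) =
        a * F.coeff (lam + (m - n) • α) := by
    rw [AddMonoidAlgebra.coeff_single_mul_apply]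
    congr 2
    module
  have hrefl (F : LaurentRing b.support) (m : ℤ) :
      (laurentRefl b k F).coeff (lam + m • α) = F.coeff (simpleRefl b k lam + (-m) • α) := by
    rw [coeff_laurentRefl, simpleRefl_add_zsmul]
    congr 1
    module
  constructor
  · intro hev
    have h := congrArg (fun F ↦ AddMonoidAlgebra.coeff F (lam + (1 : ℤ) • α)) e1
    simp only [AddMonoidAlgebra.coeff_add (_ * _), Finsupp.add_apply, hsingle, hrefl] at h
    simp only [AddMonoidAlgebra.coeff_add, Finsupp.add_apply, coeff_laurentSign, hpar, hparS,
      hev.neg_one_zpow] at h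
    norm_num at h
    linear_combination h / 2
  · intro hodd
    have h := congrArg (fun F ↦ AddMonoidAlgebra.coeff F (lam + (2 : ℤ) • α)) e2
    simp only [AddMonoidAlgebra.coeff_sub (_ * _), Finsupp.sub_apply, hsingle, hrefl] at h
    simp only [AddMonoidAlgebra.coeff_sub, Finsupp.sub_apply, coeff_laurentSign, hpar, hparS,
      hodd.neg_one_zpow] at h
    norm_num at h
    rw [← sub_eq_add_neg (simpleRefl b k lam)] at h
    rw [hτ2]
    linear_combination h / 2

/-- The coefficients of the numerator satisfy the functional equations. -/
lemma coeffFE_of_eq_numerator (hP : b.cartanMatrix.IsSimplyLaced) (hq : q ≠ 0)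
    {N : MvPolynomial b.support ℂ}
    (hN : algebraMap (MvPolynomial b.support ℂ) (RatField b.support) N = numerator b q 0) :
    CoeffFE b q 0 (coeffZ N) := by
  have hc := sqrtq_ne_zero hq
  have hG : laurentHom hc (polyHom (sqrtq q) N) = numerator b q 0 := by
    rw [laurentHom_polyHom, hN]
  have hqs : (q : ℂ) = sqrtq q * sqrtq q := (sqrtq_mul_self q).symm
  intro k lam mu hmu _
  have hmu' : simpleRefl b k lam = mu - simpleRoot b k := by rw [hmu]; simp
  have hparmu : latticePairing b k mu = 2 - latticePairing b k lam := by
    rw [hmu, map_add, latticePairing_simpleRefl, cartanMatrix_self]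
    simp
    ring
  have hht : ht b (lam - mu + simpleRoot b k) = ht b lam - ht b mu + 1 := by
    rw [ht_add, ht_sub, ht_simpleRoot]
  constructor
  · intro hev
    rw [even_phi_iff hP, hparmu, Int.even_sub] at hev
    have h := (coeff_even_odd hc hP hq hG k (lam - simpleRoot b k)).1 (by
      rw [map_sub, latticePairing_simpleRoot_self, Int.even_sub]
      simpa using hev)
    have hs : simpleRefl b k (lam - simpleRoot b k) = mu := by
      have := simpleRefl_add_zsmul k lam (-1)
      rw [neg_one_smul, ← sub_eq_add_neg] at this
      rw [this, hmu']
      module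
    rw [sub_add_cancel, hs] at h
    rw [coeff_polyHom hc, coeff_polyHom hc, coeff_polyHom hc, coeff_polyHom hc]
    change _ * (sqrtq q ^ ht b _ * _) + sqrtq q ^ ht b _ * _ =
      _ * (sqrtq q ^ ht b _ * _ + sqrtq q ^ ht b _ * _ / _)
    rw [hht, ht_sub, ht_add, ht_simpleRoot, hqs]
    rw [zpow_sub₀ hc, zpow_add₀ hc, zpow_sub₀ hc, zpow_add₀ hc, zpow_one]
    have hz := zpow_ne_zero (ht b mu) hc
    have hzl := zpow_ne_zero (ht b lam) hc
    generalize sqrtq q ^ ht b mu = B at hz ⊢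
    generalize sqrtq q ^ ht b lam = A at hzl ⊢
    field_simp at h ⊢
    linear_combination h
  · intro hodd
    rw [odd_phi_iff hP, hparmu] at hodd
    have h := (coeff_even_odd hc hP hq hG k (lam - (2 : ℤ) • simpleRoot b k)).2 (by
      obtain ⟨r, hr⟩ := hodd
      rw [map_sub, map_zsmul, latticePairing_simpleRoot_self, smul_eq_mul]
      exact ⟨-r - 2, by lia⟩)
    have hs : simpleRefl b k (lam - (2 : ℤ) • simpleRoot b k) = mu + simpleRoot b k := by
      have := simpleRefl_add_zsmul k lam (-2)
      rw [neg_smul, ← sub_eq_add_neg] at this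
      rw [this, hmu']
      module
    have hl : lam - (2 : ℤ) • simpleRoot b k + 2 • simpleRoot b k = lam := by module
    have hm : mu + simpleRoot b k + simpleRoot b k = mu + (2 : ℤ) • simpleRoot b k := by module
    rw [hl, hs, add_sub_cancel_right, hm] at h
    rw [coeff_polyHom hc, coeff_polyHom hc, coeff_polyHom hc, coeff_polyHom hc]
    change _ * (sqrtq q ^ ht b _ * _) - sqrtq q ^ ht b _ * _ =
      _ * (sqrtq q ^ ht b _ * _ - sqrtq q ^ ht b _ * _ / _)
    rw [hht, ← ofNat_zsmul, ht_sub, ht_add, ht_smul, ht_simpleRoot]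
    rw [hqs] at h ⊢
    rw [zpow_sub₀ hc, zpow_add₀ hc, zpow_sub₀ hc, zpow_add₀ hc, zpow_one, mul_one]
    have hz := zpow_ne_zero (ht b mu) hc
    have hzl := zpow_ne_zero (ht b lam) hc
    generalize sqrtq q ^ ht b mu = B at hz ⊢
    generalize sqrtq q ^ ht b lam = A at hzl ⊢
    field_simp at h ⊢
    linear_combination h

end Existence

lemma CoeffFE.sub {a a' : Lattice b → ℂ} (ha : CoeffFE b q 0 a) (ha' : CoeffFE b q 0 a') :
    CoeffFE b q 0 (a - a') := by
  intro k lam mu hmu hle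
  obtain ⟨h1, h2⟩ := ha k lam mu hmu hle
  obtain ⟨h1', h2'⟩ := ha' k lam mu hmu hle
  simp only [Pi.sub_apply]
  constructor
  · intro h
    linear_combination h1 h - h1' h
  · intro h
    linear_combination h2 h - h2' h

/-- Uniqueness of the solution of the functional equations. Along the `k`-string through a nonzero
`mu ≥ 0` with `⟨mu, coroot k⟩ > 0`, the functional equations express the coefficients from `mu`
upwards by coefficients at smaller exponents; as the string of nonzero coefficients ends, the
coefficient at `mu` vanishes as soon as all coefficients at smaller exponents do. -/
lemma CoeffFE.eq_zero [Finite ι] [P.IsRootSystem] (hP : b.cartanMatrix.IsSimplyLaced) (hq : q ≠ 0)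
    {a : Lattice b → ℂ} (ha : CoeffFE b q 0 a) (hneg : ∀ lam, ¬0 ≤ lam → a lam = 0)
    (hfin : ∀ k, ∃ B : ℤ, ∀ lam : Lattice b, B < lam k → a lam = 0) (h0 : a 0 = 0) : a = 0 := by
  have hc := sqrtq_ne_zero hq
  have hqC : (q : ℂ) ≠ 0 := by exact_mod_cast hq
  suffices h : ∀ (n : ℕ) (mu : Lattice b), ht b mu < n → a mu = 0 by
    ext mu
    exact h ((ht b mu).toNat + 1) mu (by lia)
  intro n
  induction n with
  | zero =>
    intro mu hmu
    refine hneg mu fun h ↦ ?_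
    have : 0 ≤ ht b mu := Finset.sum_nonneg fun j _ ↦ h j
    lia
  | succ n ih =>
    intro mu hmu
    by_cases hmu0 : 0 ≤ mu
    swap
    · exact hneg mu hmu0
    rcases eq_or_ne mu 0 with rfl | hne
    · exact h0
    obtain ⟨k, hk⟩ := exists_latticePairing_pos b hmu0 hne
    set N := latticePairing b k mu with hN
    set D : ℤ → ℂ := fun i ↦ a (mu + i • simpleRoot b k) with hD
    have hDneg (i : ℤ) (hi : i < 0) : D i = 0 := by
      refine ih _ ?_
      rw [ht_add, ht_smul, ht_simpleRoot]
      push_cast at hmu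
      lia
    obtain ⟨B, hB⟩ := hfin k
    have hDtop (i : ℤ) (hi : B < i) : D i = 0 := by
      refine hB _ ?_
      have := hmu0 k
      simp only [Pi.zero_apply] at this
      simp only [Pi.add_apply, Pi.smul_apply, simpleRoot_self, smul_eq_mul, mul_one]
      lia
    have key (m : ℤ) (hm : 0 ≤ m) :
        (Even N → q * D (-N - m) + D (1 - N - m) =
          sqrtq q ^ (2 - N - 2 * m) * (D m + D (m + 1) / q)) ∧
        (Odd N → q ^ 2 * D (-1 - N - m) - D (1 - N - m) =
          sqrtq q * sqrtq q ^ (2 - N - 2 * m) * (D m - D (m + 2) / q ^ 2)) := by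
      have h := ha k (mu + (1 - N - m) • simpleRoot b k) (mu + m • simpleRoot b k) ?_ ?_
      · have hpar : latticePairing b k (mu + m • simpleRoot b k) = N + m * 2 := by
          rw [map_add, map_zsmul, latticePairing_simpleRoot_self, smul_eq_mul]
        have hevN : Even (N + m * 2) ↔ Even N := by simp [Int.even_add]
        have hoddN : Odd (N + m * 2) ↔ Odd N := by
          rw [← Int.not_even_iff_odd, hevN, Int.not_even_iff_odd]
        have hht : ht b (mu + (1 - N - m) • simpleRoot b k - (mu + m • simpleRoot b k) +
            simpleRoot b k) = 2 - N - 2 * m := by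
          simp only [ht_add, ht_sub, ht_smul, ht_simpleRoot]
          ring
        have h1 : mu + (1 - N - m) • simpleRoot b k - simpleRoot b k =
            mu + (-N - m) • simpleRoot b k := by module
        have h2 : mu + (1 - N - m) • simpleRoot b k - 2 • simpleRoot b k =
            mu + (-1 - N - m) • simpleRoot b k := by module
        have h3 : mu + m • simpleRoot b k + simpleRoot b k =
            mu + (m + 1) • simpleRoot b k := by module
        have h4 : mu + m • simpleRoot b k + 2 • simpleRoot b k =
            mu + (m + 2) • simpleRoot b k := by module
        rwa [even_phi_iff hP, odd_phi_iff hP, hpar, hevN, hoddN, hht, h1, h2, h3, h4] at h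
      · rw [simpleRefl_add_zsmul, simpleRefl_eq, ← hN]
        simp only [Pi.zero_apply, zero_add, one_smul]
        module
      · rw [add_le_add_iff_left]
        exact smul_le_smul_of_nonneg_right (by lia) (simpleRoot_nonneg b k)
    have hdown (hrec : ∀ m : ℤ, 1 ≤ m → D (m + 1) = 0 → D (m + 2) = 0 → D m = 0) (m : ℤ)
        (hm : 1 ≤ m) : D m = 0 := by
      obtain ⟨j, hj⟩ : ∃ j : ℕ, B < m + j := ⟨(B - m + 1).toNat, by lia⟩
      have h2 (j : ℕ) : ∀ m : ℤ, 1 ≤ m → B < m + j → D m = 0 := by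
        induction j with
        | zero => intro m _ hB'; exact hDtop m (by lia)
        | succ j ih =>
          intro m hm hB'
          exact hrec m hm (ih _ (by lia) (by lia)) (ih _ (by lia) (by lia))
      exact h2 j m hm hj
    have hmu' : a mu = D 0 := by simp [hD]
    rw [hmu']
    have hz (e : ℤ) : sqrtq q ^ e ≠ 0 := zpow_ne_zero e hc
    rcases Int.even_or_odd N with hev | hodd
    · have hN2 : 2 ≤ N := by obtain ⟨r, hr⟩ := hev; lia
      have hstep (m : ℤ) (hm : 0 ≤ m) (h1 : D (m + 1) = 0) : D m = 0 := by
        have h := (key m hm).1 hev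
        rw [hDneg (-N - m) (by lia), hDneg (1 - N - m) (by lia), h1, mul_zero, zero_div, add_zero,
          add_zero, eq_comm] at h
        exact (mul_eq_zero.mp h).resolve_left (hz _)
      exact hstep 0 le_rfl (hdown (fun m hm h1 _ ↦ hstep m (by lia) h1) _ (by lia))
    · have h2 : D 2 = 0 := by
        refine hdown (fun m hm _ h2 ↦ ?_) 2 (by lia)
        have h := (key m (by lia)).2 hodd
        rw [hDneg (-1 - N - m) (by lia), hDneg (1 - N - m) (by lia), h2, mul_zero, zero_div,
          sub_zero, sub_zero, eq_comm] at h
        exact (mul_eq_zero.mp h).resolve_left (mul_ne_zero hc (hz _))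
      have h := (key 0 le_rfl).2 hodd
      rw [zero_add, h2, hDneg (-1 - N - 0) (by lia), zero_div, mul_zero, zero_sub] at h
      rcases eq_or_ne N 1 with hN1 | hN1
      · rw [hN1] at h
        norm_num at h
        have h3 : (1 + (q : ℂ)) * D 0 = 0 := by
          rw [← sqrtq_mul_self]
          linear_combination -h
        have h4 : (1 + (q : ℂ)) ≠ 0 := by exact_mod_cast (by lia : 1 + q ≠ 0)
        exact (mul_eq_zero.mp h3).resolve_left h4
      · rw [sub_zero, hDneg (1 - N) (by lia), neg_zero, sub_zero, eq_comm] at h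
        exact (mul_eq_zero.mp h).resolve_left (mul_ne_zero hc (hz _))

end FunctionalEquations

/-! ### The sum of the positive roots -/

section SumPositive

open RootPairing

variable {ι M M' : Type*} [Fintype ι] [AddCommGroup M] [Module ℝ M] [AddCommGroup M'] [Module ℝ M']
  {P : RootPairing ι ℝ M M'} [P.IsCrystallographic] [P.IsReduced] (b : P.Base)

lemma sum_posRoots_pairingIn_simple (k : b.support) :
    ∑ i ∈ posRoots b, P.pairingIn ℤ i k = 2 := by
  have h := prod_posRoots_smul (b := b) (fun i ↦ Multiplicative.ofAdd (rootCoord b i)) k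
  have h1 : ∑ i ∈ posRoots b, rootCoord b (simpleElt P k • i) + rootCoord b (k : ι) =
      ∑ i ∈ posRoots b, rootCoord b i + rootCoord b (simpleElt P k • (k : ι)) := by
    have h' := congrArg Multiplicative.toAdd h
    simpa only [toAdd_mul, toAdd_prod, toAdd_ofAdd] using h'
  have h2 := congrArg (latticePairing b k) h1
  simp only [← simpleRefl_rootCoord, map_add, map_sum, latticePairing_simpleRefl, rootCoord_coe,
    latticePairing_rootCoord, latticePairing_simpleRoot, cartanMatrix_self] at h2
  rw [Finset.sum_sub_distrib, ← Finset.sum_mul] at h2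
  lia

lemma sum_posRoots_pairingIn_ne_zero (j : ι) : ∑ i ∈ posRoots b, P.pairingIn ℤ i j ≠ 0 := by
  let φ : M' →ₗ[ℝ] ℝ := ∑ i ∈ posRoots b, P.toLinearMap (P.root i)
  have hφ (j : ι) : φ (P.coroot j) = ((∑ i ∈ posRoots b, P.pairingIn ℤ i j : ℤ) : ℝ) := by
    rw [LinearMap.sum_apply, Int.cast_sum]
    exact Finset.sum_congr rfl fun i _ ↦ (P.algebraMap_pairingIn ℤ i j).symm
  have hpos {n : M'} (hn : n ∈ AddSubmonoid.closure (P.coroot '' b.support)) :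
      n = 0 ∨ 0 < φ n := by
    induction hn using AddSubmonoid.closure_induction with
    | mem n hn =>
      obtain ⟨k, hk, rfl⟩ := hn
      right
      rw [hφ, sum_posRoots_pairingIn_simple b ⟨k, hk⟩]
      norm_num
    | zero => exact Or.inl rfl
    | add n n' _ _ h h' =>
      rcases h with rfl | h
      · simpa using h'
      · rcases h' with rfl | h'
        · exact Or.inr (by simpa using h)
        · exact Or.inr (by rw [map_add]; exact add_pos h h')
  intro h0
  have hφ0 : φ (P.coroot j) = 0 := by rw [hφ, h0, Int.cast_zero]
  have hne : P.coroot j ≠ 0 := P.ne_zero' j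
  rcases b.coroot_mem_or_neg_mem j with h | h
  · rcases hpos h with h | h
    · exact hne h
    · exact h.ne' hφ0
  · rcases hpos h with h | h
    · exact hne (neg_eq_zero.mp h)
    · rw [map_neg, hφ0, neg_zero] at h
      exact h.false

end SumPositive

/-! ### Weights of a highest weight module -/

section HighestWeight

open LieAlgebra LieAlgebra.IsKilling LieModule

variable {ι : Type*} {L : Type*} [LieRing L] [LieAlgebra ℂ L]
  [FiniteDimensional ℂ L] [LieAlgebra.IsKilling ℂ L]
  {H : LieSubalgebra ℂ L} [H.IsCartanSubalgebra]
  {V : Type*} [AddCommGroup V] [Module ℂ V] [LieRingModule L V] [LieModule ℂ L V]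

/-- A Lie algebra is spanned by a Cartan subalgebra together with the root spaces. -/
lemma submodule_eq_top_of_rootSpaces (e : ι ≃ H.root) {S : Submodule ℂ L}
    (hH : ∀ h : H, (h : L) ∈ S)
    (hroot : ∀ i, ∀ x ∈ rootSpace H ((rootSystem H).root (e i)), x ∈ S) : S = ⊤ := by
  have h : (⨆ χ : Weight ℂ H L, (rootSpace H χ).toSubmodule) = ⊤ := by
    rw [← LieSubmodule.iSup_toSubmodule, iSup_genWeightSpace_eq_top', LieSubmodule.top_toSubmodule]
  rw [eq_top_iff, ← h]
  refine iSup_le fun χ x hx ↦ ?_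
  by_cases hχ : χ.IsZero
  · have hx' : x ∈ rootSpace H (0 : H → ℂ) := by
      rw [← hχ.eq]; exact hx
    rw [LieAlgebra.rootSpace_zero_eq] at hx'
    exact hH ⟨x, hx'⟩
  · have hmem : χ ∈ H.root := by simpa using hχ
    obtain ⟨i, hi⟩ := e.surjective ⟨χ, hmem⟩
    refine hroot i x ?_
    rw [hi]
    exact hx

/-- The smallest subspace containing `v` and stable under the root spaces of the roots `e i` with
`neg i`. -/
def loweringSpan (e : ι ≃ H.root) (neg : ι → Prop) (v : V) : Submodule ℂ V :=
  sInf {S | v ∈ S ∧ ∀ i, neg i → ∀ y ∈ rootSpace H ((rootSystem H).root (e i)),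
    ∀ w ∈ S, ⁅y, w⁆ ∈ S}

omit [LieModule ℂ L V] in
lemma self_mem_loweringSpan (e : ι ≃ H.root) (neg : ι → Prop) (v : V) :
    v ∈ loweringSpan e neg v := Submodule.mem_sInf.mpr fun _ hS ↦ hS.1

omit [LieModule ℂ L V] in
lemma lie_mem_loweringSpan (e : ι ≃ H.root) (neg : ι → Prop) (v : V) {i : ι} (hi : neg i) {y : L}
    (hy : y ∈ rootSpace H ((rootSystem H).root (e i))) {w : V} (hw : w ∈ loweringSpan e neg v) :
    ⁅y, w⁆ ∈ loweringSpan e neg v := Submodule.mem_sInf.mpr fun S hS ↦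
  hS.2 i hi y hy w (Submodule.mem_sInf.mp hw S hS)

omit [LieModule ℂ L V] in
lemma loweringSpan_le (e : ι ≃ H.root) (neg : ι → Prop) (v : V) {S : Submodule ℂ V} (hv : v ∈ S)
    (hS : ∀ i, neg i → ∀ y ∈ rootSpace H ((rootSystem H).root (e i)), ∀ w ∈ S, ⁅y, w⁆ ∈ S) :
    loweringSpan e neg v ≤ S := sInf_le ⟨hv, hS⟩

/-- The lowering operators generate an irreducible module from a highest weight vector. -/
lemma loweringSpan_eq_top [LieModule.IsIrreducible ℂ L V] (e : ι ≃ H.root) (pos : ι → Prop)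
    {v : V} (hv : v ≠ 0) {χ : Module.Dual ℂ H} (hχ : ∀ h : H, ⁅(h : L), v⁆ = χ h • v)
    (hpos : ∀ i, pos i → ∀ x ∈ rootSpace H ((rootSystem H).root (e i)), ⁅x, v⁆ = 0) :
    loweringSpan e (fun i ↦ ¬pos i) v = ⊤ := by
  set U := loweringSpan e (fun i ↦ ¬pos i) v with hU
  -- The vectors of `U` that every element of `L` maps into `U` form a subspace containing `v` and
  -- stable under lowering, since `⁅x, ⁅y, w⁆⁆ = ⁅⁅x, y⁆, w⁆ + ⁅y, ⁅x, w⁆⁆`.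
  let T : Submodule ℂ V :=
    { carrier := {w | ∀ x : L, ⁅x, w⁆ ∈ U}
      add_mem' := fun {w w'} hw hw' x ↦ by rw [lie_add]; exact add_mem (hw x) (hw' x)
      zero_mem' := fun x ↦ by rw [lie_zero]; exact zero_mem U
      smul_mem' := fun a w hw x ↦ by rw [lie_smul]; exact Submodule.smul_mem _ _ (hw x) }
  have hUT : U ≤ U ⊓ T := by
    refine loweringSpan_le e _ v ⟨self_mem_loweringSpan e _ v, ?_⟩ ?_
    · let S : Submodule ℂ L :=
        { carrier := {x | ⁅x, v⁆ ∈ U}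
          add_mem' := fun {x x'} hx hx' ↦ by
            change ⁅x + x', v⁆ ∈ U
            rw [add_lie]; exact add_mem hx hx'
          zero_mem' := by
            change ⁅(0 : L), v⁆ ∈ U
            rw [zero_lie]; exact zero_mem U
          smul_mem' := fun a x hx ↦ by
            change ⁅a • x, v⁆ ∈ U
            rw [smul_lie]; exact Submodule.smul_mem _ _ hx }
      have hS : S = ⊤ := by
        refine submodule_eq_top_of_rootSpaces e (fun h ↦ ?_) fun i x hx ↦ ?_
        · change ⁅(h : L), v⁆ ∈ U
          rw [hχ]
          exact Submodule.smul_mem _ _ (self_mem_loweringSpan e _ v)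
        · change ⁅x, v⁆ ∈ U
          by_cases hi : pos i
          · rw [hpos i hi x hx]; exact zero_mem U
          · exact lie_mem_loweringSpan e _ v hi hx (self_mem_loweringSpan e _ v)
      intro x
      have hx : x ∈ S := by rw [hS]; trivial
      exact hx
    · rintro i hi y hy w ⟨hwU, hwT⟩
      refine ⟨lie_mem_loweringSpan e _ v hi hy hwU, fun x ↦ ?_⟩
      rw [leibniz_lie]
      exact add_mem (hwT _) (lie_mem_loweringSpan e _ v hi hy (hwT x))
  let N : LieSubmodule ℂ L V := { U with lie_mem := fun {x w} hw ↦ (hUT hw).2 x }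
  have hvN : v ∈ N := self_mem_loweringSpan e _ v
  have hN : N = ⊤ := (IsSimpleOrder.eq_bot_or_eq_top N).resolve_left fun h ↦ hv (by
    rw [h] at hvN
    simpa using hvN)
  exact congrArg LieSubmodule.toSubmodule hN

/-- Every weight of an irreducible module with a highest weight vector lies in any set of weights
which contains the highest weight and is stable under subtracting positive roots. -/
lemma mem_of_isWeight [LieModule.IsIrreducible ℂ L V] (e : ι ≃ H.root) (pos : ι → Prop)
    {χ₀ : Module.Dual ℂ H} (hhw : IsHighestWeight H V e pos χ₀) {X : Set (Module.Dual ℂ H)}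
    (h0 : χ₀ ∈ X) (hX : ∀ χ ∈ X, ∀ i, ¬pos i → (rootSystem H).root (e i) + χ ∈ X)
    {χ : Module.Dual ℂ H} (hχ : IsWeight H V χ) : χ ∈ X := by
  obtain ⟨v, hv, hvχ, hpos⟩ := hhw
  obtain ⟨w, hw, hwχ⟩ := hχ
  by_contra hχX
  let W (ψ : Module.Dual ℂ H) : Submodule ℂ V := (genWeightSpace V (ψ : H → ℂ)).toSubmodule
  have hle : (⊤ : Submodule ℂ V) ≤ ⨆ ψ ∈ X, W ψ := by
    rw [← loweringSpan_eq_top e pos hv hvχ hpos]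
    have hweight {ψ : Module.Dual ℂ H} {u : V} (hu : ∀ h : H, ⁅(h : L), u⁆ = ψ h • u) :
        u ∈ W ψ :=
      weightSpace_le_genWeightSpace V (ψ : H → ℂ) ((mem_weightSpace _ u).mpr hu)
    refine loweringSpan_le e _ v ?_ fun i hi y hy u hu ↦ ?_
    · exact Submodule.mem_iSup_of_mem χ₀ (Submodule.mem_iSup_of_mem h0 (hweight hvχ))
    · have hmap : (⨆ ψ ∈ X, W ψ) ≤
          (⨆ ψ ∈ X, W ψ).comap (LieModule.toEnd ℂ L V y : V →ₗ[ℂ] V) := by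
        refine iSup₂_le fun ψ hψ u hu ↦ ?_
        refine Submodule.mem_iSup_of_mem _ (Submodule.mem_iSup_of_mem (hX ψ hψ i hi) ?_)
        exact lie_mem_genWeightSpace_of_mem_genWeightSpace hy hu
      exact hmap hu
  have hind := (LieSubmodule.iSupIndep_toSubmodule.mpr (iSupIndep_genWeightSpace ℂ H V)) (χ : H → ℂ)
  have hwW : w ∈ (genWeightSpace V (χ : H → ℂ)).toSubmodule :=
    weightSpace_le_genWeightSpace V (χ : H → ℂ) ((mem_weightSpace _ w).mpr hwχ)
  refine hw (Submodule.disjoint_def.mp hind w hwW ?_)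
  have hle' : (⨆ ψ ∈ X, W ψ) ≤ ⨆ (ψ : H → ℂ) (_ : ψ ≠ χ), (genWeightSpace V ψ).toSubmodule := by
    refine iSup₂_le fun ψ hψ ↦ le_iSup₂_of_le (ψ : H → ℂ) (fun h ↦ ?_) le_rfl
    exact hχX (by rwa [← DFunLike.coe_injective h])
  exact hle' (hle trivial)

end HighestWeight

section DominantRegular

open LieAlgebra LieAlgebra.IsKilling LieModule RootPairing

variable {ι M M' : Type*} [Fintype ι] [AddCommGroup M] [Module ℝ M] [AddCommGroup M'] [Module ℝ M']
  {P : RootPairing ι ℝ M M'} [P.IsCrystallographic] {b : P.Base}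
  {L : Type*} [LieRing L] [LieAlgebra ℂ L]
  [FiniteDimensional ℂ L] [LieAlgebra.IsKilling ℂ L]
  {H : LieSubalgebra ℂ L} [H.IsCartanSubalgebra] (e : ι ≃ H.root)

variable (b) in
/-- The element of the root lattice of `H` corresponding to an element of the root lattice of `P`
under a bijection of the roots. -/
def latticeToDual : Lattice b →+ Module.Dual ℂ H where
  toFun lam := ∑ j, lam j • (rootSystem H).root (e j)
  map_zero' := by simp
  map_add' lam mu := by simp [add_smul, Finset.sum_add_distrib]

variable {e} (he : ∀ i j, (rootSystem H).pairingIn ℤ (e i) (e j) = P.pairingIn ℤ i j)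
include he

omit [Fintype ι] in
lemma root_apply_coroot_eq (i j : ι) :
    (rootSystem H).root (e i) ((rootSystem H).coroot (e j)) = (P.pairingIn ℤ i j : ℂ) := by
  rw [← he i j]
  exact ((rootSystem H).algebraMap_pairingIn ℤ (e i) (e j)).symm

omit [Fintype ι] in
lemma latticeToDual_apply_coroot (lam : Lattice b) (k : b.support) :
    latticeToDual b e lam ((rootSystem H).coroot (e k)) = (latticePairing b k lam : ℂ) := by
  change (∑ j, lam j • (rootSystem H).root (e j)) _ = _
  rw [LinearMap.sum_apply, latticePairing_apply, Int.cast_sum]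
  refine Finset.sum_congr rfl fun j _ ↦ ?_
  rw [LinearMap.smul_apply, root_apply_coroot_eq he, Int.cast_mul, zsmul_eq_mul]
  rfl

omit [Fintype ι] in
lemma latticeToDual_rootCoord (i : ι) :
    latticeToDual b e (rootCoord b i) = (rootSystem H).root (e i) := by
  have hspan := IsRootSystem.span_coroot_eq_top (P := rootSystem H)
  refine LinearMap.ext_on_range hspan fun α ↦ ?_
  obtain ⟨l, rfl⟩ := e.surjective α
  change (∑ j, rootCoord b i j • (rootSystem H).root (e j)) _ = _
  rw [LinearMap.sum_apply, root_apply_coroot_eq he]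
  have h : P.pairing i l = ∑ j, rootCoord b i j • P.pairing j l := by
    rw [← P.root_coroot_eq_pairing, root_eq_sum_rootCoord b i, map_sum, LinearMap.sum_apply]
    refine Finset.sum_congr rfl fun j _ ↦ ?_
    rw [map_zsmul, LinearMap.smul_apply, P.root_coroot_eq_pairing]
  have h' : P.pairingIn ℤ i l = ∑ j, rootCoord b i j * P.pairingIn ℤ j l := by
    apply (algebraMap ℤ ℝ).injective_int
    rw [algebraMap_pairingIn, h, map_sum]
    refine Finset.sum_congr rfl fun j _ ↦ ?_
    rw [map_mul, algebraMap_pairingIn, zsmul_eq_mul]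
    rfl
  rw [h', Int.cast_sum]
  refine Finset.sum_congr rfl fun j _ ↦ ?_
  rw [LinearMap.smul_apply, root_apply_coroot_eq he, Int.cast_mul, zsmul_eq_mul]

lemma halfSum_apply_coroot (j : ι) :
    halfSum H e b.IsPos ((rootSystem H).coroot (e j)) =
      ((∑ i ∈ posRoots b, P.pairingIn ℤ i j : ℤ) : ℂ) / 2 := by
  rw [halfSum, LinearMap.smul_apply, LinearMap.sum_apply, posRoots, Int.cast_sum, smul_eq_mul,
    one_div, inv_mul_eq_div]
  congr 1
  exact Finset.sum_congr rfl fun i _ ↦ root_apply_coroot_eq he i j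

variable [P.IsReduced]

lemma halfSum_apply_simple_coroot (k : b.support) :
    halfSum H e b.IsPos ((rootSystem H).coroot (e k)) = 1 := by
  rw [halfSum_apply_coroot he, sum_posRoots_pairingIn_simple b k]
  norm_num

/-- The only dominant regular weight of the irreducible module of highest weight `ρ` is `ρ`. Any
weight is `ρ - lam` with `lam` a sum of simple roots; if it is dominant and regular then `lam` pairs
nonpositively with all simple coroots, since `ρ` pairs to one with them. -/
theorem isWeight_isDominant_isRegular_iff [P.IsRootSystem]
    {V : Type*} [AddCommGroup V] [Module ℂ V] [LieRingModule L V] [LieModule ℂ L V]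
    [LieModule.IsIrreducible ℂ L V]
    (hhw : IsHighestWeight H V e b.IsPos (halfSum H e b.IsPos)) (χ : Module.Dual ℂ H) :
    (IsWeight H V χ ∧ IsDominant H e (· ∈ b.support) χ ∧ IsRegular H χ) ↔
      χ = halfSum H e b.IsPos := by
  constructor
  · rintro ⟨hw, hdom, hreg⟩
    obtain ⟨lam, hlam, rfl⟩ : ∃ lam : Lattice b, 0 ≤ lam ∧
        χ = halfSum H e b.IsPos - latticeToDual b e lam := by
      refine mem_of_isWeight e b.IsPos hhw (X := {ψ | ∃ lam : Lattice b, 0 ≤ lam ∧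
        ψ = halfSum H e b.IsPos - latticeToDual b e lam}) ⟨0, le_rfl, by simp⟩ ?_ hw
      rintro _ ⟨lam, hlam, rfl⟩ i hi
      rw [← isPos_reflectionPerm_self b] at hi
      refine ⟨lam + rootCoord b (P.reflectionPerm i i), add_nonneg hlam (rootCoord_nonneg b hi), ?_⟩
      have hneg : rootCoord b (P.reflectionPerm i i) = -rootCoord b i := by
        rw [rootCoord_of_root_eq b (k := P.reflectionPerm i i) (i := i) (j := i) (m := -2)
          (by rw [P.root_reflectionPerm, P.reflection_apply_self]; module)]
        module
      rw [hneg, map_add, map_neg, latticeToDual_rootCoord he]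
      abel
    have hle (k : b.support) : latticePairing b k lam ≤ 0 := by
      obtain ⟨n, hn⟩ := hdom k k.2
      have hn0 : n ≠ 0 := by
        rintro rfl
        exact hreg (e k) (by rw [hn, Nat.cast_zero])
      rw [LinearMap.sub_apply, halfSum_apply_simple_coroot he, latticeToDual_apply_coroot he] at hn
      have hn' : 1 - latticePairing b k lam = n := by exact_mod_cast hn
      lia
    have hlam0 : lam = 0 := by
      by_contra h0
      obtain ⟨k, hk⟩ := exists_latticePairing_pos b hlam h0
      exact (hle k).not_gt hk
    rw [hlam0, map_zero, sub_zero]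
  · rintro rfl
    obtain ⟨v, hv, hvχ, -⟩ := hhw
    refine ⟨⟨v, hv, hvχ⟩, fun k hk ↦ ⟨1, ?_⟩, fun α ↦ ?_⟩
    · rw [halfSum_apply_simple_coroot he ⟨k, hk⟩, Nat.cast_one]
    · obtain ⟨j, rfl⟩ := e.surjective α
      rw [halfSum_apply_coroot he]
      exact div_ne_zero (Int.cast_ne_zero.mpr (sum_posRoots_pairingIn_ne_zero b j)) two_ne_zero

end DominantRegular

end

end WeylMDS

theorem corollary5p7 {ι M M' : Type*} [Fintype ι] [AddCommGroup M] [Module ℝ M]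
    [AddCommGroup M'] [Module ℝ M'] (P : RootPairing ι ℝ M M') [P.IsRootSystem]
    [P.IsCrystallographic] [P.IsReduced] (b : P.Base) (hP : b.cartanMatrix.IsSimplyLaced) :
    (∀ (L : Type*) [LieRing L] [LieAlgebra ℂ L] [FiniteDimensional ℂ L]
        [LieAlgebra.IsKilling ℂ L] (H : LieSubalgebra ℂ L) [H.IsCartanSubalgebra]
        (e : ι ≃ H.root),
      (∀ i j, (LieAlgebra.IsKilling.rootSystem H).pairingIn ℤ (e i) (e j) = P.pairingIn ℤ i j) →
      ∀ (V : Type*) [AddCommGroup V] [Module ℂ V] [LieRingModule L V] [LieModule ℂ L V]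
        [FiniteDimensional ℂ V] [LieModule.IsIrreducible ℂ L V],
      WeylMDS.IsHighestWeight H V e b.IsPos (WeylMDS.halfSum H e b.IsPos) →
      ∀ χ : Module.Dual ℂ H,
        (WeylMDS.IsWeight H V χ ∧ WeylMDS.IsDominant H e (· ∈ b.support) χ ∧
          WeylMDS.IsRegular H χ) ↔ χ = WeylMDS.halfSum H e b.IsPos) ∧
    (∀ q : ℕ, IsPrimePow q →
      ∃ N : MvPolynomial b.support ℂ,
        algebraMap (MvPolynomial b.support ℂ) (WeylMDS.RatField b.support) N =
          WeylMDS.numerator b q 0 ∧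
        ∀ N' : MvPolynomial b.support ℂ,
          (WeylMDS.CoeffFE b q 0 (WeylMDS.coeffZ N') ∧ WeylMDS.coeffZ N' 0 = 1) ↔ N' = N) := by
  refine ⟨fun L _ _ _ _ H _ e he V _ _ _ _ _ _ hhw χ ↦
    WeylMDS.isWeight_isDominant_isRegular_iff he hhw χ, fun q hq ↦ ?_⟩
  have hq0 : q ≠ 0 := hq.ne_zero
  have hc := WeylMDS.sqrtq_ne_zero hq0
  have := WeylMDS.finite_weylGroup b
  have : Fintype P.weylGroup := Fintype.ofFinite _
  obtain ⟨N, hN, hN1⟩ := WeylMDS.isPolyWithConst_numerator hc hP hq.one_lt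
  have hFE := WeylMDS.coeffFE_of_eq_numerator hP hq0 hN
  rw [← WeylMDS.coeffZ_zero_right] at hN1
  refine ⟨N, hN, fun N' ↦ ⟨fun ⟨hFE', hN1'⟩ ↦ ?_, ?_⟩⟩
  · refine sub_eq_zero.mp (WeylMDS.eq_zero_of_coeffZ_eq_zero ?_)
    have hsub : WeylMDS.coeffZ (N' - N) = WeylMDS.coeffZ N' - WeylMDS.coeffZ N :=
      funext fun k ↦ WeylMDS.coeffZ_sub N' N k
    refine WeylMDS.CoeffFE.eq_zero hP hq0 ?_ (fun lam ↦ WeylMDS.coeffZ_of_not_nonneg _)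
      (fun k ↦ ⟨_, fun lam h ↦ WeylMDS.coeffZ_eq_zero_of_degreeOf_lt (N' - N) h⟩) ?_
    · rw [hsub]
      exact hFE'.sub hFE
    · rw [hsub, Pi.sub_apply, hN1, hN1', sub_self]
  · rintro rfl
    exact ⟨hFE, hN1⟩
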